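/- **Notation.** For $n\ge 1$ let $\mathfrak{sp}_{2n}$ be the Lie algebra of the complex $2n\times 2n$ matrices that are skew-adjoint for the form $\langle e_a,e_{2n+1-a}\rangle=1=-\langle e_{2n+1-a},e_a\rangle$ $(1\le a\le n)$, all other $\langle e_a,e_b\rangle$ being $0$. Its diagonal matrices form the Cartan subalgebra $\mathfrak h$ and its upper triangular matrices the Borel subalgebra $\mathfrak b$; $\mathfrak n^-$ is the subalgebra of its strictly lower triangular matrices. Index the positive roots $\alpha_{a,b}$ by the pairs $1\le a<b\le 2n$ with $a+b\le 2n+1$. The root vector $e_{\alpha_{a,b}}\in\mathfrak{sp}_{2n}$ is the matrix $E_{a,b}\pm E_{2n+1-b,2n+1-a}$ ($E_{a,b}$ alone if $a+b=2n+1$), the sign being the one that makes it lie in $\mathfrak{sp}_{2n}$, and $f_{\alpha_{a,b}}$ is likewise $E_{b,a}\pm E_{2n+1-a,2n+1-b}$ ($E_{b,a}$ alone if $a+b=2n+1$). The simple roots are $\alpha_k=\alpha_{k,k+1}$ $(1\le k\le n)$, with simple reflections $r_k$ and fundamental weights $\omega_k$; put $e_k=e_{\alpha_k}$, $f_k=f_{\alpha_k}$,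 $h_k=[e_k,f_k]$. Write $x^{(k)}=x^k/k!$. Let $U_{\mathbb Z}(\mathfrak{sp}_{2n})$ be the subring of the enveloping algebra generated by all $e_\alpha^{(k)}$, $f_\alpha^{(k)}$ and $\binom{h_j}{k}$, let $U_{\mathbb Z}(\mathfrak b)$ be the subring generated by the $e_\alpha^{(k)}$ and $\binom{h_j}{k}$, and $U_{\mathbb Z}(\mathfrak n^-)$ the one generated by the $f_\alpha^{(k)}$. For a dominant integral weight $\lambda$ let $V(\lambda)$ be the irreducible module with highest weight vector $v_\lambda$, and $V_{\mathbb Z}(\lambda)=U_{\mathbb Z}(\mathfrak{sp}_{2n})v_\lambda$. For a word $w=r_{k_1}\cdots r_{k_t}$ in the simple reflections let $v_w=s_{k_1}\cdots s_{k_t}v_\lambda$ with $s_k=\exp(e_k)\exp(-f_k)\exp(e_k)$; the Demazure module is $V_{\mathbb Z}(\lambda)_w=U_{\mathbb Z}(\mathfrak b)v_w$. Let $U_{\mathbb Z}(\mathfrak n^-)_{\le s}$ be the $\mathbb Z$-span of the products $f_{\beta_1}^{(k_1)}\cdots f_{\beta_r}^{(k_r)}$ with $k_1+\dots+k_r\le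 s$. The associated graded ring of $U_{\mathbb Z}(\mathfrak n^-)$ for this filtration is $S^\bullet_{\mathbb Z}(\mathfrak n^-)$, the commutative divided power algebra over $\mathbb Z$ on the $f_\alpha$ (generators $f_\alpha^{(k)}$, relations $f_\alpha^{(0)}=1$, $f_\alpha^{(a)}f_\alpha^{(b)}=\binom{a+b}{a}f_\alpha^{(a+b)}$, and commutativity). Put $V_{\mathbb Z}(\lambda)_{\le s}=U_{\mathbb Z}(\mathfrak n^-)_{\le s}v_\lambda$ (and $0$ for $s=-1$). The associated graded group $$V_{\mathbb Z}(\lambda)^a=\bigoplus_{s\ge 0}V_{\mathbb Z}(\lambda)_{\le s}/V_{\mathbb Z}(\lambda)_{\le s-1}$$ is an $S^\bullet_{\mathbb Z}(\mathfrak n^-)$-module. **Setting.** Let $m\ge 1$. Objects attached to $\mathfrak{sp}_{2m}$ are written without, those attached to $\mathfrak{sp}_{4m}$ with a tilde (the latter with $n=2m$). Let $\Psi$ be the linear map of weights with $\Psi\bigl(\sum_{j=1}^m a_j\omega_j\bigr)=\sum_{j=1}^m a_j\tilde\omega_{2j}$, and $$\bar\tau=(r_{2m}\cdots r_{m+1})\cdots(r_{2m}r_{2m-1})\,r_{2m}\,(r_m\cdots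 r_{2m-2})\cdots(r_3r_4)\,r_2$$ in the Weyl group of $\mathfrak{sp}_{4m}$. For a positive root $\alpha=\alpha_{a,b}$ of $\mathfrak{sp}_{2m}$ put $\varphi(\alpha)=\tilde\alpha_{b,a+2m}$, a positive root of $\mathfrak{sp}_{4m}$. The vectors $\tilde e_{\varphi(\alpha)}$ commute with each other, so $f_\alpha^{(k)}\mapsto\tilde e_{\varphi(\alpha)}^{(k)}$ defines a ring homomorphism $S^\bullet_{\mathbb Z}(\mathfrak n^-)\to U_{\mathbb Z}(\tilde{\mathfrak b})$, through which every Demazure module of $\mathfrak{sp}_{4m}$ is an $S^\bullet_{\mathbb Z}(\mathfrak n^-)$-module. **Lemma.** For all $m\ge1$, $1\le i\le m$ and $\ell\ge 0$, the Demazure module $\tilde V_{\mathbb Z}(\Psi(\ell\omega_i))_{\bar\tau}$ is contained in $\tilde V_{\mathbb Z}(\Psi(\ell\omega_i))$, and $\tilde V_{\mathbb Z}(\Psi(\ell\omega_i))_{\bar\tau}$ and $V_{\mathbb Z}(\ell\omega_i)^a$ are isomorphic as $S^\bullet_{\mathbb Z}(\mathfrak n^-)$-modules. -/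

import Mathlib

open scoped Nat

noncomputable section

namespace SympPBW

attribute [local instance 100] LieRing.ofAssociativeRing

/-! ### The symplectic Lie algebra and its Chevalley basis -/

/-- Rows and columns are numbered from `0` to `2n - 1`; `i.rev` is the index opposite to `i`. -/
def sgn (n : ℕ) (i : Fin (2 * n)) : ℂ := if (i : ℕ) < n then 1 else -1

/-- The skew-symmetric form with `⟨e_i, e_{i.rev}⟩ = 1` for `i` in the first half of the indices,
`-1` for `i` in the second half, and `⟨e_i, e_j⟩ = 0` otherwise. -/
def form (n : ℕ) : Matrix (Fin (2 * n)) (Fin (2 * n)) ℂ :=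
  Matrix.of fun i j => if j = i.rev then sgn n i else 0

/-- The symplectic Lie algebra of rank `n`; its diagonal matrices form the Cartan subalgebra, its
upper triangular matrices the Borel subalgebra. -/
abbrev sp (n : ℕ) : LieSubalgebra ℂ (Matrix (Fin (2 * n)) (Fin (2 * n)) ℂ) :=
  skewAdjointMatricesLieSubalgebra (form n)

/-- For `i ≠ j`, the root vector `E_{i,j} ± E_{j.rev,i.rev}` of the symplectic Lie algebra, with
the sign that makes it skew-adjoint; it is `E_{i,j}` when `j = i.rev`. -/
def rootMat (n : ℕ) (i j : Fin (2 * n)) : Matrix (Fin (2 * n)) (Fin (2 * n)) ℂ :=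
  Matrix.of fun a b =>
    if a = i ∧ b = j then 1
    else if a = j.rev ∧ b = i.rev then -(sgn n i * sgn n j) else 0

theorem sgn_rev (n : ℕ) (i : Fin (2 * n)) : sgn n i.rev = - sgn n i := by
  unfold sgn
  have := i.2
  simp only [Fin.val_rev]
  split_ifs <;> first | omega | simp

theorem sgn_mul_self (n : ℕ) (i : Fin (2 * n)) : sgn n i * sgn n i = 1 := by
  unfold sgn; split_ifs <;> simp

theorem mem_sp_of (n : ℕ) (A : Matrix (Fin (2 * n)) (Fin (2 * n)) ℂ)
    (h : ∀ a b, A a b = -(sgn n a * sgn n b) * A b.rev a.rev) : A ∈ sp n := by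
  rw [mem_skewAdjointMatricesLieSubalgebra, mem_skewAdjointMatricesSubmodule]
  unfold Matrix.IsSkewAdjoint Matrix.IsAdjointPair
  rw [← Matrix.ext_iff]
  have h1 : ∀ a b, (A.transpose * form n) a b = A b.rev a * sgn n b.rev := by
    intro a b
    rw [Matrix.mul_apply, Finset.sum_eq_single b.rev]
    · simp [form]
    · intro c _ hc
      have : b ≠ c.rev := fun h => hc (by simp [h])
      simp [form, this]
    · simp
  have h2 : ∀ a b, (form n * (-A)) a b = - (sgn n a * A a.rev b) := by
    intro a b
    rw [Matrix.mul_apply, Finset.sum_eq_single a.rev]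
    · simp [form]
    · intro c _ hc
      simp [form, hc]
    · simp
  intro a b
  rw [h1, h2, h b.rev a, Fin.rev_rev, sgn_rev]
  linear_combination (-sgn n a * A a.rev b) * sgn_mul_self n b

theorem rootMat_mem (n : ℕ) (i j : Fin (2 * n)) : rootMat n i j ∈ sp n := by
  apply mem_sp_of
  intro a b
  simp only [rootMat, Matrix.of_apply, Fin.rev_eq_iff, Fin.rev_rev]
  have hi := sgn_mul_self n i
  have hj := sgn_mul_self n j
  by_cases h1 : a = i ∧ b = j
  · obtain ⟨rfl, rfl⟩ := h1
    by_cases h2 : b = a.rev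
    · subst h2
      simp [sgn_rev, hi]
    · simp [h2]
      linear_combination (-(sgn n b * sgn n b)) * hi - hj
  · by_cases h3 : a = j.rev ∧ b = i.rev
    · obtain ⟨rfl, rfl⟩ := h3
      simp [h1, sgn_rev]
      ring
    · have h3' : ¬ (b = i.rev ∧ a = j.rev) := fun h => h3 h.symm
      have h1' : ¬ (b = j ∧ a = i) := fun h => h1 h.symm
      simp [h1, h3, h3', h1']

/-- The root vector, as an element of the symplectic Lie algebra. -/
def rootVec (n : ℕ) (i j : Fin (2 * n)) : sp n := ⟨rootMat n i j, rootMat_mem n i j⟩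

/-- The positive roots: the pairs `i < j` on or above the antidiagonal. -/
abbrev PosRoot (n : ℕ) : Type :=
  {p : Fin (2 * n) × Fin (2 * n) // p.1 < p.2 ∧ (p.1 : ℕ) + p.2 < 2 * n}

/-- The `k`-th simple root, with `k` counted from `0`; the last one is long. -/
def simpleRoot {n : ℕ} (k : Fin n) : PosRoot n :=
  ⟨(⟨k, by omega⟩, ⟨k + 1, by omega⟩), by simp [Fin.lt_def], by simp; omega⟩

/-- The complex enveloping algebra. -/
abbrev U (n : ℕ) : Type := UniversalEnvelopingAlgebra ℂ (sp n)

/-- The Chevalley generator `e_α`. -/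
def eVec {n : ℕ} (α : PosRoot n) : U n :=
  UniversalEnvelopingAlgebra.ι ℂ (rootVec n α.1.1 α.1.2)

/-- The Chevalley generator `f_α`. -/
def fVec {n : ℕ} (α : PosRoot n) : U n :=
  UniversalEnvelopingAlgebra.ι ℂ (rootVec n α.1.2 α.1.1)

/-- The simple coroot `h_k = [e_k, f_k]`. -/
def hVec {n : ℕ} (k : Fin n) : U n :=
  UniversalEnvelopingAlgebra.ι ℂ ⁅rootVec n (simpleRoot k).1.1 (simpleRoot k).1.2,
    rootVec n (simpleRoot k).1.2 (simpleRoot k).1.1⁆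

/-! ### Hyperalgebras -/

/-- The divided power `x ^ k / k!`. -/
def divPow {A : Type*} [Ring A] [Algebra ℂ A] (x : A) (k : ℕ) : A := ((k ! : ℂ))⁻¹ • x ^ k

/-- The binomial coefficient `x (x - 1) ⋯ (x - k + 1) / k!`. -/
def binom {A : Type*} [Ring A] [Algebra ℂ A] (x : A) (k : ℕ) : A :=
  ((k ! : ℂ))⁻¹ • Polynomial.aeval x (descPochhammer ℂ k)

/-- The hyperalgebra `U_ℤ(𝔤)`. -/
def UZ (n : ℕ) : Subalgebra ℤ (U n) :=
  Algebra.adjoin ℤ ({x | ∃ (α : PosRoot n) (k : ℕ), x = divPow (eVec α) k} ∪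
    {x | ∃ (α : PosRoot n) (k : ℕ), x = divPow (fVec α) k} ∪
    {x | ∃ (i : Fin n) (k : ℕ), x = binom (hVec i) k})

/-- The hyperalgebra `U_ℤ(𝔟)` of the Borel subalgebra. -/
def UZb (n : ℕ) : Subalgebra ℤ (U n) :=
  Algebra.adjoin ℤ ({x | ∃ (α : PosRoot n) (k : ℕ), x = divPow (eVec α) k} ∪
    {x | ∃ (i : Fin n) (k : ℕ), x = binom (hVec i) k})

/-! ### Weights and irreducible modules -/

/-- Integral weights, given by their coordinates `⟨α_k^∨, λ⟩` in the basis of fundamental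
weights. -/
abbrev Weight (n : ℕ) : Type := Fin n → ℤ

/-- The fundamental weights, counted from `0`. -/
def fundWeight {n : ℕ} (k : Fin n) : Weight n := Pi.single k 1

/-- The left ideal generated by all `e_α` and all `h_k - ⟨α_k^∨, λ⟩`. -/
def vermaIdeal {n : ℕ} (lam : Weight n) : Submodule (U n) (U n) :=
  Submodule.span (U n)
    (Set.range eVec ∪ Set.range fun k => hVec k - algebraMap ℂ (U n) (lam k))

/-- The Verma module of highest weight `λ`. -/
abbrev Verma {n : ℕ} (lam : Weight n) : Type := U n ⧸ vermaIdeal lam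

/-- The sum of all proper submodules of the Verma module, which is its largest proper
submodule. -/
def maxSub {n : ℕ} (lam : Weight n) : Submodule (U n) (Verma lam) := sSup {N | N ≠ ⊤}

/-- The irreducible module `V(λ)` of highest weight `λ`: the irreducible quotient of the Verma
module. -/
def V {n : ℕ} (lam : Weight n) : Type := Verma lam ⧸ maxSub lam

instance {n : ℕ} (lam : Weight n) : AddCommGroup (V lam) :=
  inferInstanceAs (AddCommGroup (Verma lam ⧸ maxSub lam))

instance {n : ℕ} (lam : Weight n) : Module (U n) (V lam) :=
  inferInstanceAs (Module (U n) (Verma lam ⧸ maxSub lam))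

/-- The highest weight vector `v_λ`. -/
def hwVec {n : ℕ} (lam : Weight n) : V lam := (maxSub lam).mkQ ((vermaIdeal lam).mkQ 1)

/-- The integral form `V_ℤ(λ) = U_ℤ(𝔤) v_λ`. -/
def VZ {n : ℕ} (lam : Weight n) : Submodule (UZ n) (V lam) := Submodule.span (UZ n) {hwVec lam}

/-! ### Demazure modules -/

/-- The action of `exp x` for `x` acting locally nilpotently: `∑ x ^ k / k! • v`. -/
def expAct {n : ℕ} {lam : Weight n} (x : U n) (v : V lam) : V lam := ∑ᶠ k : ℕ, divPow x k • v

/-- The action of the representative `exp(e_k) exp(-f_k) exp(e_k)` in the simply connected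
Chevalley group of the simple reflection `r_k`. -/
def reflAct {n : ℕ} {lam : Weight n} (k : Fin n) (v : V lam) : V lam :=
  expAct (eVec (simpleRoot k)) (expAct (-fVec (simpleRoot k)) (expAct (eVec (simpleRoot k)) v))

/-- The extremal weight vector `v_w` for `w` the product of the simple reflections listed. -/
def extremalVec {n : ℕ} (lam : Weight n) (w : List (Fin n)) : V lam := w.foldr reflAct (hwVec lam)

/-- The Demazure module `V_ℤ(λ)_w = U_ℤ(𝔟) v_w`. -/
def demazure {n : ℕ} (lam : Weight n) (w : List (Fin n)) : Submodule (UZb n) (V lam) :=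
  Submodule.span (UZb n) {extremalVec lam w}

/-- The word, with simple reflections of the Weyl group of rank `2m` numbered from `1`,
`(r_{2m} ⋯ r_{m+1}) ⋯ (r_{2m} r_{2m-1}) r_{2m} (r_m ⋯ r_{2m-2}) ⋯ (r_3 r_4) r_2`. -/
def tauWord (m : ℕ) : List (Fin (2 * m)) :=
  ((List.finRange m).reverse.flatMap fun k : Fin m =>
    (List.finRange ((k : ℕ) + 1)).map fun j => ⟨2 * m - 1 - j, by omega⟩) ++
  ((List.finRange m).reverse.flatMap fun k : Fin m =>
    (List.finRange (k : ℕ)).map fun j => ⟨(k : ℕ) + j, by omega⟩)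

/-- The map `Ψ(∑ a_i ω_i) = ∑ a_i ω̃_{2i}` (fundamental weights numbered from `1` here). -/
def Psi {m : ℕ} (lam : Weight m) : Weight (2 * m) :=
  ∑ i : Fin m, lam i • fundWeight (n := 2 * m) ⟨2 * (i : ℕ) + 1, by omega⟩

/-! ### The algebra `S_ℤ(𝔫⁻)` -/

/-- The relations of the divided power algebra on the free abelian group with basis `f_α`; the
generator `(α, k)` is `f_α^{(k)}`. -/
inductive SRel (m : ℕ) : FreeAlgebra ℤ (PosRoot m × ℕ) → FreeAlgebra ℤ (PosRoot m × ℕ) → Prop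
  | zero (α : PosRoot m) : SRel m (FreeAlgebra.ι ℤ (α, 0)) 1
  | mul (α : PosRoot m) (a b : ℕ) :
      SRel m (FreeAlgebra.ι ℤ (α, a) * FreeAlgebra.ι ℤ (α, b))
        ((a + b).choose a • FreeAlgebra.ι ℤ (α, a + b))
  | comm (α β : PosRoot m) (a b : ℕ) :
      SRel m (FreeAlgebra.ι ℤ (α, a) * FreeAlgebra.ι ℤ (β, b))
        (FreeAlgebra.ι ℤ (β, b) * FreeAlgebra.ι ℤ (α, a))

/-- The algebra `S_ℤ(𝔫⁻)`, the associated graded algebra of `U_ℤ(𝔫⁻)` for the PBW filtration: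
the commutative divided power algebra over `ℤ` on the basis `f_α` of `𝔫⁻_ℤ`. -/
abbrev SZ (m : ℕ) : Type := RingQuot (SRel m)

/-- The map `φ` sending the positive root `α_{i,j}` of rank `m` to the positive root
`α̃_{j,i+2m}` of rank `2m`. The root vector `f_α` is a lower triangular matrix `A` in `𝔰𝔭_{2m}`, and
`e_{φ(α)}` is the block matrix with upper right block `η(A)`, where `η` changes the signs of the
entries in the lower right quarter. -/
def phi {m : ℕ} (α : PosRoot m) : PosRoot (2 * m) :=
  ⟨(⟨α.1.2, by omega⟩, ⟨α.1.1 + 2 * m, by omega⟩),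
    by have := α.2.1; simp only [Fin.lt_def] at this ⊢; omega,
    by have := α.2.2; simp only; omega⟩

/-! ### Divided powers -/

theorem divPow_zero {A : Type*} [Ring A] [Algebra ℂ A] (x : A) : divPow x 0 = 1 := by
  simp [divPow]

theorem divPow_mul {A : Type*} [Ring A] [Algebra ℂ A] (x : A) (a b : ℕ) :
    divPow x a * divPow x b = (a + b).choose a • divPow x (a + b) := by
  unfold divPow
  rw [smul_mul_smul_comm, ← pow_add, ← Nat.cast_smul_eq_nsmul ℂ, smul_smul]
  congr 1
  have h := Nat.choose_mul_factorial_mul_factorial (Nat.le_add_right a b)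
  rw [Nat.add_sub_cancel_left] at h
  have ha : ((a ! : ℕ) : ℂ) ≠ 0 := by exact_mod_cast a.factorial_ne_zero
  have hb : ((b ! : ℕ) : ℂ) ≠ 0 := by exact_mod_cast b.factorial_ne_zero
  have hab : (((a + b)! : ℕ) : ℂ) ≠ 0 := by exact_mod_cast (a + b).factorial_ne_zero
  have h' : ((a + b).choose a : ℂ) * a ! * b ! = ((a + b)! : ℕ) := by exact_mod_cast h
  field_simp
  linear_combination -h'

theorem divPow_commute {A : Type*} [Ring A] [Algebra ℂ A] {x y : A} (h : Commute x y) (a b : ℕ) :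
    Commute (divPow x a) (divPow y b) := by
  unfold divPow
  exact ((h.pow_pow a b).smul_left _).smul_right _

theorem divPow_zsmul {A : Type*} [Ring A] [Algebra ℂ A] (c : ℤ) (x : A) (k : ℕ) :
    divPow (c • x) k = c ^ k • divPow x k := by
  unfold divPow
  rw [smul_pow, smul_comm]

theorem succ_smul_divPow {A : Type*} [Ring A] [Algebra ℂ A] (x : A) (k : ℕ) :
    ((k : ℂ) + 1) • divPow x (k + 1) = divPow x k * x := by
  unfold divPow
  rw [smul_smul, smul_mul_assoc, ← pow_succ]
  congr 1
  rw [Nat.factorial_succ]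
  have ha : ((k ! : ℕ) : ℂ) ≠ 0 := by exact_mod_cast k.factorial_ne_zero
  have : (k : ℂ) + 1 ≠ 0 := by exact_mod_cast k.succ_ne_zero
  push_cast
  field_simp

theorem divPow_add {A : Type*} [Ring A] [Algebra ℂ A] {x y : A} (h : Commute x y) (a : ℕ) :
    divPow (x + y) a = ∑ p ∈ Finset.HasAntidiagonal.antidiagonal a, divPow x p.1 * divPow y p.2 := by
  unfold divPow
  rw [h.add_pow', Finset.smul_sum]
  refine Finset.sum_congr rfl fun p hp => ?_
  rw [Finset.HasAntidiagonal.mem_antidiagonal] at hp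
  subst hp
  rw [smul_mul_smul_comm, ← Nat.cast_smul_eq_nsmul ℂ, smul_smul]
  congr 1
  have h := Nat.choose_mul_factorial_mul_factorial (Nat.le_add_right p.1 p.2)
  rw [Nat.add_sub_cancel_left] at h
  have ha : ((p.1 ! : ℕ) : ℂ) ≠ 0 := by exact_mod_cast p.1.factorial_ne_zero
  have hb : ((p.2 ! : ℕ) : ℂ) ≠ 0 := by exact_mod_cast p.2.factorial_ne_zero
  have hab : (((p.1 + p.2)! : ℕ) : ℂ) ≠ 0 := by exact_mod_cast (p.1 + p.2).factorial_ne_zero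
  have h' : ((p.1 + p.2).choose p.1 : ℂ) * p.1 ! * p.2 ! = ((p.1 + p.2)! : ℕ) := by
    exact_mod_cast h
  field_simp
  linear_combination h'

/-- If `[y, x] = z`, `[y, z] = 2u` and `[y, u] = 0`, then the generating series of the divided powers
of `y` intertwines `x` and `x + z X + u X ^ 2`. -/
theorem semiconj_divPow {A : Type*} [Ring A] [Algebra ℂ A] {x y z u : A}
    (hyx : y * x = x * y + z) (hyz : y * z = z * y + (2 : ℂ) • u) (hyu : y * u = u * y) :
    SemiconjBy (PowerSeries.mk fun b => divPow y b) (PowerSeries.C x)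
      (PowerSeries.C x + (PowerSeries.C z * PowerSeries.X + PowerSeries.C u * PowerSeries.X ^ 2)) := by
  have h1 : ∀ b : ℕ, y * divPow y b = divPow y b * y := fun b => by
    have := divPow_commute (Commute.refl y) 1 b
    simpa [divPow] using this.eq
  have hu : ∀ b : ℕ, divPow y b * u = u * divPow y b := fun b => by
    have := divPow_commute (show Commute y u from hyu) b 1
    simpa [divPow] using this.eq
  have hz : ∀ b : ℕ, divPow y (b + 1) * z = z * divPow y (b + 1) + (2 : ℂ) • (u * divPow y b) := by
    intro b
    induction b with
    | zero => simpa [divPow] using hyz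
    | succ b ih =>
      have hne : ((b + 1 : ℕ) : ℂ) + 1 ≠ 0 := by exact_mod_cast (b + 1).succ_ne_zero
      apply smul_right_injective A hne
      have e1 := succ_smul_divPow y (b + 1)
      have e2 := succ_smul_divPow y b
      simp only [smul_add]
      rw [← smul_mul_assoc, e1, mul_assoc, hyz, mul_add, ← mul_assoc, ih, add_mul, mul_assoc z,
        ← e1, mul_smul_comm, mul_smul_comm, hu, smul_mul_assoc, mul_assoc u, ← e2,
        mul_smul_comm]
      push_cast
      module
  have hx1 : ∀ b : ℕ, divPow y (b + 2) * x =
      x * divPow y (b + 2) + z * divPow y (b + 1) + u * divPow y b := by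
    intro b
    induction b with
    | zero =>
      have hne : ((1 : ℕ) : ℂ) + 1 ≠ 0 := by norm_num
      apply smul_right_injective A hne
      have e1 := succ_smul_divPow y 1
      have hy1 : divPow y 1 = y := by simp [divPow]
      simp only [smul_add]
      rw [zero_add, ← smul_mul_assoc, ← mul_smul_comm, e1, hy1, divPow_zero, mul_assoc, hyx, mul_add,
        ← mul_assoc, hyx, hyz, add_mul, mul_one, mul_assoc]
      push_cast
      module
    | succ b ih =>
      have hne : ((b + 2 : ℕ) : ℂ) + 1 ≠ 0 := by exact_mod_cast (b + 2).succ_ne_zero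
      apply smul_right_injective A hne
      have e1 := succ_smul_divPow y (b + 2)
      have e2 := succ_smul_divPow y (b + 1)
      have e3 := succ_smul_divPow y b
      simp only [smul_add]
      rw [← smul_mul_assoc, e1, mul_assoc, hyx, mul_add, ← mul_assoc, ih, add_mul, add_mul,
        mul_assoc x, ← e1, mul_assoc z, ← e2, mul_assoc u, ← e3, hz (b + 1)]
      simp only [mul_smul_comm]
      push_cast
      module
  unfold SemiconjBy
  ext b
  have hy1 : divPow y 1 = y := by simp [divPow]
  rcases b with _ | _ | b
  · simp [add_mul, mul_assoc, divPow_zero]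
  · simp only [zero_add, PowerSeries.coeff_mul_C, PowerSeries.coeff_mk, add_mul, mul_assoc, map_add,
      PowerSeries.coeff_C_mul]
    rw [show (1 : ℕ) = 0 + 1 from rfl, PowerSeries.coeff_succ_X_mul, pow_two, mul_assoc,
      PowerSeries.coeff_succ_X_mul]
    simp [hy1, hyx, divPow_zero]
  · simp only [PowerSeries.coeff_mul_C, PowerSeries.coeff_mk, add_mul, mul_assoc, map_add,
      PowerSeries.coeff_C_mul]
    rw [PowerSeries.coeff_succ_X_mul, pow_two, mul_assoc, PowerSeries.coeff_succ_X_mul,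
      PowerSeries.coeff_succ_X_mul]
    simp only [PowerSeries.coeff_mk, hx1]
    abel

theorem C_divPow {A : Type*} [Ring A] [Algebra ℂ A] (w : A) (k : ℕ) :
    PowerSeries.C (divPow w k) = divPow (PowerSeries.C w) k := by
  unfold divPow
  rw [← map_pow]
  ext t
  rw [PowerSeries.coeff_smul, PowerSeries.coeff_C, PowerSeries.coeff_C]
  split_ifs <;> simp

/-- Divided powers of `x` and `y` commute up to lower degree terms. -/
theorem comm_mem_aux {A : Type*} [Ring A] [Algebra ℂ A] {G : ℕ → Submodule ℤ A}
    (hG : ∀ {s t r : ℕ} {x y : A}, x ∈ G s → y ∈ G t → s + t ≤ r + 1 → x * y ∈ G r) {x y z u : A}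
    (hyx : y * x = x * y + z) (hyz : y * z = z * y + (2 : ℂ) • u) (hyu : y * u = u * y)
    (hxz : Commute x z) (hxu : Commute x u) (hzu : Commute z u)
    (hx : ∀ k, divPow x k ∈ G (k + 1)) (hy : ∀ k, divPow y k ∈ G (k + 1))
    (hz : ∀ k, divPow z k ∈ G (k + 1)) (hu : ∀ k, divPow u k ∈ G (k + 1)) (a b : ℕ) :
    divPow y b * divPow x a - divPow x a * divPow y b ∈ G (a + b) := by
  have hdC : ∀ (w : A) (j k : ℕ), divPow (PowerSeries.C w * PowerSeries.X ^ j) k =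
      PowerSeries.C (divPow w k) * PowerSeries.X ^ (j * k) := by
    intro w j k
    rw [C_divPow]
    unfold divPow
    have hc : Commute (PowerSeries.C w) (PowerSeries.X ^ j) :=
      ((PowerSeries.commute_X (PowerSeries.C w)).pow_right j)
    rw [hc.mul_pow, ← pow_mul, ← smul_mul_assoc]
  have hCC : ∀ {v w : A} (j l : ℕ), Commute v w →
      Commute (PowerSeries.C v * PowerSeries.X ^ j) (PowerSeries.C w * PowerSeries.X ^ l) := by
    intro v w j l hvw
    have hX : ∀ (p : PowerSeries A) (r : ℕ), Commute p (PowerSeries.X ^ r) :=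
      fun p r => (PowerSeries.commute_X p).pow_right r
    refine Commute.mul_left (Commute.mul_right ?_ (hX _ _)) (hX _ _).symm
    unfold Commute SemiconjBy
    rw [← map_mul, ← map_mul, hvw.eq]
  set W : PowerSeries A := PowerSeries.C x +
    (PowerSeries.C z * PowerSeries.X + PowerSeries.C u * PowerSeries.X ^ 2) with hW
  have hW' : W = PowerSeries.C x * PowerSeries.X ^ 0 +
    (PowerSeries.C z * PowerSeries.X ^ 1 + PowerSeries.C u * PowerSeries.X ^ 2) := by
    simp [hW]
  have hcoeff : ∀ k, PowerSeries.coeff k (divPow W a) ∈ G (a + 1) := by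
    intro k
    rw [hW', divPow_add ((hCC 0 1 hxz).add_right (hCC 0 2 hxu)), map_sum]
    refine Submodule.sum_mem _ fun p hp => ?_
    rw [divPow_add (hCC 1 2 hzu), Finset.mul_sum, map_sum]
    refine Submodule.sum_mem _ fun q hq => ?_
    rw [Finset.HasAntidiagonal.mem_antidiagonal] at hp hq
    rw [hdC, hdC, hdC]
    have : PowerSeries.C (divPow x p.1) * PowerSeries.X ^ (0 * p.1) *
        (PowerSeries.C (divPow z q.1) * PowerSeries.X ^ (1 * q.1) *
          (PowerSeries.C (divPow u q.2) * PowerSeries.X ^ (2 * q.2))) =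
        PowerSeries.C (divPow x p.1 * divPow z q.1 * divPow u q.2) *
          PowerSeries.X ^ (q.1 + 2 * q.2) := by
      rw [zero_mul, pow_zero, mul_one, one_mul, mul_assoc (PowerSeries.C (divPow z q.1)),
        ← mul_assoc (PowerSeries.X ^ q.1),
        ((PowerSeries.commute_X (PowerSeries.C (divPow u q.2))).pow_right q.1).symm.eq,
        map_mul, map_mul, pow_add]
      simp only [mul_assoc]
    rw [this, PowerSeries.coeff_C_mul, PowerSeries.coeff_X_pow]
    split_ifs
    · rw [mul_one]
      exact hG (hG (hx _) (hz _) (show _ ≤ (p.1 + q.1 + 1) + 1 by omega)) (hu _)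
        (by omega)
    · simp
  have hcoeff0 : PowerSeries.coeff 0 (divPow W a) = divPow x a := by
    unfold divPow
    rw [PowerSeries.coeff_smul, PowerSeries.coeff_zero_eq_constantCoeff_apply, map_pow]
    simp [hW]
  have key : (PowerSeries.mk fun b => divPow y b) * PowerSeries.C (divPow x a) =
      divPow W a * (PowerSeries.mk fun b => divPow y b) := by
    have h := ((semiconj_divPow hyx hyz hyu).pow_right a).eq
    rw [C_divPow, divPow, mul_smul_comm, h, ← smul_mul_assoc]
    rfl
  have key2 := congrArg (PowerSeries.coeff b) key
  rw [PowerSeries.coeff_mul_C, PowerSeries.coeff_mk, PowerSeries.coeff_mul] at key2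
  rw [key2, ← Finset.add_sum_erase _ _ (show (0, b) ∈ Finset.HasAntidiagonal.antidiagonal b by simp)]
  simp only [hcoeff0, PowerSeries.coeff_mk, add_sub_cancel_left]
  refine Submodule.sum_mem _ fun p hp => ?_
  rw [Finset.mem_erase, Finset.HasAntidiagonal.mem_antidiagonal] at hp
  have hp1 : p.1 ≠ 0 := fun h => hp.1 (by ext <;> simp <;> omega)
  exact hG (hcoeff _) (hy _) (by omega)

/-! ### The PBW filtration -/

/-- The part of degree `< s` of the PBW filtration: the `ℤ`-span of the products of divided powers
`f_{α_1}^{(k_1)} ⋯ f_{α_r}^{(k_r)}` with `k_1 + ⋯ + k_r < s`. -/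
def pbw (n : ℕ) (s : ℕ) : Submodule ℤ (U n) :=
  Submodule.span ℤ {x | ∃ L : List (PosRoot n × ℕ), (L.map Prod.snd).sum < s ∧
    x = (L.map fun p => divPow (fVec p.1) p.2).prod}

theorem pbw_mono {n s t : ℕ} (h : s ≤ t) : pbw n s ≤ pbw n t :=
  Submodule.span_mono fun _ ⟨L, hL, hx⟩ => ⟨L, hL.trans_le h, hx⟩

theorem divPow_mem_pbw {n : ℕ} (α : PosRoot n) (k : ℕ) : divPow (fVec α) k ∈ pbw n (k + 1) :=
  Submodule.subset_span ⟨[(α, k)], by simp, by simp⟩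

theorem mul_mem_pbw {n s t r : ℕ} {x y : U n} (hx : x ∈ pbw n s) (hy : y ∈ pbw n t)
    (h : s + t ≤ r + 1) : x * y ∈ pbw n r := by
  induction hx using Submodule.span_induction with
  | zero => simp
  | add a b _ _ ha hb => rw [add_mul]; exact add_mem ha hb
  | smul c a _ ha => rw [smul_mul_assoc]; exact Submodule.smul_mem _ _ ha
  | mem a ha =>
    obtain ⟨L, hL, rfl⟩ := ha
    induction hy using Submodule.span_induction with
    | zero => simp
    | add a b _ _ ha hb => rw [mul_add]; exact add_mem ha hb
    | smul c a _ ha => rw [mul_smul_comm]; exact Submodule.smul_mem _ _ ha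
    | mem b hb =>
      obtain ⟨M, hM, rfl⟩ := hb
      exact Submodule.subset_span ⟨L ++ M, by simp; omega, by simp⟩

theorem single_mul_single {n : ℕ} (i j k l : Fin (2 * n)) (c d : ℂ) :
    Matrix.single i j c * Matrix.single k l d = if j = k then Matrix.single i l (c * d) else 0 := by
  split_ifs with h
  · subst h; simp
  · exact Matrix.single_mul_single_of_ne (h := h) ..

theorem rootMat_eq (n : ℕ) (i j : Fin (2 * n)) : rootMat n i j = Matrix.single i j 1 +
    Matrix.single j.rev i.rev (if j = i.rev then 0 else -(sgn n i * sgn n j)) := by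
  ext a b
  simp only [rootMat, Matrix.of_apply, Matrix.add_apply, Matrix.single_apply]
  by_cases h1 : a = i ∧ b = j
  · obtain ⟨rfl, rfl⟩ := h1
    by_cases h : b = a.rev
    · simp [h]
    · have : ¬ b.rev = a := fun h' => h (by simp [← h'])
      simp [this]
  · have h1' : ¬ (i = a ∧ j = b) := fun h => h1 ⟨h.1.symm, h.2.symm⟩
    by_cases h2 : a = j.rev ∧ b = i.rev
    · obtain ⟨rfl, rfl⟩ := h2
      have : ¬ j = i.rev := fun h => h1 (by simp [h])
      simp [h1, this]
    · have h2' : ¬ (j.rev = a ∧ i.rev = b) := fun h => h2 ⟨h.1.symm, h.2.symm⟩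
      simp [h1, h1', h2, h2']

/-- The root vectors in the enveloping algebra. -/
def rootU {n : ℕ} (i j : Fin (2 * n)) : U n := UniversalEnvelopingAlgebra.ι ℂ (rootVec n i j)

theorem rootU_mul {n : ℕ} (p q r s : Fin (2 * n)) (x : sp n)
    (h : rootMat n p q * rootMat n r s = rootMat n r s * rootMat n p q + x) :
    (rootU p q : U n) * rootU r s = rootU r s * rootU p q + UniversalEnvelopingAlgebra.ι ℂ x := by
  have : ⁅rootVec n p q, rootVec n r s⁆ = x := by
    apply Subtype.ext
    rw [LieSubalgebra.coe_bracket, Ring.lie_def]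
    simp only [rootVec]
    rw [h]; abel
  rw [← this, LieHom.map_lie, Ring.lie_def, rootU, rootU]
  abel

theorem rootMat_mul_zero {n : ℕ} {p q r s : Fin (2 * n)} (h1 : q ≠ r) (h2 : q ≠ s.rev)
    (h3 : p ≠ r.rev) (h4 : p ≠ s) : rootMat n p q * rootMat n r s = 0 := by
  have h3' : p.rev ≠ r := fun h => h3 (by simp [← h])
  have h4' : p.rev ≠ s.rev := fun h => h4 (by simpa using h)
  rw [rootMat_eq, rootMat_eq]
  simp [add_mul, mul_add, h1, h2, h3', h4]

theorem rootU_commute {n : ℕ} {p q r s : Fin (2 * n)} (h1 : q ≠ r) (h2 : q ≠ s.rev)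
    (h3 : p ≠ r.rev) (h4 : p ≠ s) : Commute (rootU p q : U n) (rootU r s) := by
  have := rootU_mul p q r s 0 (by
    rw [rootMat_mul_zero h1 h2 h3 h4, rootMat_mul_zero h4.symm, ZeroMemClass.coe_zero, add_zero]
    · exact fun h => h2 (by simp [h])
    · exact fun h => h3 (by simp [h])
    · exact h1.symm)
  simpa [Commute, SemiconjBy] using this

theorem exists_sgn (n : ℕ) (i j : Fin (2 * n)) : ∃ c : ℤ, sgn n i * sgn n j = c := by
  unfold sgn
  split_ifs
  · exact ⟨1, by simp⟩
  · exact ⟨-1, by simp⟩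
  · exact ⟨-1, by simp⟩
  · exact ⟨1, by simp⟩

theorem ι_zsmul_rootVec {n : ℕ} (c : ℤ) (p q : Fin (2 * n)) :
    UniversalEnvelopingAlgebra.ι ℂ (c • rootVec n p q) = c • (rootU p q : U n) := by
  rw [map_zsmul]; rfl

theorem coe_zsmul_rootVec {n : ℕ} (c : ℤ) (p q : Fin (2 * n)) :
    ((c • rootVec n p q : sp n) : Matrix (Fin (2 * n)) (Fin (2 * n)) ℂ) =
      (c : ℂ) • rootMat n p q := by
  rw [← Int.cast_smul_eq_zsmul ℂ]; rfl

theorem rootU_flip {n : ℕ} (p q : Fin (2 * n)) :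
    ∃ c : ℤ, (rootU p q : U n) = c • rootU q.rev p.rev := by
  by_cases h : q = p.rev
  · exact ⟨1, by simp [h]⟩
  · obtain ⟨c, hc⟩ := exists_sgn n p q
    refine ⟨-c, ?_⟩
    have h' : ¬ p.rev = q := fun h' => h h'.symm
    rw [← ι_zsmul_rootVec, rootU]
    congr 1
    apply Subtype.ext
    have hs := sgn_mul_self n p
    have hs' := sgn_mul_self n q
    have hcc : (c : ℂ) * c = 1 := by rw [← hc]; linear_combination (sgn n q * sgn n q) * hs + hs'
    rw [coe_zsmul_rootVec]
    simp only [rootVec]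
    rw [rootMat_eq, rootMat_eq]
    simp only [h, Fin.rev_rev, h', if_false, sgn_rev, smul_add, Matrix.smul_single, smul_eq_mul,
      Int.cast_neg, mul_comm (sgn n q), hc, hcc, mul_one, neg_mul, mul_neg, neg_neg]
    rw [add_comm]

theorem divPow_rootU_mem {n : ℕ} {p q : Fin (2 * n)} (h : q < p) (k : ℕ) :
    divPow (rootU p q : U n) k ∈ pbw n (k + 1) := by
  have hp := p.2
  have hq := q.2
  by_cases h1 : (q : ℕ) + p < 2 * n
  · exact divPow_mem_pbw (⟨(q, p), h, h1⟩ : PosRoot n) k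
  · obtain ⟨c, hc⟩ := rootU_flip p q
    rw [hc, divPow_zsmul]
    refine Submodule.smul_mem _ _ (divPow_mem_pbw (⟨(p.rev, q.rev), ?_, ?_⟩ : PosRoot n) k)
    · simpa using h
    · simp only [Fin.val_rev]; omega

/-- The divided powers of two elements commute up to terms of lower degree. -/
def CommLow {n : ℕ} (x y : U n) : Prop :=
  ∀ a b : ℕ, divPow y b * divPow x a - divPow x a * divPow y b ∈ pbw n (a + b)

theorem CommLow.symm {n : ℕ} {x y : U n} (h : CommLow x y) : CommLow y x := by
  intro a b
  have := Submodule.neg_mem _ (h b a)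
  rwa [neg_sub, add_comm b a] at this

theorem CommLow.zsmul_left {n : ℕ} {x y : U n} (h : CommLow x y) (c : ℤ) : CommLow (c • x) y := by
  intro a b
  rw [divPow_zsmul, mul_smul_comm, smul_mul_assoc, ← smul_sub]
  exact Submodule.smul_mem _ _ (h a b)

theorem CommLow.zsmul_right {n : ℕ} {x y : U n} (h : CommLow x y) (c : ℤ) : CommLow x (c • y) :=
  (h.symm.zsmul_left c).symm

theorem commLow_of_commute {n : ℕ} {x y : U n} (h : Commute x y) : CommLow x y := by
  intro a b
  rw [(divPow_commute h a b).eq, sub_self]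
  exact Submodule.zero_mem _

theorem divPow_zsmul_mem {n : ℕ} {x : U n} (h : ∀ k, divPow x k ∈ pbw n (k + 1)) (c : ℤ) (k : ℕ) :
    divPow (c • x) k ∈ pbw n (k + 1) := by
  rw [divPow_zsmul]; exact Submodule.smul_mem _ _ (h k)

theorem commLow_short {n : ℕ} {p q s : Fin (2 * n)} (h1 : s < q) (h2 : q < p)
    (h3 : p ≠ q.rev) (h4 : q ≠ s.rev) : CommLow (rootU p q : U n) (rootU q s) := by
  have hps : s < p := h1.trans h2
  have hss : s ≠ s.rev := by
    intro h; have := s.2; rw [Fin.ext_iff, Fin.val_rev] at h; omega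
  have hpp : p ≠ p.rev := by
    intro h; have := p.2; rw [Fin.ext_iff, Fin.val_rev] at h; omega
  have hqq : q ≠ q.rev := by
    intro h; have := q.2; rw [Fin.ext_iff, Fin.val_rev] at h; omega
  have h3' : p.rev ≠ q := fun h => h3 (by simp [← h])
  have h5 : q ≠ p.rev := fun h => h3 (by simp [h])
  have h3'' : q.rev ≠ p := fun h => h3 h.symm
  have h4' : s.rev ≠ q := fun h => h4 h.symm
  have h4'' : s ≠ q.rev := fun h => h4 (by simp [h])
  have hsgn := sgn_mul_self n q
  obtain ⟨c, hc⟩ : ∃ c : ℤ, rootMat n q s * rootMat n p q =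
      rootMat n p q * rootMat n q s + ((c • rootVec n p s : sp n) : Matrix _ _ ℂ) := by
    refine ⟨if s = p.rev then -2 else -1, ?_⟩
    rw [coe_zsmul_rootVec]
    rw [rootMat_eq, rootMat_eq, rootMat_eq]
    simp only [add_mul, mul_add, single_mul_single, hps.ne, hps.ne', h3', h3'', h4, h4'', h5,
      Fin.rev_inj, if_true, if_false, zero_add, add_zero]
    by_cases h : s = p.rev
    · subst h
      have hsp := sgn_mul_self n p
      simp only [if_true, Fin.rev_rev, Matrix.single_zero, Matrix.smul_single, smul_eq_mul, mul_one,
        sgn_rev, add_zero, ← Matrix.single_add]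
      congr 1
      push_cast
      linear_combination (-(sgn n p * sgn n p)) * hsgn - hsp
    · simp only [h, if_false, smul_add, Matrix.smul_single, smul_eq_mul, mul_one]
      rw [← add_assoc, ← Matrix.single_add]
      push_cast
      rw [add_neg_cancel, Matrix.single_zero, zero_add]
      congr 1
      linear_combination (sgn n s * sgn n p) * hsgn
  have hyx := rootU_mul q s p q _ hc
  rw [ι_zsmul_rootVec] at hyx
  have hyz : Commute (rootU q s : U n) (rootU p s) :=
    rootU_commute hps.ne hss (fun h => h3 (by simp [h])) h1.ne'
  have hxz : Commute (rootU p q : U n) (rootU p s) :=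
    rootU_commute h2.ne h4 hpp hps.ne'
  exact comm_mem_aux (G := pbw n) mul_mem_pbw (u := 0) hyx
    (by rw [smul_zero, add_zero]; exact (hyz.smul_right c).eq) (by simp)
    (hxz.smul_right c) (Commute.zero_right _) (Commute.zero_right _)
    (divPow_rootU_mem h2) (divPow_rootU_mem h1) (divPow_zsmul_mem (divPow_rootU_mem hps) c)
    (fun k => by
      have := divPow_zsmul_mem (divPow_rootU_mem h2) 0 k
      simpa using this)

theorem commLow_long {n : ℕ} {q s : Fin (2 * n)} (h1 : s < q) (h2 : q < q.rev) :
    CommLow (rootU q.rev q : U n) (rootU q s) := by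
  have hss : s ≠ s.rev := by
    intro h; have := s.2; rw [Fin.ext_iff, Fin.val_rev] at h; omega
  have hsr : q.rev < s.rev := by simpa using h1
  have hqs : q ≠ s.rev := (h2.trans hsr).ne
  have hsq : s ≠ q.rev := (h1.trans h2).ne
  obtain ⟨c, hc⟩ := exists_sgn n q s
  have hsgn := sgn_mul_self n q
  have e1 : rootMat n q s * rootMat n q.rev q =
      rootMat n q.rev q * rootMat n q s + (((-1 : ℤ) • rootVec n q.rev s : sp n) : Matrix _ _ ℂ) := by
    rw [coe_zsmul_rootVec]
    rw [rootMat_eq, rootMat_eq, rootMat_eq]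
    simp [add_mul, mul_add, h1.ne, hqs, hsq, sgn_rev, ← Matrix.single_neg]
  have e2 : rootMat n q s * rootMat n q.rev s =
      rootMat n q.rev s * rootMat n q s + ((((-2 * c : ℤ)) • rootVec n s.rev s : sp n) : Matrix _ _ ℂ) := by
    rw [coe_zsmul_rootVec]
    rw [rootMat_eq, rootMat_eq, rootMat_eq]
    simp [add_mul, mul_add, h1.ne, h1.ne', hqs, hsq, sgn_rev, hss, ← Matrix.single_neg]
    rw [hc, two_mul (c : ℂ), Matrix.single_add]
    abel
  have hyx := rootU_mul _ _ _ _ _ e1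
  have hyz := rootU_mul _ _ _ _ _ e2
  rw [ι_zsmul_rootVec] at hyx hyz
  have hS : s < s.rev := h1.trans (h2.trans hsr)
  have hxz : Commute (rootU q.rev q : U n) (rootU q.rev s) :=
    rootU_commute h2.ne hqs (by simpa using h2.ne') hsq.symm
  have hxu : Commute (rootU q.rev q : U n) (rootU s.rev s) :=
    rootU_commute hqs hqs (by simpa using hsq.symm) hsq.symm
  have hzu : Commute (rootU q.rev s : U n) (rootU s.rev s) :=
    rootU_commute hss hss (by simpa using hsq.symm) hsq.symm
  have hyu : Commute (rootU q s : U n) (rootU s.rev s) :=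
    rootU_commute hss hss (by simpa using h1.ne') h1.ne'
  refine comm_mem_aux (G := pbw n) mul_mem_pbw (u := c • rootU s.rev s) hyx ?_ (hyu.smul_right c).eq
    (hxz.smul_right _) (hxu.smul_right c) ((hzu.smul_left _).smul_right c)
    (divPow_rootU_mem h2) (divPow_rootU_mem h1)
    (divPow_zsmul_mem (divPow_rootU_mem (h1.trans h2)) _)
    (divPow_zsmul_mem (divPow_rootU_mem hS) c)
  rw [mul_smul_comm, hyz, smul_mul_assoc, smul_add, smul_smul, ← Int.cast_smul_eq_zsmul ℂ (-1 * _),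
    ← Int.cast_smul_eq_zsmul ℂ c, smul_smul]
  push_cast
  ring_nf

theorem commLow_chain {n : ℕ} {p q s : Fin (2 * n)} (h1 : s < q) (h2 : q < p) :
    CommLow (rootU p q : U n) (rootU q s) := by
  by_cases h3 : p = q.rev
  · subst h3; exact commLow_long h1 h2
  by_cases h4 : q = s.rev
  · subst h4
    obtain ⟨c, hc⟩ := rootU_flip p s.rev
    rw [hc, Fin.rev_rev]
    refine CommLow.zsmul_left (commLow_long ?_ h1).symm c
    rw [← Fin.rev_lt_rev, Fin.rev_rev]; exact h2
  · exact commLow_short h1 h2 h3 h4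

theorem commLow_rootU {n : ℕ} {p q r s : Fin (2 * n)} (h1 : q < p) (h2 : s < r) :
    CommLow (rootU p q : U n) (rootU r s) := by
  by_cases c1 : q = r
  · subst c1; exact commLow_chain h2 h1
  by_cases c2 : p = s
  · subst c2; exact (commLow_chain h1 h2).symm
  by_cases c3 : q = s.rev
  · obtain ⟨c, hc⟩ := rootU_flip r s
    rw [hc, ← c3]
    refine CommLow.zsmul_right (commLow_chain ?_ h1) c
    rw [c3]; simpa using h2
  by_cases c4 : p = r.rev
  · obtain ⟨c, hc⟩ := rootU_flip p q
    rw [hc, c4, Fin.rev_rev]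
    refine CommLow.zsmul_left (commLow_chain h2 ?_) c
    rw [← Fin.rev_lt_rev, Fin.rev_rev, ← c4]; exact h1
  · exact commLow_of_commute (rootU_commute c1 c3 c4 c2)

theorem comm_mem_pbw {n : ℕ} (α β : PosRoot n) (a b : ℕ) :
    divPow (fVec β) b * divPow (fVec α) a - divPow (fVec α) a * divPow (fVec β) b ∈ pbw n (a + b) :=
  commLow_rootU α.2.1 β.2.1 a b

/-! ### The degenerate module `V_ℤ(λ)ᵃ` -/

/-- The part of degree `< s` of the PBW filtration of `V_ℤ(λ)`: the elements `x v_λ` with `x` of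
degree `< s` in the PBW filtration of `U_ℤ(𝔫⁻)`. -/
def pbwV {n : ℕ} (lam : Weight n) (s : ℕ) : AddSubgroup (V lam) where
  carrier := {w | ∃ x ∈ pbw n s, w = x • hwVec lam}
  zero_mem' := ⟨0, Submodule.zero_mem _, by rw [zero_smul]⟩
  add_mem' := by
    rintro w w' ⟨x, hx, hw⟩ ⟨x', hx', hw'⟩
    exact ⟨x + x', add_mem hx hx', by rw [hw, hw', add_smul]⟩
  neg_mem' := by
    rintro w ⟨x, hx, hw⟩
    exact ⟨-x, neg_mem hx, by rw [hw, neg_smul]⟩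

theorem smul_mem_pbwV {n : ℕ} {lam : Weight n} {s t r : ℕ} {x : U n} {w : V lam}
    (hx : x ∈ pbw n s) (hw : w ∈ pbwV lam t) (h : s + t ≤ r + 1) : x • w ∈ pbwV lam r := by
  obtain ⟨y, hy, hw⟩ := hw
  exact ⟨x * y, mul_mem_pbw hx hy h, by rw [hw, mul_smul]⟩

theorem pbw_le_UZ {n s : ℕ} {x : U n} (hx : x ∈ pbw n s) : x ∈ UZ n := by
  induction hx using Submodule.span_induction with
  | zero => exact zero_mem _
  | add a b _ _ ha hb => exact add_mem ha hb
  | smul c a _ ha => exact (UZ n).smul_mem ha c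
  | mem a ha =>
    obtain ⟨L, -, rfl⟩ := ha
    refine list_prod_mem fun y hy => ?_
    obtain ⟨p, -, rfl⟩ := List.mem_map.mp hy
    exact Algebra.subset_adjoin (Or.inl (Or.inr ⟨p.1, p.2, rfl⟩))

theorem pbwV_le_VZ {n : ℕ} {lam : Weight n} {s : ℕ} {w : V lam} (hw : w ∈ pbwV lam s) :
    w ∈ VZ lam := by
  obtain ⟨x, hx, rfl⟩ := hw
  exact (VZ lam).smul_mem ⟨x, pbw_le_UZ hx⟩ (Submodule.subset_span rfl)

/-- The direct sum of the filtration steps `V_ℤ(λ)_{≤ s}`. -/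
def grTop {n : ℕ} (lam : Weight n) : AddSubgroup (ℕ →₀ V lam) where
  carrier := {p | ∀ s, p s ∈ pbwV lam (s + 1)}
  zero_mem' := fun _ => (pbwV lam _).zero_mem
  add_mem' := fun hp hq s => add_mem (hp s) (hq s)
  neg_mem' := fun hp s => neg_mem (hp s)

/-- The direct sum of the filtration steps `V_ℤ(λ)_{≤ s - 1}`, with `V_ℤ(λ)_{≤ -1} = 0`. -/
def grBot {n : ℕ} (lam : Weight n) : AddSubgroup (ℕ →₀ V lam) where
  carrier := {p | ∀ s, p s ∈ pbwV lam s}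
  zero_mem' := fun _ => (pbwV lam _).zero_mem
  add_mem' := fun hp hq s => add_mem (hp s) (hq s)
  neg_mem' := fun hp s => neg_mem (hp s)

/-- The degenerate module `V_ℤ(λ)ᵃ = ⨁ V_ℤ(λ)_{≤ s} / V_ℤ(λ)_{≤ s - 1}`. -/
def Va {n : ℕ} (lam : Weight n) : Type := grTop lam ⧸ (grBot lam).addSubgroupOf (grTop lam)

instance {n : ℕ} (lam : Weight n) : AddCommGroup (Va lam) :=
  inferInstanceAs (AddCommGroup (grTop lam ⧸ (grBot lam).addSubgroupOf (grTop lam)))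

/-- The operator that applies `x` and raises the degree by `k`. -/
def shiftAct {n : ℕ} (lam : Weight n) (x : U n) (k : ℕ) : (ℕ →₀ V lam) →+ (ℕ →₀ V lam) :=
  (Finsupp.mapDomain.addMonoidHom fun s => s + k).comp
    (Finsupp.mapRange.addMonoidHom (DistribSMul.toAddMonoidHom (V lam) x))

theorem shiftAct_apply {n : ℕ} (lam : Weight n) (x : U n) (k : ℕ) (p : ℕ →₀ V lam) (s : ℕ) :
    shiftAct lam x k p s = if k ≤ s then x • p (s - k) else 0 := by
  have hinj : Function.Injective fun s : ℕ => s + k := fun a b h => by simpa using h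
  simp only [shiftAct, AddMonoidHom.comp_apply, Finsupp.mapDomain.addMonoidHom_apply]
  split_ifs with h
  · obtain ⟨t, rfl⟩ := Nat.exists_eq_add_of_le' h
    rw [Finsupp.mapDomain_apply hinj (a := t)]
    simp
  · apply Finsupp.mapDomain_of_notMem_range
    rintro ⟨t, rfl⟩
    exact h (by simp)

theorem shiftAct_mem_top {n : ℕ} {lam : Weight n} {x : U n} {k : ℕ} (hx : x ∈ pbw n (k + 1))
    {p : ℕ →₀ V lam} (hp : p ∈ grTop lam) : shiftAct lam x k p ∈ grTop lam := by
  intro s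
  rw [shiftAct_apply]
  split_ifs with h
  · exact smul_mem_pbwV hx (hp (s - k)) (by omega)
  · exact (pbwV lam _).zero_mem

theorem shiftAct_mem_bot {n : ℕ} {lam : Weight n} {x : U n} {k : ℕ} (hx : x ∈ pbw n (k + 1))
    {p : ℕ →₀ V lam} (hp : p ∈ grBot lam) : shiftAct lam x k p ∈ grBot lam := by
  intro s
  rw [shiftAct_apply]
  split_ifs with h
  · exact smul_mem_pbwV hx (hp (s - k)) (by omega)
  · exact (pbwV lam _).zero_mem

/-- An element of lower degree acts trivially on the associated graded module. -/
theorem shiftAct_mem_bot_of_top {n : ℕ} {lam : Weight n} {x : U n} {k : ℕ}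
    (hx : x ∈ pbw n k) {p : ℕ →₀ V lam} (hp : p ∈ grTop lam) :
    shiftAct lam x k p ∈ grBot lam := by
  intro s
  rw [shiftAct_apply]
  split_ifs with h
  · exact smul_mem_pbwV hx (hp (s - k)) (by omega)
  · exact (pbwV lam _).zero_mem

theorem shiftAct_shiftAct {n : ℕ} (lam : Weight n) (x y : U n) (k l : ℕ) (p : ℕ →₀ V lam) :
    shiftAct lam x k (shiftAct lam y l p) = shiftAct lam (x * y) (k + l) p := by
  ext s : 1
  simp only [shiftAct_apply]
  by_cases h1 : k ≤ s
  · by_cases h2 : l ≤ s - k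
    · rw [if_pos h1, if_pos h2, if_pos (by omega), mul_smul, Nat.sub_sub]
    · rw [if_pos h1, if_neg h2, if_neg (by omega), smul_zero]
  · rw [if_neg h1, if_neg (by omega)]

theorem shiftAct_sub {n : ℕ} (lam : Weight n) (x y : U n) (k : ℕ) (p : ℕ →₀ V lam) :
    shiftAct lam (x - y) k p = shiftAct lam x k p - shiftAct lam y k p := by
  ext s : 1
  simp only [shiftAct_apply, Finsupp.sub_apply]
  split_ifs
  · exact sub_smul _ _ _
  · simp

/-- The operator on the direct sum of the `V_ℤ(λ)_{≤ s}` given by `f_α^{(k)}`. -/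
def topAct {n : ℕ} (lam : Weight n) (α : PosRoot n) (k : ℕ) : grTop lam →+ grTop lam where
  toFun p := ⟨shiftAct lam (divPow (fVec α) k) k p, shiftAct_mem_top (divPow_mem_pbw α k) p.2⟩
  map_zero' := Subtype.ext (map_zero (shiftAct lam (divPow (fVec α) k) k))
  map_add' p q := Subtype.ext (map_add (shiftAct lam (divPow (fVec α) k) k) p.1 q.1)

/-- The operator on `V_ℤ(λ)ᵃ` induced by `f_α^{(k)}`; it raises the degree by `k`. -/
def grAct {n : ℕ} (lam : Weight n) (α : PosRoot n) (k : ℕ) : AddMonoid.End (Va lam) :=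
  QuotientAddGroup.map _ _ (topAct lam α k)
    fun p hp => shiftAct_mem_bot (p := (p : ℕ →₀ V lam)) (divPow_mem_pbw α k) hp

/-- The class of an element in the associated graded module. -/
def Va.mk {n : ℕ} {lam : Weight n} (p : grTop lam) : Va lam := QuotientAddGroup.mk p

theorem Va.mk_surjective {n : ℕ} {lam : Weight n} : Function.Surjective (Va.mk (lam := lam)) :=
  QuotientAddGroup.mk_surjective

theorem Va.mk_eq {n : ℕ} {lam : Weight n} {p q : grTop lam}
    (h : (p : ℕ →₀ V lam) - q ∈ grBot lam) : Va.mk p = Va.mk q := by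
  refine Eq.symm (QuotientAddGroup.eq.mpr ?_)
  rw [AddSubgroup.mem_addSubgroupOf, AddSubgroup.coe_add, AddSubgroup.coe_neg, neg_add_eq_sub]
  exact h

theorem Va.mk_nsmul {n : ℕ} {lam : Weight n} (c : ℕ) (p : grTop lam) :
    c • Va.mk p = Va.mk (c • p) := rfl

theorem grAct_mk {n : ℕ} (lam : Weight n) (α : PosRoot n) (k : ℕ) (p : grTop lam) :
    grAct lam α k (Va.mk p) = Va.mk (topAct lam α k p) := rfl

theorem grAct_zero {n : ℕ} (lam : Weight n) (α : PosRoot n) : grAct lam α 0 = 1 := by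
  ext w
  obtain ⟨p, rfl⟩ := Va.mk_surjective w
  change Va.mk (topAct lam α 0 p) = Va.mk p
  congr 1
  apply Subtype.ext
  ext s : 1
  change shiftAct lam (divPow (fVec α) 0) 0 p s = _
  simp [shiftAct_apply, divPow_zero]

theorem grAct_mul {n : ℕ} (lam : Weight n) (α : PosRoot n) (a b : ℕ) :
    grAct lam α a * grAct lam α b = (a + b).choose a • grAct lam α (a + b) := by
  ext w
  obtain ⟨p, rfl⟩ := Va.mk_surjective w
  change Va.mk (topAct lam α a (topAct lam α b p)) =
    Va.mk ((a + b).choose a • topAct lam α (a + b) p)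
  congr 1
  apply Subtype.ext
  ext s : 1
  change shiftAct lam _ a (shiftAct lam _ b p) s = (a + b).choose a • shiftAct lam _ (a + b) p s
  rw [shiftAct_shiftAct, divPow_mul]
  simp only [shiftAct_apply]
  split_ifs
  · exact smul_assoc _ _ _
  · simp

theorem grAct_comm {n : ℕ} (lam : Weight n) (α β : PosRoot n) (a b : ℕ) :
    grAct lam α a * grAct lam β b = grAct lam β b * grAct lam α a := by
  ext w
  obtain ⟨p, rfl⟩ := Va.mk_surjective w
  change Va.mk (topAct lam α a (topAct lam β b p)) = Va.mk (topAct lam β b (topAct lam α a p))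
  apply Va.mk_eq
  change shiftAct lam _ a (shiftAct lam _ b p) - shiftAct lam _ b (shiftAct lam _ a p) ∈ _
  rw [shiftAct_shiftAct, shiftAct_shiftAct, add_comm b a, ← shiftAct_sub]
  refine shiftAct_mem_bot_of_top ?_ p.2
  have := comm_mem_pbw β α b a
  rwa [add_comm b a] at this

theorem grAct_rel {m : ℕ} (lam : Weight m) ⦃x y : FreeAlgebra ℤ (PosRoot m × ℕ)⦄ (h : SRel m x y) :
    FreeAlgebra.lift ℤ (fun g : PosRoot m × ℕ => grAct lam g.1 g.2) x =
      FreeAlgebra.lift ℤ (fun g : PosRoot m × ℕ => grAct lam g.1 g.2) y := by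
  cases h with
  | zero α =>
    simp only [FreeAlgebra.lift_ι_apply, map_one]
    exact grAct_zero lam α
  | mul α a b =>
    simp only [FreeAlgebra.lift_ι_apply, map_mul, map_nsmul]
    exact grAct_mul lam α a b
  | comm α β a b =>
    simp only [FreeAlgebra.lift_ι_apply, map_mul]
    exact grAct_comm lam α β a b

/-- The action of `S_ℤ(𝔫⁻)` on `V_ℤ(λ)ᵃ`. -/
def grHom {m : ℕ} (lam : Weight m) : SZ m →ₐ[ℤ] AddMonoid.End (Va lam) :=
  RingQuot.liftAlgHom ℤ
    ⟨FreeAlgebra.lift ℤ fun g : PosRoot m × ℕ => grAct lam g.1 g.2, grAct_rel lam⟩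

instance {m : ℕ} (lam : Weight m) : Module (SZ m) (Va lam) :=
  Module.compHom (Va lam) (grHom lam).toRingHom

/-! ### The Demazure module as a module over `S_ℤ(𝔫⁻)` -/

/-- The divided power `e_α^{(k)}` as an element of the hyperalgebra of the Borel subalgebra. -/
def eZ {n : ℕ} (α : PosRoot n) (k : ℕ) : UZb n :=
  ⟨divPow (eVec α) k, Algebra.subset_adjoin (Or.inl ⟨α, k, rfl⟩)⟩

theorem eVec_phi_commute {m : ℕ} (α β : PosRoot m) :
    Commute (eVec (phi α) : U (2 * m)) (eVec (phi β)) := by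
  have h1 := α.1.1.2
  have h2 := α.1.2.2
  have h3 := β.1.1.2
  have h4 := β.1.2.2
  refine rootU_commute ?_ ?_ ?_ ?_ <;>
  · simp only [phi, ne_eq, Fin.ext_iff, Fin.val_rev]
    omega

theorem borelHom_rel {m : ℕ} ⦃x y : FreeAlgebra ℤ (PosRoot m × ℕ)⦄ (h : SRel m x y) :
    FreeAlgebra.lift ℤ (fun g : PosRoot m × ℕ => eZ (phi g.1) g.2) x =
      FreeAlgebra.lift ℤ (fun g : PosRoot m × ℕ => eZ (phi g.1) g.2) y := by
  cases h with
  | zero α =>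
    simp only [FreeAlgebra.lift_ι_apply, map_one]
    exact Subtype.ext (divPow_zero _)
  | mul α a b =>
    simp only [FreeAlgebra.lift_ι_apply, map_mul, map_nsmul]
    exact Subtype.ext (divPow_mul _ a b)
  | comm α β a b =>
    simp only [FreeAlgebra.lift_ι_apply, map_mul]
    exact Subtype.ext (divPow_commute (eVec_phi_commute α β) a b).eq

/-- The homomorphism from `S_ℤ(𝔫⁻)` to the hyperalgebra of the Borel subalgebra of the symplectic
Lie algebra of rank `2m` that sends `f_α^{(k)}` to `e_{φ(α)}^{(k)}`. -/
def borelHom (m : ℕ) : SZ m →ₐ[ℤ] UZb (2 * m) :=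
  RingQuot.liftAlgHom ℤ
    ⟨FreeAlgebra.lift ℤ fun g : PosRoot m × ℕ => eZ (phi g.1) g.2, borelHom_rel⟩

instance {m : ℕ} (lam : Weight (2 * m)) (w : List (Fin (2 * m))) :
    Module (SZ m) (demazure lam w) :=
  Module.compHom (demazure lam w) (borelHom m).toRingHom

end SympPBW

end

open scoped Nat Matrix

noncomputable section

namespace SympPBW

attribute [local instance 100] LieRing.ofAssociativeRing

set_option linter.unusedSectionVars false

/-! Both sides are cyclic over the divided power algebra: the graded module by the class `grGen` of
the highest weight vector, the Demazure module by the extremal vector `tauGen`. It therefore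
suffices that the two generators have the same annihilator. Let r be the number of the fundamental
weight, counted from one. With indices from 0, only the roots (a, b) with a < r ≤ b act nontrivially
on either generator. Each is recorded as the interval [b, 2m-1-a] (`Edge`), so that a monomial in
the f's is a multiset s of intervals.

Explicit models. The irreducible modules with highest weight ℓω embed into ℓ-fold tensor powers of
exterior powers of the vector representation (`exists_realization`). The standard hermitian form,
for which the image of the Lie algebra is closed under adjoints, shows that a highest weight vector
generates an irreducible module (`exists_embedding`). The root vectors in use have square zero, so
exp(xX) = 1 + xX. Hence the coordinates of a product of divided powers applied to a wedge of columns
are the coefficients of a product of ℓ minors of ∏(1 + x_a X_a)K (`coeff_wedgeVec_expProd`). For the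
f's the matrix is `chartMat`, an identity block together with entries x_{b, 2m-1-a} that depend only
on the unordered pair of indices, minus quadratic terms (`expProd_lowMat_apply`). For the e_{φ(α)}
it is `tauChart`, with no quadratic terms, and its minors are integer multiples of minors of
`chartMat`, among which all of the latter occur. So relations among the monomials on `tauGen` are
exactly the relations among the coefficients of products of minors of `chartMat`.

From the graded module to the Demazure module. A coordinate with n row indices ≥ r vanishes on
filtration steps of degree below n, and on degree n it does not see the quadratic terms. A relation
modulo lower filtration therefore becomes a relation among coefficients of minors
(`sum_mul_coeff_eq_zero`).

Upper bound. Substitute x_{b,c} = T u_b u_c, corrected so that the quadratic terms cancel. The rows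
from r on then have rank one, each minor has degree at most 1 in T, and the coefficients of T^n
vanish for n > ℓ. In the graded module this says that, for n > ℓ, the sum of all monomials in n
intervals with a prescribed multiset of end points is zero (`sum_mono_smul_grGen`). Give s the
weight ∑ lo·hi. A chain of nested intervals has strictly the smallest weight among the families with
its end points (`Edge.eq_or_wt_lt_of_isChain`), so every chain with more than ℓ members can be
rewritten. The monomials without such chains, called admissible, span (`mono_smul_grGen_mem_span`).

Lower bound. An admissible s is a union of ℓ antichains (`Edge.exists_antichains`). By the
rearrangement inequality each antichain is the term of greatest weight of one minor
(`exists_isLead_det`). Thus s leads a product of ℓ minors, and triangularity makes the admissible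
monomials independent on `tauGen` (`eq_zero_of_sum_mono_smul_tauGen`). The two bounds give equality
of annihilators.

That the extremal vector generates the Demazure module over the commuting e_{φ(α)} alone is
`exists_smul_tauGen`: the remaining root vectors either kill it or act on the coordinates by
integral polynomial substitutions (`one_add_smul_mul_tauChart`). -/

section

/-! ### Tensor powers of the vector representation -/

section Tensor

variable {I P R : Type*} [Fintype I] [DecidableEq P] [CommRing R]

/-- The action of a matrix on one factor of a tensor power. -/
def posAct (p : P) (X : Matrix I I R) : Module.End R ((P → I) → R) where
  toFun F t := ∑ y, X (t p) y * F (Function.update t p y)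
  map_add' F G := by
    ext t
    simp [mul_add, Finset.sum_add_distrib]
  map_smul' c F := by
    ext t
    simp only [Pi.smul_apply, smul_eq_mul, RingHom.id_apply, Finset.mul_sum]
    exact Finset.sum_congr rfl fun y _ => by ring

theorem posAct_apply (p : P) (X : Matrix I I R) (F : (P → I) → R) (t : P → I) :
    posAct p X F t = ∑ y, X (t p) y * F (Function.update t p y) := rfl

theorem posAct_mul (p : P) (X Y : Matrix I I R) : posAct p X * posAct p Y = posAct p (X * Y) := by
  ext F t
  simp only [Module.End.mul_apply, posAct_apply, Function.update_self, Function.update_idem,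
    Matrix.mul_apply, Finset.mul_sum, Finset.sum_mul, mul_assoc]
  exact Finset.sum_comm

theorem posAct_comm {p q : P} (h : p ≠ q) (X Y : Matrix I I R) :
    posAct p X * posAct q Y = posAct q Y * posAct p X := by
  ext F t
  simp only [Module.End.mul_apply, posAct_apply, Function.update_of_ne h,
    Function.update_of_ne h.symm, Finset.mul_sum]
  rw [Finset.sum_comm]
  refine Finset.sum_congr rfl fun y _ => Finset.sum_congr rfl fun z _ => ?_
  rw [Function.update_comm h]
  ring

theorem posAct_sub (p : P) (X Y : Matrix I I R) : posAct p (X - Y) = posAct p X - posAct p Y := by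
  ext F t
  simp [posAct_apply, sub_mul, Finset.sum_sub_distrib]

variable [Fintype P]

variable (P) in
/-- The derivation action of a matrix on a tensor power. -/
def tensAct (X : Matrix I I R) : Module.End R ((P → I) → R) := ∑ p, posAct p X

theorem tensAct_apply (X : Matrix I I R) (F : (P → I) → R) (t : P → I) :
    tensAct P X F t = ∑ p, ∑ y, X (t p) y * F (Function.update t p y) := by
  simp [tensAct, posAct_apply]

theorem tensAct_add (X Y : Matrix I I R) : tensAct P (X + Y) = tensAct P X + tensAct P Y := by
  ext F t
  simp [tensAct_apply, add_mul, Finset.sum_add_distrib]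

theorem tensAct_smul (c : R) (X : Matrix I I R) : tensAct P (c • X) = c • tensAct P X := by
  ext F t
  simp [tensAct_apply, Finset.mul_sum, mul_assoc]

/-- Actions on different factors commute, so only the diagonal terms of the double sum survive. -/
theorem tensAct_lie (X Y : Matrix I I R) :
    tensAct P (X * Y - Y * X) = tensAct P X * tensAct P Y - tensAct P Y * tensAct P X := by
  simp only [tensAct, Finset.sum_mul_sum]
  rw [Finset.sum_comm (f := fun i j => posAct i Y * posAct j X), ← Finset.sum_sub_distrib]
  refine Finset.sum_congr rfl fun p _ => ?_
  rw [← Finset.sum_sub_distrib, Finset.sum_eq_single p]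
  · rw [posAct_mul, posAct_mul, posAct_sub]
  · intro q _ hq
    rw [posAct_comm hq, sub_self]
  · simp

variable {J κ : Type*} [Fintype J] [DecidableEq J] [Fintype κ] [DecidableEq κ]

/-- The tensor power, over `J`, of the exterior product of the columns of `K`. -/
def wedgeVec (J : Type*) [Fintype J] (K : Matrix I κ R) : (J × κ → I) → R :=
  fun t => ∏ j : J, (K.submatrix (fun k => t (j, k)) id).det

theorem wedgeVec_map {S : Type*} [CommRing S] (g : R →+* S) (K : Matrix I κ R) (t : J × κ → I) :
    wedgeVec J (K.map g) t = g (wedgeVec J K t) := by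
  simp only [wedgeVec, map_prod, RingHom.map_det]
  rfl

/-- Each factor is a determinant, hence multiplicative. Changes of columns of determinant ±1 thus
alter the vector at most by a sign, which is how signed permutations and shears are absorbed later.
-/
theorem wedgeVec_mul (K : Matrix I κ R) (B : Matrix κ κ R) (t : J × κ → I) :
    wedgeVec J (K * B) t = B.det ^ Fintype.card J * wedgeVec J K t := by
  simp only [wedgeVec]
  have : ∀ j, ((K * B).submatrix (fun k => t (j, k)) id).det =
      (K.submatrix (fun k => t (j, k)) id).det * B.det := by
    intro j
    rw [← Matrix.det_mul]
    rfl
  simp only [this, Finset.prod_mul_distrib, Finset.prod_const, Finset.card_univ]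
  ring

/-- A matrix that preserves the span of the columns of `K` acts on their exterior product by the
trace. -/
theorem tensAct_wedgeVec {X : Matrix I I R} {K : Matrix I κ R} {B : Matrix κ κ R}
    (h : X * K = K * B) :
    tensAct (J × κ) X (wedgeVec J K) = ((Fintype.card J : R) * B.trace) • wedgeVec J K := by
  ext t
  rw [tensAct_apply, Fintype.sum_prod_type, Pi.smul_apply, smul_eq_mul, mul_assoc,
    ← nsmul_eq_mul, ← Finset.card_univ, ← Finset.sum_const]
  refine Finset.sum_congr rfl fun j _ => ?_
  set M : J → Matrix κ κ R := fun j => K.submatrix (fun k => t (j, k)) id with hM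
  -- Changing the index at (j, k) replaces row k of the j-th matrix and leaves the other
  -- determinants alone.
  have h1 : ∀ (k : κ) (y : I), wedgeVec J K (Function.update t (j, k) y) =
      ((M j).updateRow k (K y)).det * ∏ j' ∈ Finset.univ.erase j, (M j').det := by
    intro k y
    rw [wedgeVec, ← Finset.mul_prod_erase _ _ (Finset.mem_univ j)]
    congr 1
    · congr 1
      ext k' c
      by_cases hk : k' = k
      · subst hk; simp
      · have : (j, k') ≠ (j, k) := fun h => hk (by simpa using h)
        simp [hM, Matrix.updateRow_ne hk, Function.update_of_ne this]
    · refine Finset.prod_congr rfl fun j' hj' => ?_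
      congr 1
      ext k' c
      have : (j', k') ≠ (j, k) := fun h => Finset.ne_of_mem_erase hj' (by simpa using congrArg Prod.fst h)
      simp [hM, Function.update_of_ne this]
  have h2 : ∀ k, ∑ y, X (t (j, k)) y * ((M j).updateRow k (K y)).det =
      ((M j).updateRow k ((M j * B) k)).det := by
    intro k
    have e : (M j * B) k = ∑ y, X (t (j, k)) y • K y := by
      ext c
      have := congrFun (congrFun h (t (j, k))) c
      simp only [Matrix.mul_apply] at this
      simp only [Finset.sum_apply, Pi.smul_apply, smul_eq_mul, this, Matrix.mul_apply]
      rfl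
    rw [e]
    simp only [← Matrix.cramer_transpose_apply, map_sum, map_smul, Finset.sum_apply, Pi.smul_apply,
      smul_eq_mul]
  simp only [h1]
  simp_rw [← mul_assoc, ← Finset.sum_mul, h2, ← Matrix.cramer_transpose_apply,
    Matrix.cramer_eq_adjugate_mulVec]
  -- By Cramer's rule the sum over the replaced rows is the trace of M B adj(M), and cyclicity of
  -- the trace leaves det M · tr B.
  have h3 : ∑ k, ((M j)ᵀ.adjugate.mulVec ((M j * B) k)) k = (M j).det * B.trace := by
    have : ∑ k, ((M j)ᵀ.adjugate.mulVec ((M j * B) k)) k =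
        ((M j * B) * (M j).adjugate).trace := by
      simp only [Matrix.trace, Matrix.diag, Matrix.mulVec, dotProduct, Matrix.mul_apply (M := M j * B),
        ← Matrix.adjugate_transpose, Matrix.transpose_apply]
      exact Finset.sum_congr rfl fun k _ => Finset.sum_congr rfl fun l _ => mul_comm _ _
    rw [this, Matrix.trace_mul_comm, ← mul_assoc, Matrix.adjugate_mul, Matrix.smul_mul, one_mul,
      Matrix.trace_smul, smul_eq_mul]
  rw [h3, wedgeVec, ← Finset.mul_prod_erase _ _ (Finset.mem_univ j)]
  ring

end Tensor

end

section

/-! ### Generating functions of divided powers -/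

section Generating

open MvPolynomial

variable {I P J κ σ : Type*} [Fintype I] [DecidableEq I] [Fintype P] [DecidableEq P]
  [Fintype J] [DecidableEq J] [Fintype κ] [DecidableEq κ]

/-- The Leibniz expansion reduces statements about wedges to products of single entries, where a
product rule or a bound on degrees can be applied factor by factor. -/
theorem wedgeVec_eq_sum {R : Type*} [CommRing R] (K : Matrix I κ R) (t : J × κ → I) :
    wedgeVec J K t = ∑ g : J → Equiv.Perm κ,
      (∏ j, ((Equiv.Perm.sign (g j) : ℤ) : R)) * ∏ p : J × κ, K (t p) (g p.1 p.2) := by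
  have h : ∀ j, (K.submatrix (fun k => t (j, k)) id).det =
      ∑ e : Equiv.Perm κ, ((Equiv.Perm.sign e : ℤ) : R) * ∏ k, K (t (j, k)) (e k) := by
    intro j
    rw [← Matrix.det_transpose, Matrix.det_apply']
    rfl
  simp only [wedgeVec, h, Finset.prod_univ_sum, Fintype.piFinset_univ, Finset.prod_mul_distrib,
    Fintype.prod_prod_type]

theorem tensAct_prod {R : Type*} [CommRing R] (X : Matrix I I R) (K : Matrix I κ R) (c : P → κ)
    (t : P → I) : tensAct P X (fun t => ∏ p, K (t p) (c p)) t =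
      ∑ p, (X * K) (t p) (c p) * ∏ q ∈ Finset.univ.erase p, K (t q) (c q) := by
  rw [tensAct_apply]
  refine Finset.sum_congr rfl fun p _ => ?_
  rw [Matrix.mul_apply, Finset.sum_mul]
  refine Finset.sum_congr rfl fun y _ => ?_
  rw [← Finset.mul_prod_erase _ _ (Finset.mem_univ p), Function.update_self, mul_assoc]
  congr 2
  refine Finset.prod_congr rfl fun q hq => ?_
  rw [Function.update_of_ne (Finset.ne_of_mem_erase hq)]

theorem derivation_prod {A : Type*} [CommRing A] (D : Derivation ℤ A A) (s : Finset P) (g : P → A) :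
    D (∏ p ∈ s, g p) = ∑ p ∈ s, D (g p) * ∏ q ∈ s.erase p, g q := by
  induction s using Finset.induction_on with
  | empty => simp
  | insert p s hp ih =>
    rw [Finset.prod_insert hp, Derivation.leibniz, ih, Finset.sum_insert hp,
      Finset.erase_insert hp, smul_eq_mul, smul_eq_mul, Finset.mul_sum, add_comm, mul_comm]
    congr 1
    refine Finset.sum_congr rfl fun q hq => ?_
    have hpq : p ≠ q := fun h => hp (h ▸ hq)
    rw [Finset.erase_insert_of_ne hpq, Finset.prod_insert (fun h => hp (Finset.mem_of_mem_erase h))]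
    ring

/-- Both D and the Lie algebra action obey the product rule on each Leibniz term, so agreement on
the entries of K is enough. This turns a differential equation for the matrix into one for the
generating function. -/
theorem derivation_wedgeVec {A : Type*} [CommRing A] (D : Derivation ℤ A A) (X : Matrix I I A)
    (K : Matrix I κ A) (h : ∀ x c, D (K x c) = (X * K) x c) (t : J × κ → I) :
    D (wedgeVec J K t) = tensAct (J × κ) X (wedgeVec J K) t := by
  have hz : ∀ (z : ℤ) (F : A), D ((z : A) * F) = (z : A) * D F := by
    intro z F
    rw [← zsmul_eq_mul, map_zsmul, zsmul_eq_mul]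
  have e : wedgeVec J K = ∑ g : J → Equiv.Perm κ,
      ((∏ j, (Equiv.Perm.sign (g j) : ℤ) : ℤ) : A) •
        fun t : J × κ → I => ∏ p : J × κ, K (t p) (g p.1 p.2) := by
    ext1 t
    rw [wedgeVec_eq_sum, Finset.sum_apply]
    refine Finset.sum_congr rfl fun g _ => ?_
    rw [Pi.smul_apply, smul_eq_mul, Int.cast_prod]
  rw [wedgeVec_eq_sum, e, map_sum, map_sum, Finset.sum_apply]
  refine Finset.sum_congr rfl fun g _ => ?_
  rw [map_smul, Pi.smul_apply, tensAct_prod _ K, ← Int.cast_prod, hz, derivation_prod, smul_eq_mul]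
  congr 1
  exact Finset.sum_congr rfl fun p _ => by rw [h]

/-- A matrix of complex numbers as a matrix of constant polynomials. -/
def constMat (σ : Type*) {A B : Type*} (K : Matrix A B ℂ) : Matrix A B (MvPolynomial σ ℂ) := K.map C

theorem constMat_apply {A B : Type*} (K : Matrix A B ℂ) (x : A) (y : B) :
    constMat σ K x y = C (K x y) := rfl

theorem coeff_tensAct (s : σ →₀ ℕ) (X : Matrix I I ℂ) (F : (P → I) → MvPolynomial σ ℂ)
    (t : P → I) : coeff s (tensAct P (constMat σ X) F t) = tensAct P X (fun t => coeff s (F t)) t := by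
  simp [tensAct_apply, constMat, coeff_sum, coeff_C_mul]

/-- The factor `1 + x_a X` of a generating function. -/
def expFactor (X : σ → Matrix I I ℂ) (a : σ) : Matrix I I (MvPolynomial σ ℂ) :=
  1 + (MvPolynomial.X a : MvPolynomial σ ℂ) • constMat σ (X a)

/-- Since X_a has square zero and K does not involve x_a, the matrix (1 + x_a X_a)K satisfies ∂_a M
= X_a M. The generating function solves the same equation, and comparing coefficients gives a
recursion whose solution is the divided powers. -/
theorem coeff_wedgeVec_expFactor [DecidableEq σ] {X : σ → Matrix I I ℂ} {a : σ}
    (hX : X a * X a = 0) {K : Matrix I κ (MvPolynomial σ ℂ)} (hK : ∀ x c, pderiv a (K x c) = 0)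
    (s : σ →₀ ℕ) :
    (fun t => coeff s (wedgeVec J (expFactor X a * K) t)) =
      divPow (tensAct (J × κ) (X a)) (s a) (fun t => coeff (s.erase a) (wedgeVec J K t)) := by
  obtain ⟨k, hk⟩ : ∃ k, s a = k := ⟨_, rfl⟩
  have hXX : constMat σ (X a) * constMat σ (X a) = (0 : Matrix I I (MvPolynomial σ ℂ)) := by
    rw [constMat, ← Matrix.map_mul, hX]; ext; simp
  have hder : ∀ x c, pderiv a ((expFactor X a * K) x c) =
      (constMat σ (X a) * (expFactor X a * K)) x c := by
    intro x c
    have e2 : (constMat σ (X a) * (expFactor X a * K)) =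
        constMat σ (X a) * K := by
      rw [expFactor, ← Matrix.mul_assoc, mul_add, mul_one, Matrix.mul_smul, hXX, smul_zero, add_zero]
    rw [e2, expFactor, Matrix.add_mul, Matrix.one_mul, Matrix.smul_mul, Matrix.add_apply, Matrix.smul_apply,
      map_add, hK, smul_eq_mul, Derivation.leibniz, pderiv_X_self, zero_add, smul_eq_mul,
      smul_eq_mul, mul_one, Matrix.mul_apply, map_sum]
    rw [Finset.sum_eq_zero, mul_zero, zero_add]
    intro y _
    simp [Derivation.leibniz, hK, constMat_apply]
  induction k generalizing s with
  | zero =>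
    rw [hk, divPow_zero, Module.End.one_apply, Finsupp.erase_of_notMem_support (by simpa using hk)]
    ext1 t
    -- Coefficients without x_a are read modulo x_a, where the factor 1 + x_a X_a becomes the
    -- identity.
    let q := Ideal.Quotient.mk (Ideal.span {(MvPolynomial.X a : MvPolynomial σ ℂ)})
    have hq : q (wedgeVec J (expFactor X a * K) t) = q (wedgeVec J K t) := by
      rw [← wedgeVec_map, ← wedgeVec_map, Matrix.map_mul]
      have : (expFactor X a).map q = 1 := by
        ext x y
        have hz : q (MvPolynomial.X a) = 0 :=
          Ideal.Quotient.eq_zero_iff_mem.mpr (Ideal.subset_span rfl)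
        simp only [expFactor, constMat, Matrix.map_apply, Matrix.add_apply, Matrix.smul_apply, smul_eq_mul,
          map_add, map_mul, hz, zero_mul, add_zero, Matrix.one_apply]
        split_ifs <;> simp
      rw [this, Matrix.one_mul]
    rw [Ideal.Quotient.eq, Ideal.mem_span_singleton] at hq
    obtain ⟨G, hG⟩ := hq
    rw [sub_eq_iff_eq_add.mp hG, coeff_add, mul_comm, coeff_mul_X', if_neg (by simpa using hk),
      zero_add]
  | succ k ih =>
    have hle : Finsupp.single a 1 ≤ s := by
      rw [Finsupp.single_le_iff]; omega
    obtain ⟨s', rfl⟩ : ∃ s', s = s' + Finsupp.single a 1 := ⟨s - Finsupp.single a 1, by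
      rw [tsub_add_cancel_of_le hle]⟩
    have hk' : s' a = k := by simpa using hk
    have hne : (k : ℂ) + 1 ≠ 0 := by exact_mod_cast k.succ_ne_zero
    have her : (s' + Finsupp.single a 1).erase a = s'.erase a := by
      ext b
      by_cases hb : b = a
      · subst hb; simp
      · simp [Finsupp.erase_ne hb]
    -- The derivative multiplies the coefficient by k + 1, which is nonzero in ℂ and matches the
    -- recursion of the divided powers.
    apply smul_right_injective _ hne
    beta_reduce
    rw [hk, her, ← LinearMap.smul_apply, succ_smul_divPow]
    have hc := (divPow_commute (Commute.refl (tensAct (J × κ) (X a))) k 1).eq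
    have h1 : divPow (tensAct (J × κ) (X a)) 1 = tensAct (J × κ) (X a) := by simp [divPow]
    rw [h1] at hc
    rw [hc, Module.End.mul_apply, ← hk', ← ih s' hk']
    ext1 t
    rw [← coeff_tensAct, ← derivation_wedgeVec ((pderiv a).restrictScalars ℤ) _ _ hder,
      Derivation.restrictScalars_apply, coeff_pderiv]
    simp only [Pi.smul_apply, smul_eq_mul]
    ring

/-- The product of the factors `1 + x_a X_a`. -/
def expProd (X : σ → Matrix I I ℂ) (L : List σ) : Matrix I I (MvPolynomial σ ℂ) :=
  (L.map (expFactor X)).prod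

theorem pderiv_expProd [DecidableEq σ] (X : σ → Matrix I I ℂ) (K : Matrix I κ ℂ) {L : List σ}
    {a : σ} (ha : a ∉ L) (x : I) (c : κ) :
    pderiv a ((expProd X L * constMat σ K) x c) = 0 := by
  induction L generalizing x with
  | nil =>
    rw [expProd, List.map_nil, List.prod_nil, Matrix.one_mul, constMat, Matrix.map_apply, pderiv_C]
  | cons b L ih =>
    rw [List.mem_cons, not_or] at ha
    have ih' := ih ha.2
    rw [expProd, List.map_cons, List.prod_cons, Matrix.mul_assoc, ← expProd, expFactor,
      Matrix.add_mul, Matrix.one_mul,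
      Matrix.smul_mul, Matrix.add_apply, Matrix.smul_apply, map_add, ih', smul_eq_mul,
      Derivation.leibniz, pderiv_X_of_ne (Ne.symm ha.1), Matrix.mul_apply, map_sum]
    simp [Derivation.leibniz, ih', constMat_apply]

/-- The coefficients of the generating function are given by products of divided powers. -/
theorem coeff_wedgeVec_expProd [DecidableEq σ] {X : σ → Matrix I I ℂ} (K : Matrix I κ ℂ)
    {L : List σ} (hX : ∀ a ∈ L, X a * X a = 0) (hL : L.Nodup) (s : σ →₀ ℕ)
    (hs : ∀ a, a ∉ L → s a = 0) :
    (fun t => coeff s (wedgeVec J (expProd X L * constMat σ K) t)) =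
      (L.map fun a => divPow (tensAct (J × κ) (X a)) (s a)).prod (wedgeVec J K) := by
  induction L generalizing s with
  | nil =>
    obtain rfl : s = 0 := by ext a; exact hs a (by simp)
    ext1 t
    simp only [expProd, constMat, List.map_nil, List.prod_nil, Matrix.one_mul, wedgeVec_map, coeff_zero_C,
      Module.End.one_apply]
  | cons a L ih =>
    rw [List.nodup_cons] at hL
    have e : (expProd X (a :: L) * constMat σ K) =
        expFactor X a * (expProd X L * constMat σ K) := by
      simp [expProd, Matrix.mul_assoc]
    rw [e, coeff_wedgeVec_expFactor (hX a (by simp)) (pderiv_expProd X K hL.1), List.map_cons,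
      List.prod_cons, Module.End.mul_apply,
      ih (fun b hb => hX b (by simp [hb])) hL.2 (s.erase a)]
    · congr 3
      refine List.map_congr_left fun b hb => ?_
      rw [Finsupp.erase_ne (fun h : b = a => hL.1 (h ▸ hb))]
    · intro b hb
      by_cases hba : b = a
      · subst hba; simp
      · rw [Finsupp.erase_ne hba, hs b (by simp [hba, hb])]

end Generating

end

section

/-! ### The Chevalley generators span the symplectic Lie algebra -/

theorem apply_of_mem_sp {n : ℕ} {A : Matrix (Fin (2 * n)) (Fin (2 * n)) ℂ} (h : A ∈ sp n)
    (a b : Fin (2 * n)) : A a b = -(sgn n a * sgn n b) * A b.rev a.rev := by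
  rw [mem_skewAdjointMatricesLieSubalgebra, mem_skewAdjointMatricesSubmodule] at h
  unfold Matrix.IsSkewAdjoint Matrix.IsAdjointPair at h
  have h1 : ∀ a b, (A.transpose * form n) a b = A b.rev a * sgn n b.rev := by
    intro a b
    rw [Matrix.mul_apply, Finset.sum_eq_single b.rev]
    · simp [form]
    · intro c _ hc
      have : b ≠ c.rev := fun h => hc (by simp [h])
      simp [form, this]
    · simp
  have h2 : ∀ a b, (form n * (-A)) a b = - (sgn n a * A a.rev b) := by
    intro a b
    rw [Matrix.mul_apply, Finset.sum_eq_single a.rev]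
    · simp [form]
    · intro c _ hc
      simp [form, hc]
    · simp
  have h3 := congrFun (congrFun h a.rev) b
  rw [h1, h2, Fin.rev_rev, sgn_rev, sgn_rev] at h3
  have := sgn_mul_self n a
  linear_combination (-sgn n a) * h3 - A a b * this

theorem rootMat_add_eq {n : ℕ} (a b : Fin (2 * n)) :
    (if b = a.rev then (2 : ℂ) else 1) • rootMat n a b =
      Matrix.single a b 1 + Matrix.single b.rev a.rev (-(sgn n a * sgn n b)) := by
  rw [rootMat_eq]
  split_ifs with h
  · subst h
    rw [sgn_rev, Fin.rev_rev, mul_neg, neg_neg, sgn_mul_self, Matrix.single_zero, add_zero, two_smul]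
  · rw [one_smul]

/-- The flip (a, b) ↦ (b.rev, a.rev) pairs the entries of X, so the sum over all positions counts
every root vector twice; hence the factor 1/2. On the antidiagonal a position is its own flip and
the root vector is a single matrix unit, which the extra 2 takes into account. -/
theorem sp_eq_sum {n : ℕ} (X : sp n) : X = ∑ a, ∑ b,
    ((2 : ℂ)⁻¹ * X.1 a b * (if b = a.rev then (2 : ℂ) else 1)) • rootVec n a b := by
  apply Subtype.ext
  have h1 : ∀ a b : Fin (2 * n),
      (((2 : ℂ)⁻¹ * X.1 a b * (if b = a.rev then (2 : ℂ) else 1)) • rootVec n a b : sp n).1 =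
      (2 : ℂ)⁻¹ • (Matrix.single a b (X.1 a b) + Matrix.single b.rev a.rev (X.1 b.rev a.rev)) := by
    intro a b
    change ((2 : ℂ)⁻¹ * X.1 a b * (if b = a.rev then (2 : ℂ) else 1)) • rootMat n a b = _
    rw [mul_smul, rootMat_add_eq, mul_smul, smul_add, Matrix.smul_single, Matrix.smul_single]
    congr 3
    · simp
    · rw [apply_of_mem_sp X.2 b.rev, sgn_rev, sgn_rev, Fin.rev_rev, Fin.rev_rev]
      simp; ring
  rw [AddSubmonoidClass.coe_finsetSum]
  simp_rw [AddSubmonoidClass.coe_finsetSum, h1, ← Finset.smul_sum, Finset.sum_add_distrib]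
  have h2 : ∑ a : Fin (2 * n), ∑ b : Fin (2 * n),
      Matrix.single b.rev a.rev (X.1 b.rev a.rev) = X.1 := by
    rw [Finset.sum_comm, ← Equiv.sum_comp Fin.revPerm]
    simp_rw [Fin.revPerm_apply, Fin.rev_rev]
    conv_rhs => rw [Matrix.matrix_eq_sum_single X.1]
    refine Finset.sum_congr rfl fun a _ => ?_
    rw [← Equiv.sum_comp Fin.revPerm]
    simp
  rw [h2, ← Matrix.matrix_eq_sum_single X.1, ← two_smul ℂ, smul_smul]
  simp

theorem rootMat_self_apply {n : ℕ} (a x y : Fin (2 * n)) : rootMat n a a x y =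
    if x = y then (if x = a then 1 else 0) - (if x = a.rev then 1 else 0) else 0 := by
  have h0 : a ≠ a.rev := by
    intro h; have := a.2; rw [Fin.ext_iff, Fin.val_rev] at h; omega
  simp only [rootMat, Matrix.of_apply, sgn_mul_self]
  by_cases h1 : x = a
  · subst h1
    by_cases h2 : y = x
    · subst h2; simp [h0]
    · simp [h2, h0, Ne.symm h2]
  · by_cases h2 : x = a.rev
    · subst h2
      by_cases h3 : y = a.rev
      · subst h3; simp [h0.symm]
      · simp [h0.symm, h3, Ne.symm h3]
    · simp [h1, h2]

theorem lie_simpleRoot_of_lt {n : ℕ} (k : Fin n) (h : (k : ℕ) + 1 < n) :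
    ⁅rootVec n (simpleRoot k).1.1 (simpleRoot k).1.2,
      rootVec n (simpleRoot k).1.2 (simpleRoot k).1.1⁆ =
    rootVec n (simpleRoot k).1.1 (simpleRoot k).1.1 -
      rootVec n (simpleRoot k).1.2 (simpleRoot k).1.2 := by
  apply Subtype.ext
  rw [LieSubalgebra.coe_bracket, Ring.lie_def]
  change rootMat n _ _ * rootMat n _ _ - rootMat n _ _ * rootMat n _ _ =
    rootMat n _ _ - rootMat n _ _
  set a := (simpleRoot k).1.1
  set b := (simpleRoot k).1.2
  have ha : (a : ℕ) = k := rfl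
  have hb : (b : ℕ) = k + 1 := rfl
  have hab : a ≠ b := by rw [ne_eq, Fin.ext_iff]; omega
  have h1 : a ≠ b.rev := by rw [ne_eq, Fin.ext_iff, Fin.val_rev]; omega
  have h2 : b ≠ a.rev := by rw [ne_eq, Fin.ext_iff, Fin.val_rev]; omega
  have h3 : a ≠ a.rev := by rw [ne_eq, Fin.ext_iff, Fin.val_rev]; omega
  have h4 : b ≠ b.rev := by rw [ne_eq, Fin.ext_iff, Fin.val_rev]; omega
  have sa : sgn n a = 1 := by simp [sgn, ha]
  have sb : sgn n b = 1 := by simp [sgn, hb, h]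
  simp [rootMat_eq, h1, h2, h3, h4, h1.symm, h2.symm, sa, sb, add_mul, mul_add,
    ← Matrix.single_neg]
  abel

theorem lie_simpleRoot_of_eq {n : ℕ} (k : Fin n) (h : (k : ℕ) + 1 = n) :
    ⁅rootVec n (simpleRoot k).1.1 (simpleRoot k).1.2,
      rootVec n (simpleRoot k).1.2 (simpleRoot k).1.1⁆ =
    rootVec n (simpleRoot k).1.1 (simpleRoot k).1.1 := by
  apply Subtype.ext
  rw [LieSubalgebra.coe_bracket, Ring.lie_def]
  change rootMat n _ _ * rootMat n _ _ - rootMat n _ _ * rootMat n _ _ = rootMat n _ _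
  set a := (simpleRoot k).1.1
  set b := (simpleRoot k).1.2
  have ha : (a : ℕ) = k := rfl
  have hb : b = a.rev := by
    rw [Fin.ext_iff, Fin.val_rev]; change (k : ℕ) + 1 = _; omega
  have h3 : a ≠ a.rev := by rw [ne_eq, Fin.ext_iff, Fin.val_rev]; omega
  rw [hb]
  simp [rootMat_eq, h3, sgn_mul_self, ← Matrix.single_neg]
  abel

/-- The diagonal root vectors are combinations of the simple coroots. -/
theorem rootU_self_mem {n : ℕ} (a : Fin (2 * n)) :
    (rootU a a : U n) ∈ Submodule.span ℂ (Set.range (hVec (n := n))) := by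
  -- Descending induction from the long simple root, with d the distance to it: there the coroot is
  -- the diagonal root vector itself, and before it the coroot is the difference of two consecutive
  -- ones.
  have key : ∀ (d : ℕ) (k : Fin n), n = k + 1 + d →
      (rootU (simpleRoot k).1.1 (simpleRoot k).1.1 : U n) ∈
        Submodule.span ℂ (Set.range (hVec (n := n))) := by
    intro d
    induction d with
    | zero =>
      intro k hk
      have : (rootU (simpleRoot k).1.1 (simpleRoot k).1.1 : U n) = hVec k := by
        rw [hVec, lie_simpleRoot_of_eq k (by omega)]; rfl
      rw [this]
      exact Submodule.subset_span ⟨k, rfl⟩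
    | succ d ih =>
      intro k hk
      have h1 := ih ⟨k + 1, by omega⟩ (by simp; omega)
      have h2 : (rootU (simpleRoot k).1.1 (simpleRoot k).1.1 : U n) =
          hVec k + rootU (simpleRoot k).1.2 (simpleRoot k).1.2 := by
        rw [hVec, lie_simpleRoot_of_lt k (by omega), map_sub]
        simp [rootU]
      rw [h2]
      exact add_mem (Submodule.subset_span ⟨k, rfl⟩) h1
  by_cases ha : (a : ℕ) < n
  · exact key (n - 1 - a) ⟨a, ha⟩ (by simp; omega)
  · obtain ⟨c, hc⟩ := rootU_flip a a
    rw [hc, ← Int.cast_smul_eq_zsmul ℂ]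
    have := a.2
    exact Submodule.smul_mem _ _ (key (n - 1 - a.rev) ⟨a.rev, by rw [Fin.val_rev]; omega⟩
      (by simp; omega))

theorem iota_mem_span {n : ℕ} (X : sp n) : UniversalEnvelopingAlgebra.ι ℂ X ∈
    Submodule.span ℂ (Set.range (eVec (n := n)) ∪ Set.range (fVec (n := n)) ∪
      Set.range (hVec (n := n))) := by
  rw [sp_eq_sum X]
  simp only [map_sum, map_smul]
  refine Submodule.sum_mem _ fun a _ => Submodule.sum_mem _ fun b _ => Submodule.smul_mem _ _ ?_
  change rootU a b ∈ _
  have ha := a.2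
  have hb := b.2
  rcases lt_trichotomy a b with h | h | h
  · refine Submodule.span_mono (Set.subset_union_of_subset_left Set.subset_union_left _) ?_
    by_cases h1 : (a : ℕ) + b < 2 * n
    · exact Submodule.subset_span ⟨⟨(a, b), h, h1⟩, rfl⟩
    · obtain ⟨c, hc⟩ := rootU_flip a b
      rw [hc, ← Int.cast_smul_eq_zsmul ℂ]
      refine Submodule.smul_mem _ _ (Submodule.subset_span ⟨⟨(b.rev, a.rev), ?_, ?_⟩, rfl⟩)
      · simpa using h
      · simp only [Fin.val_rev]; omega
  · subst h
    exact Submodule.span_mono Set.subset_union_right (rootU_self_mem a)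
  · refine Submodule.span_mono (Set.subset_union_of_subset_left Set.subset_union_right _) ?_
    by_cases h1 : (b : ℕ) + a < 2 * n
    · exact Submodule.subset_span ⟨⟨(b, a), h, h1⟩, rfl⟩
    · obtain ⟨c, hc⟩ := rootU_flip a b
      rw [hc, ← Int.cast_smul_eq_zsmul ℂ]
      refine Submodule.smul_mem _ _ (Submodule.subset_span ⟨⟨(a.rev, b.rev), ?_, ?_⟩, rfl⟩)
      · simpa using h
      · simp only [Fin.val_rev]; omega

theorem diagonal_mul_rootMat {n : ℕ} {d : Fin (2 * n) → ℂ} (hd : ∀ a, d a.rev = -d a)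
    (i j : Fin (2 * n)) : Matrix.diagonal d * rootMat n i j =
      rootMat n i j * Matrix.diagonal d + (d i - d j) • rootMat n i j := by
  ext a b
  rw [Matrix.diagonal_mul, Matrix.add_apply, Matrix.mul_diagonal, Matrix.smul_apply, smul_eq_mul]
  simp only [rootMat, Matrix.of_apply]
  split_ifs with h1 h2
  · rw [h1.1, h1.2]; ring
  · rw [h2.1, h2.2, hd, hd]; ring
  · ring

/-- A diagonal element of the symplectic Lie algebra. -/
def diagVec {n : ℕ} (d : Fin (2 * n) → ℂ) (hd : ∀ a, d a.rev = -d a) : sp n :=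
  ⟨Matrix.diagonal d, mem_sp_of n _ fun a b => by
    by_cases h : a = b
    · subst h
      rw [Matrix.diagonal_apply_eq, Matrix.diagonal_apply_eq, hd, sgn_mul_self]; ring
    · have : b.rev ≠ a.rev := fun h' => h (by simpa using h'.symm)
      rw [Matrix.diagonal_apply_ne _ h, Matrix.diagonal_apply_ne _ this, mul_zero]⟩

theorem iota_diagVec_mem {n : ℕ} (d : Fin (2 * n) → ℂ) (hd : ∀ a, d a.rev = -d a) :
    UniversalEnvelopingAlgebra.ι ℂ (diagVec d hd) ∈
      Submodule.span ℂ (Set.range (hVec (n := n))) := by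
  rw [sp_eq_sum (diagVec d hd)]
  simp only [map_sum, map_smul]
  refine Submodule.sum_mem _ fun a _ => Submodule.sum_mem _ fun b _ => ?_
  by_cases h : a = b
  · subst h
    exact Submodule.smul_mem _ _ (rootU_self_mem a)
  · have : (diagVec d hd).1 a b = 0 := Matrix.diagonal_apply_ne _ h
    rw [this]
    simp

theorem iota_diagVec_mul_rootU {n : ℕ} (d : Fin (2 * n) → ℂ) (hd : ∀ a, d a.rev = -d a)
    (i j : Fin (2 * n)) : UniversalEnvelopingAlgebra.ι ℂ (diagVec d hd) * (rootU i j : U n) =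
      rootU i j * UniversalEnvelopingAlgebra.ι ℂ (diagVec d hd) + (d i - d j) • rootU i j := by
  have : ⁅diagVec d hd, rootVec n i j⁆ = (d i - d j) • rootVec n i j := by
    apply Subtype.ext
    rw [LieSubalgebra.coe_bracket, Ring.lie_def]
    exact sub_eq_iff_eq_add'.mpr (diagonal_mul_rootMat hd i j)
  rw [rootU, ← map_smul, ← this, LieHom.map_lie, Ring.lie_def]
  abel

end

section

/-! ### The enveloping algebra acting on tensor powers -/

/-- By the universal property the inclusion of the subalgebra generated by the Lie algebra has a
section, so it is everything. This provides the induction principle on the enveloping algebra. -/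
theorem adjoin_range_iota (n : ℕ) :
    Algebra.adjoin ℂ (Set.range (UniversalEnvelopingAlgebra.ι ℂ : sp n → U n)) = ⊤ := by
  set S := Algebra.adjoin ℂ (Set.range (UniversalEnvelopingAlgebra.ι ℂ : sp n → U n)) with hS
  let g : sp n →ₗ⁅ℂ⁆ S :=
    { toFun := fun x => ⟨UniversalEnvelopingAlgebra.ι ℂ x, Algebra.subset_adjoin ⟨x, rfl⟩⟩
      map_add' := fun x y => Subtype.ext (map_add _ x y)
      map_smul' := fun c x => Subtype.ext (map_smul _ c x)
      map_lie' := fun {x y} => Subtype.ext (LieHom.map_lie _ x y) }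
  have h : S.val.comp (UniversalEnvelopingAlgebra.lift ℂ g) = AlgHom.id ℂ (U n) := by
    apply UniversalEnvelopingAlgebra.hom_ext
    ext x
    simp [g]
  rw [eq_top_iff]
  intro x _
  have := DFunLike.congr_fun h x
  rw [AlgHom.comp_apply, AlgHom.id_apply] at this
  rw [← this]
  exact (UniversalEnvelopingAlgebra.lift ℂ g x).2

theorem U_induction {n : ℕ} {p : U n → Prop} (hι : ∀ x : sp n, p (UniversalEnvelopingAlgebra.ι ℂ x))
    (hc : ∀ c : ℂ, p (algebraMap ℂ (U n) c)) (hadd : ∀ x y, p x → p y → p (x + y))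
    (hmul : ∀ x y, p x → p y → p (x * y)) (x : U n) : p x := by
  have hx : x ∈ Algebra.adjoin ℂ (Set.range (UniversalEnvelopingAlgebra.ι ℂ : sp n → U n)) := by
    rw [adjoin_range_iota]; trivial
  induction hx using Algebra.adjoin_induction with
  | mem x hx => obtain ⟨y, rfl⟩ := hx; exact hι y
  | algebraMap c => exact hc c
  | add x y _ _ hx hy => exact hadd x y hx hy
  | mul x y _ _ hx hy => exact hmul x y hx hy

section Rep

variable {P : Type*} [Fintype P] [DecidableEq P]

variable (P) in
/-- The tensor power of the vector representation. -/
def tensRep (n : ℕ) : sp n →ₗ⁅ℂ⁆ Module.End ℂ ((P → Fin (2 * n)) → ℂ) where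
  toFun X := tensAct P X.1
  map_add' X Y := tensAct_add X.1 Y.1
  map_smul' c X := tensAct_smul c X.1
  map_lie' {X Y} := tensAct_lie X.1 Y.1

variable (P) in
/-- The action of the enveloping algebra on the tensor power of the vector representation. -/
def tensHom (n : ℕ) : U n →ₐ[ℂ] Module.End ℂ ((P → Fin (2 * n)) → ℂ) :=
  UniversalEnvelopingAlgebra.lift ℂ (tensRep P n)

theorem tensHom_iota {n : ℕ} (X : sp n) :
    tensHom P n (UniversalEnvelopingAlgebra.ι ℂ X) = tensAct P X.1 :=
  UniversalEnvelopingAlgebra.lift_ι_apply ℂ (tensRep P n) X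

theorem tensHom_eVec {n : ℕ} (α : PosRoot n) :
    tensHom P n (eVec α) = tensAct P (rootMat n α.1.1 α.1.2) := tensHom_iota _

theorem tensHom_fVec {n : ℕ} (α : PosRoot n) :
    tensHom P n (fVec α) = tensAct P (rootMat n α.1.2 α.1.1) := tensHom_iota _

theorem map_divPow {A B : Type*} [Ring A] [Algebra ℂ A] [Ring B] [Algebra ℂ B] (g : A →ₐ[ℂ] B)
    (x : A) (k : ℕ) : g (divPow x k) = divPow (g x) k := by
  simp [divPow]

/-- The standard hermitian form on a tensor power. -/
def herm {I : Type*} [Fintype I] (F G : (P → I) → ℂ) : ℂ := ∑ t, star (F t) * G t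

theorem herm_tensAct {I : Type*} [Fintype I] (X : Matrix I I ℂ) (F G : (P → I) → ℂ) :
    herm (tensAct P X F) G = herm F (tensAct P Xᴴ G) := by
  simp only [herm, tensAct_apply, star_sum, Finset.sum_mul, Finset.mul_sum]
  rw [Finset.sum_comm]
  conv_rhs => rw [Finset.sum_comm]
  refine Finset.sum_congr rfl fun p _ => ?_
  rw [← Finset.sum_product', ← Finset.sum_product']
  -- The involution that exchanges the p-th entry of t with the summation index y transposes the
  -- matrix.
  refine Finset.sum_bij' (fun q _ => (Function.update q.1 p q.2, q.1 p))
    (fun q _ => (Function.update q.1 p q.2, q.1 p)) (by simp) (by simp) (by simp) (by simp) ?_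
  rintro ⟨t, y⟩ _
  simp only [Function.update_self, Function.update_idem, Function.update_eq_self, star_mul',
    Matrix.conjTranspose_apply]
  ring

theorem herm_self_eq_zero {I : Type*} [Fintype I] {F : (P → I) → ℂ} (h : herm F F = 0) : F = 0 := by
  have h1 : ∀ t, star (F t) * F t = ((Complex.normSq (F t) : ℝ) : ℂ) := fun t =>
    (Complex.normSq_eq_conj_mul_self).symm
  simp only [herm, h1] at h
  rw [← Complex.ofReal_sum, Complex.ofReal_eq_zero,
    Finset.sum_eq_zero_iff_of_nonneg fun t _ => Complex.normSq_nonneg _] at h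
  ext t
  exact Complex.normSq_eq_zero.mp (h t (Finset.mem_univ t))

theorem star_sgn (n : ℕ) (a : Fin (2 * n)) : star (sgn n a) = sgn n a := by
  unfold sgn; split_ifs <;> simp

theorem rootMat_conjTranspose {n : ℕ} (a b : Fin (2 * n)) :
    (rootMat n a b)ᴴ = rootMat n b a := by
  rw [rootMat_eq, rootMat_eq, Matrix.conjTranspose_add, Matrix.conjTranspose_single,
    Matrix.conjTranspose_single, star_one]
  congr 2
  have : (b = a.rev) = (a = b.rev) := by
    apply propext
    constructor <;> (rintro rfl; simp)
  simp only [this]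
  split_ifs
  · simp
  · rw [star_neg, star_mul', star_sgn, star_sgn, mul_comm]

/-- The symplectic Lie algebra is closed under conjugate transposition, because the signs defining
the form are real; adjoints then extend to products and sums. This makes the hermitian form
contravariant. -/
theorem exists_adjoint {n : ℕ} (x : U n) : ∃ y : U n, ∀ F G : (P → Fin (2 * n)) → ℂ,
    herm (tensHom P n x F) G = herm F (tensHom P n y G) := by
  induction x using U_induction with
  | hι X =>
    have : X.1ᴴ ∈ sp n := by
      apply mem_sp_of
      intro a b
      rw [Matrix.conjTranspose_apply, Matrix.conjTranspose_apply, apply_of_mem_sp X.2 b a, star_mul',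
        star_neg, star_mul', star_sgn, star_sgn]
      ring
    refine ⟨UniversalEnvelopingAlgebra.ι ℂ ⟨X.1ᴴ, this⟩, fun F G => ?_⟩
    rw [tensHom_iota, tensHom_iota, herm_tensAct]
  | hc c =>
    refine ⟨algebraMap ℂ _ (star c), fun F G => ?_⟩
    simp only [AlgHom.commutes, Module.algebraMap_end_apply, herm, Pi.smul_apply, smul_eq_mul,
      star_mul']
    exact Finset.sum_congr rfl fun t _ => by ring
  | hadd x y hx hy =>
    obtain ⟨x', hx⟩ := hx
    obtain ⟨y', hy⟩ := hy
    refine ⟨x' + y', fun F G => ?_⟩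
    have h1 := hx F G
    have h2 := hy F G
    simp only [map_add, LinearMap.add_apply, herm, Pi.add_apply, star_add, add_mul, mul_add,
      Finset.sum_add_distrib] at h1 h2 ⊢
    rw [h1, h2]
  | hmul x y hx hy =>
    obtain ⟨x', hx⟩ := hx
    obtain ⟨y', hy⟩ := hy
    refine ⟨y' * x', fun F G => ?_⟩
    rw [map_mul, map_mul, Module.End.mul_apply, Module.End.mul_apply, hx, hy]

end Rep

/-! ### Verma modules -/

section Verma

variable {n : ℕ} (lam : Weight n)

/-- The generator of the Verma module. -/
def vermaGen : Verma lam := (vermaIdeal lam).mkQ 1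

theorem smul_vermaGen (x : U n) : x • vermaGen lam = (vermaIdeal lam).mkQ x := by
  rw [vermaGen, ← map_smul, smul_eq_mul, mul_one]

theorem eVec_smul_vermaGen (α : PosRoot n) : eVec α • vermaGen lam = 0 := by
  rw [smul_vermaGen, Submodule.mkQ_apply, Submodule.Quotient.mk_eq_zero]
  exact Submodule.subset_span (Or.inl ⟨α, rfl⟩)

theorem hVec_smul_vermaGen (k : Fin n) : hVec k • vermaGen lam = (lam k : ℂ) • vermaGen lam := by
  have : (lam k : ℂ) • vermaGen lam = algebraMap ℂ (U n) (lam k) • vermaGen lam :=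
    (algebraMap_smul (U n) _ _).symm
  rw [this, smul_vermaGen, smul_vermaGen, ← sub_eq_zero, ← map_sub, Submodule.mkQ_apply,
    Submodule.Quotient.mk_eq_zero]
  exact Submodule.subset_span (Or.inr ⟨k, rfl⟩)

/-- The Verma module is spanned by the products of the `f_α` applied to the generator. -/
theorem verma_span : Submodule.span ℂ (Set.range fun L : List (PosRoot n) =>
    (L.map fVec).prod • vermaGen lam) = ⊤ := by
  set B := Submodule.span ℂ (Set.range fun L : List (PosRoot n) =>
    (L.map fVec).prod • vermaGen lam) with hB
  have hmem : ∀ L : List (PosRoot n), (L.map fVec).prod • vermaGen lam ∈ B :=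
    fun L => Submodule.subset_span ⟨L, rfl⟩
  have hf : ∀ (α : PosRoot n) (w : Verma lam), w ∈ B → fVec α • w ∈ B := by
    intro α w hw
    induction hw using Submodule.span_induction with
    | mem w hw =>
      obtain ⟨L, rfl⟩ := hw
      have := hmem (α :: L)
      rwa [List.map_cons, List.prod_cons, mul_smul] at this
    | zero => rw [smul_zero]; exact zero_mem _
    | add x y _ _ hx hy => rw [smul_add]; exact add_mem hx hy
    | smul c x _ hx => rw [smul_comm]; exact B.smul_mem c hx
  -- The statement is for all X at once, since moving X past f_β produces the bracket of X with f_β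
  -- acting on the shorter product.
  have key : ∀ (L : List (PosRoot n)) (X : sp n),
      UniversalEnvelopingAlgebra.ι ℂ X • (L.map fVec).prod • vermaGen lam ∈ B := by
    intro L
    induction L with
    | nil =>
      intro X
      rw [List.map_nil, List.prod_nil, one_smul]
      have hX := iota_mem_span X
      generalize UniversalEnvelopingAlgebra.ι ℂ X = x at hX ⊢
      induction hX using Submodule.span_induction with
      | mem x hx =>
        obtain (⟨α, rfl⟩ | ⟨α, rfl⟩) | ⟨k, rfl⟩ := hx
        · rw [eVec_smul_vermaGen]; exact zero_mem _
        · simpa using hmem [α]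
        · rw [hVec_smul_vermaGen]; exact B.smul_mem _ (by simpa using hmem [])
      | zero => rw [zero_smul]; exact zero_mem _
      | add x y _ _ hx hy => rw [add_smul]; exact add_mem hx hy
      | smul c x _ hx => rw [smul_assoc]; exact B.smul_mem c hx
    | cons β L ih =>
      intro X
      have e : UniversalEnvelopingAlgebra.ι ℂ X * fVec β = fVec β * UniversalEnvelopingAlgebra.ι ℂ X +
          UniversalEnvelopingAlgebra.ι ℂ ⁅X, rootVec n β.1.2 β.1.1⁆ := by
        rw [LieHom.map_lie, Ring.lie_def, fVec]; abel
      rw [List.map_cons, List.prod_cons, ← mul_smul, ← mul_assoc, e, add_mul, add_smul, mul_assoc,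
        mul_smul, mul_smul, mul_smul]
      exact add_mem (hf β _ (ih X)) (ih _)
  have hU : ∀ (x : U n) (w : Verma lam), w ∈ B → x • w ∈ B := by
    intro x
    induction x using U_induction with
    | hι X =>
      intro w hw
      induction hw using Submodule.span_induction with
      | mem w hw => obtain ⟨L, rfl⟩ := hw; exact key L X
      | zero => rw [smul_zero]; exact zero_mem _
      | add x y _ _ hx hy => rw [smul_add]; exact add_mem hx hy
      | smul c x _ hx => rw [smul_comm]; exact B.smul_mem c hx
    | hc c => intro w hw; rw [algebraMap_smul]; exact B.smul_mem c hw
    | hadd x y hx hy => intro w hw; rw [add_smul]; exact add_mem (hx w hw) (hy w hw)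
    | hmul x y hx hy => intro w hw; rw [mul_smul]; exact hx _ (hy w hw)
  rw [eq_top_iff]
  intro w _
  obtain ⟨x, rfl⟩ := (vermaIdeal lam).mkQ_surjective w
  rw [← smul_vermaGen]
  exact hU x _ (by simpa using hmem [])

end Verma

end

section

/-! ### Realization of irreducible modules in tensor powers -/

theorem ht_rev {n : ℕ} (a : Fin (2 * n)) : 2 * (n : ℂ) - 1 - 2 * ((a.rev : ℕ) : ℂ) =
    -(2 * (n : ℂ) - 1 - 2 * ((a : ℕ) : ℂ)) := by
  have : ((a.rev : ℕ) : ℂ) = 2 * n - ((a : ℕ) + 1) := by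
    rw [Fin.val_rev, Nat.cast_sub (by omega)]; push_cast; ring
  rw [this]; ring

/-- A diagonal element for which all the `f_α` have negative weight. -/
def htVec (n : ℕ) : sp n := diagVec (fun a => 2 * (n : ℂ) - 1 - 2 * ((a : ℕ) : ℂ)) ht_rev

theorem htVec_mul_fVec {n : ℕ} (β : PosRoot n) :
    ∃ k : ℕ, 0 < k ∧ UniversalEnvelopingAlgebra.ι ℂ (htVec n) * fVec β =
      fVec β * UniversalEnvelopingAlgebra.ι ℂ (htVec n) - (k : ℂ) • fVec β := by
  have h := β.2.1
  rw [Fin.lt_def] at h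
  refine ⟨2 * (β.1.2 - β.1.1), by omega, ?_⟩
  change _ * rootU β.1.2 β.1.1 = rootU β.1.2 β.1.1 * _ - _ • rootU β.1.2 β.1.1
  rw [htVec, iota_diagVec_mul_rootU, sub_eq_add_neg (rootU β.1.2 β.1.1 * _), ← neg_smul]
  congr 2
  push_cast [h.le]
  ring

/-- An eigenvector cannot be a combination of eigenvectors for other eigenvalues. This isolates the
highest weight component inside an arbitrary quotient of the Verma module. -/
theorem eq_zero_of_eigen_add {M : Type*} [AddCommGroup M] [Module ℂ M] {T : Module.End ℂ M}
    {c d : ℂ} (hd : d ≠ 0) {x z : M} (hx : T x = c • x)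
    (hz : z ∈ ⨆ μ : ℂ, ⨆ _ : μ ≠ c, T.eigenspace μ) (h : d • x + z = 0) : x = 0 := by
  have h4 : x ∈ ⨆ μ : ℂ, ⨆ _ : μ ≠ c, T.eigenspace μ := by
    have : x = -d⁻¹ • z := by
      rw [neg_smul, ← smul_neg, ← eq_neg_of_add_eq_zero_left h, smul_smul, inv_mul_cancel₀ hd,
        one_smul]
    rw [this]
    exact Submodule.smul_mem _ _ hz
  exact Submodule.disjoint_def.mp (T.eigenspaces_iSupIndep c) _
    (Module.End.mem_eigenspace_iff.mpr hx) h4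

section Eigen

variable {n : ℕ} {lam : Weight n}

theorem htVec_smul_vermaGen : ∃ c : ℂ,
    UniversalEnvelopingAlgebra.ι ℂ (htVec n) • vermaGen lam = c • vermaGen lam := by
  have h := iota_diagVec_mem (n := n) (fun a => 2 * (n : ℂ) - 1 - 2 * ((a : ℕ) : ℂ)) ht_rev
  change UniversalEnvelopingAlgebra.ι ℂ (htVec n) ∈ _ at h
  generalize UniversalEnvelopingAlgebra.ι ℂ (htVec n) = x at h ⊢
  induction h using Submodule.span_induction with
  | mem x hx => obtain ⟨k, rfl⟩ := hx; exact ⟨_, hVec_smul_vermaGen lam k⟩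
  | zero => exact ⟨0, by simp⟩
  | add x y _ _ hx hy =>
    obtain ⟨a, ha⟩ := hx
    obtain ⟨b, hb⟩ := hy
    exact ⟨a + b, by rw [add_smul, add_smul, ha, hb]⟩
  | smul c x _ hx =>
    obtain ⟨a, ha⟩ := hx
    exact ⟨c * a, by rw [smul_assoc, ha, smul_smul]⟩

/-- Each f lowers the eigenvalue of `htVec` by a positive integer, so among these spanning vectors
the eigenvalue of the generator occurs only at the empty product. -/
theorem htVec_smul_prod {c : ℂ}
    (hc : UniversalEnvelopingAlgebra.ι ℂ (htVec n) • vermaGen lam = c • vermaGen lam)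
    (L : List (PosRoot n)) : ∃ k : ℕ, (L ≠ [] → 0 < k) ∧
      UniversalEnvelopingAlgebra.ι ℂ (htVec n) • (L.map fVec).prod • vermaGen lam =
        (c - k) • (L.map fVec).prod • vermaGen lam := by
  induction L with
  | nil => exact ⟨0, by simp, by simpa using hc⟩
  | cons β L ih =>
    obtain ⟨k, -, hk⟩ := ih
    obtain ⟨j, hj0, hj⟩ := htVec_mul_fVec β
    refine ⟨j + k, fun _ => by omega, ?_⟩
    rw [List.map_cons, List.prod_cons, mul_smul, ← mul_smul, hj, sub_smul, mul_smul, hk,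
      smul_comm (fVec β), smul_assoc, ← sub_smul]
    push_cast
    ring_nf

variable {P : Type*} [Fintype P] [DecidableEq P]

/-- A highest weight vector in a tensor power generates an irreducible module. -/
theorem exists_embedding {v : (P → Fin (2 * n)) → ℂ} (hv : v ≠ 0)
    (he : ∀ α : PosRoot n, tensHom P n (eVec α) v = 0)
    (hh : ∀ k : Fin n, tensHom P n (hVec k) v = (lam k : ℂ) • v) :
    ∃ Θ : V lam →+ ((P → Fin (2 * n)) → ℂ), Function.Injective Θ ∧
      (∀ (x : U n) (w : V lam), Θ (x • w) = tensHom P n x (Θ w)) ∧ Θ (hwVec lam) = v := by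
  let _ : Module (U n) ((P → Fin (2 * n)) → ℂ) :=
    Module.compHom _ (tensHom P n).toRingHom
  have hsm : ∀ (x : U n) (F : (P → Fin (2 * n)) → ℂ), x • F = tensHom P n x F := fun _ _ => rfl
  have hle : vermaIdeal lam ≤ LinearMap.ker (LinearMap.toSpanSingleton (U n) _ v) := by
    rw [vermaIdeal, Submodule.span_le]
    rintro x (⟨α, rfl⟩ | ⟨k, rfl⟩)
    · rw [SetLike.mem_coe, LinearMap.mem_ker, LinearMap.toSpanSingleton_apply, hsm, he]
    · rw [SetLike.mem_coe, LinearMap.mem_ker, LinearMap.toSpanSingleton_apply, hsm, map_sub,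
        LinearMap.sub_apply, hh, AlgHom.commutes, Module.algebraMap_end_apply, sub_self]
  let θ : Verma lam →ₗ[U n] ((P → Fin (2 * n)) → ℂ) := (vermaIdeal lam).liftQ _ hle
  have hθ : θ (vermaGen lam) = v := by
    change (vermaIdeal lam).liftQ _ hle ((vermaIdeal lam).mkQ 1) = v
    rw [Submodule.mkQ_apply, Submodule.liftQ_apply, LinearMap.toSpanSingleton_apply, one_smul]
  have hker : LinearMap.ker θ ≠ ⊤ := by
    intro h
    have : vermaGen lam ∈ LinearMap.ker θ := by rw [h]; trivial
    rw [LinearMap.mem_ker, hθ] at this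
    exact hv this
  have hle1 : LinearMap.ker θ ≤ maxSub lam := le_sSup hker
  -- A submodule N that is not inside the kernel is shown to contain the generator. For w in N with
  -- θ w ≠ 0, an adjoint y of an element producing w moves w to a vector with a nonzero component
  -- along the generator.
  have hle2 : maxSub lam ≤ LinearMap.ker θ := by
    refine sSup_le fun N hN => ?_
    by_contra hcon
    obtain ⟨w, hwN, hw⟩ := SetLike.not_le_iff_exists.mp hcon
    rw [LinearMap.mem_ker] at hw
    obtain ⟨x, hx⟩ : ∃ x : U n, x • vermaGen lam = w := by
      obtain ⟨x, rfl⟩ := (vermaIdeal lam).mkQ_surjective w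
      exact ⟨x, smul_vermaGen lam x⟩
    obtain ⟨y, hy⟩ := exists_adjoint (P := P) x
    -- This number equals the hermitian square of θ w.
    have hne : herm v (θ (y • w)) ≠ 0 := by
      have := hy v (θ w)
      rw [← hsm, ← hθ, ← map_smul, hx, ← hsm, ← map_smul, hθ] at this
      rw [← this]
      exact fun h => hw (herm_self_eq_zero h)
    obtain ⟨c, hc⟩ := htVec_smul_vermaGen (lam := lam)
    let T : Module.End ℂ (Verma lam ⧸ N) :=
      Algebra.lsmul ℂ ℂ (Verma lam ⧸ N) (UniversalEnvelopingAlgebra.ι ℂ (htVec n))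
    have hT : ∀ w : Verma lam, T (N.mkQ w) =
        N.mkQ (UniversalEnvelopingAlgebra.ι ℂ (htVec n) • w) := fun w => by
      rw [map_smul]; rfl
    -- The generator coefficient d is detected by pairing with v, since every f has an e as adjoint
    -- and v is killed by the e's. The decomposition is stated modulo N, where the independence of
    -- eigenspaces will be used.
    have hdec : ∀ w : Verma lam, ∃ d : ℂ, ∃ z ∈ ⨆ μ : ℂ, ⨆ _ : μ ≠ c, T.eigenspace μ,
        N.mkQ w = d • N.mkQ (vermaGen lam) + z ∧ herm v (θ w) = d * herm v v := by
      intro w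
      have hw : w ∈ Submodule.span ℂ (Set.range fun L : List (PosRoot n) =>
          (L.map fVec).prod • vermaGen lam) := by rw [verma_span]; trivial
      have hsmul : ∀ (d : ℂ) (w : Verma lam), N.mkQ (d • w) = d • N.mkQ w := fun d w => rfl
      have hsmul' : ∀ (d : ℂ) (w : Verma lam), θ (d • w) = d • θ w := fun d w => by
        rw [← algebraMap_smul (U n) d w, map_smul, hsm, AlgHom.commutes,
          Module.algebraMap_end_apply]
      induction hw using Submodule.span_induction with
      | mem w hw =>
        obtain ⟨L, rfl⟩ := hw
        rcases L with _ | ⟨β, L⟩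
        · exact ⟨1, 0, zero_mem _, by simp, by simp [hθ]⟩
        · obtain ⟨k, hk0, hk⟩ := htVec_smul_prod hc (β :: L)
          refine ⟨0, N.mkQ (((β :: L).map fVec).prod • vermaGen lam), ?_, by simp, ?_⟩
          · have hk' : c - k ≠ c := by
              have : (k : ℂ) ≠ 0 := by exact_mod_cast (hk0 (by simp)).ne'
              simpa using this
            refine Submodule.mem_iSup_of_mem (c - k) (Submodule.mem_iSup_of_mem hk' ?_)
            rw [Module.End.mem_eigenspace_iff, hT, hk, hsmul]
          · beta_reduce
            rw [List.map_cons, List.prod_cons, mul_smul, map_smul, hsm, tensHom_fVec, zero_mul]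
            have := herm_tensAct (rootMat n β.1.1 β.1.2) v (θ ((L.map fVec).prod • vermaGen lam))
            rw [rootMat_conjTranspose, ← tensHom_eVec, he] at this
            rw [← this]
            simp [herm]
      | zero => exact ⟨0, 0, zero_mem _, by simp, by simp [herm]⟩
      | add x y _ _ hx hy =>
        obtain ⟨d, z, hz, h1, h2⟩ := hx
        obtain ⟨d', z', hz', h1', h2'⟩ := hy
        refine ⟨d + d', z + z', add_mem hz hz', ?_, ?_⟩
        · rw [map_add, h1, h1', add_smul]; abel
        · rw [map_add, add_mul, ← h2, ← h2']
          simp [herm, mul_add, Finset.sum_add_distrib]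
      | smul a x _ hx =>
        obtain ⟨d, z, hz, h1, h2⟩ := hx
        refine ⟨a * d, a • z, Submodule.smul_mem _ a hz, ?_, ?_⟩
        · rw [hsmul, h1, smul_add, smul_smul]
        · rw [hsmul', mul_assoc, ← h2]
          simp only [herm, Pi.smul_apply, smul_eq_mul, Finset.mul_sum]
          exact Finset.sum_congr rfl fun t _ => by ring
    obtain ⟨d, z, hz, h1, h2⟩ := hdec (y • w)
    have hd : d ≠ 0 := by rintro rfl; exact hne (by rw [h2, zero_mul])
    have h3 : N.mkQ (y • w) = 0 := by
      rw [Submodule.mkQ_apply, Submodule.Quotient.mk_eq_zero]; exact N.smul_mem _ hwN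
    have h6 : N.mkQ (vermaGen lam) = 0 :=
      eq_zero_of_eigen_add hd (by rw [hT, hc]; rfl) hz (h1.symm.trans h3)
    rw [Submodule.mkQ_apply, Submodule.Quotient.mk_eq_zero] at h6
    apply hN
    rw [eq_top_iff]
    intro u _
    obtain ⟨x, rfl⟩ := (vermaIdeal lam).mkQ_surjective u
    rw [← smul_vermaGen]
    exact N.smul_mem x h6
  let Θ : V lam →ₗ[U n] ((P → Fin (2 * n)) → ℂ) := (maxSub lam).liftQ θ hle2
  refine ⟨Θ.toAddMonoidHom, ?_, fun x w => map_smul Θ x w, ?_⟩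
  · have : LinearMap.ker Θ = ⊥ := Submodule.ker_liftQ_eq_bot _ _ _ hle1
    exact LinearMap.ker_eq_bot.mp this
  · exact hθ

end Eigen

/-- The matrix whose columns are the basis vectors with the given indices. -/
def colMat {I κ : Type*} [DecidableEq I] (R : Type*) [CommRing R] (g : κ → I) : Matrix I κ R :=
  Matrix.of fun x c => if x = g c then 1 else 0

theorem mul_colMat {I κ : Type*} [Fintype I] [DecidableEq I] {R : Type*} [CommRing R]
    (X : Matrix I I R) (g : κ → I) (x : I) (c : κ) : (X * colMat R g) x c = X x (g c) := by
  simp [Matrix.mul_apply, colMat]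

theorem wedgeVec_colMat_ne_zero {I J κ : Type*} [Fintype I] [DecidableEq I] [Fintype J]
    [Fintype κ] [DecidableEq κ] {g : κ → I} (hg : Function.Injective g) :
    wedgeVec J (colMat ℂ g) ≠ 0 := by
  intro h
  have h1 := congrFun h fun p => g p.2
  have h2 : (colMat ℂ g).submatrix (fun k => g k) id = 1 := by
    ext a b
    simp [colMat, Matrix.one_apply, hg.eq_iff]
  simp [wedgeVec, h2] at h1

/-- The chosen basis vectors form an initial segment, so their span is stable under upper triangular
matrices; the matrix on the right is the restriction, whose trace gives the weight. -/
theorem colMat_invariant {n : ℕ} {κ : Type*} [Fintype κ] {r : ℕ}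
    {g : κ → Fin (2 * n)} (hr : ∀ x, x ∈ Set.range g ↔ (x : ℕ) < r) (hg : Function.Injective g)
    {X : Matrix (Fin (2 * n)) (Fin (2 * n)) ℂ} (hX : ∀ a b, b < a → X a b = 0) :
    X * colMat ℂ g = colMat ℂ g * Matrix.of fun c c' => X (g c) (g c') := by
  classical
  ext x c
  rw [mul_colMat, Matrix.mul_apply]
  by_cases hx : x ∈ Set.range g
  · obtain ⟨d, rfl⟩ := hx
    rw [Finset.sum_eq_single d]
    · simp [colMat]
    · intro b _ hb
      simp [colMat, hg.eq_iff, hb.symm]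
    · simp
  · have h1 : ∀ d, x ≠ g d := fun d h => hx ⟨d, h.symm⟩
    have h2 : (g c : ℕ) < r := (hr _).mp ⟨c, rfl⟩
    have h3 : ¬ (x : ℕ) < r := fun h => hx ((hr x).mpr h)
    rw [hX x (g c) (by rw [Fin.lt_def]; omega)]
    simp [colMat, h1]

theorem rootMat_upper {n : ℕ} {i j : Fin (2 * n)} (h : i ≤ j) (a b : Fin (2 * n)) (hab : b < a) :
    rootMat n i j a b = 0 := by
  simp only [rootMat, Matrix.of_apply]
  rw [if_neg, if_neg]
  · rintro ⟨rfl, rfl⟩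
    rw [Fin.rev_lt_rev] at hab
    exact absurd h (not_le.mpr hab)
  · rintro ⟨rfl, rfl⟩
    exact absurd h (not_le.mpr hab)

/-- The irreducible module whose highest weight is a multiple of a fundamental weight, in a tensor
power of an exterior power of the vector representation. -/
theorem exists_realization {n : ℕ} (k : Fin n) (ℓ : ℕ) {κ : Type*} [Fintype κ] [DecidableEq κ]
    {g : κ → Fin (2 * n)} (hg : Function.Injective g)
    (hr : ∀ x, x ∈ Set.range g ↔ (x : ℕ) < k + 1) :
    ∃ Θ : V ((ℓ : ℤ) • fundWeight k) →+ ((Fin ℓ × κ → Fin (2 * n)) → ℂ), Function.Injective Θ ∧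
      (∀ (x : U n) (w : V ((ℓ : ℤ) • fundWeight k)), Θ (x • w) = tensHom (Fin ℓ × κ) n x (Θ w)) ∧
      Θ (hwVec ((ℓ : ℤ) • fundWeight k)) = wedgeVec (Fin ℓ) (colMat ℂ g) := by
  have hsum : ∀ a : Fin (2 * n), ∑ c, (if g c = a then (1 : ℂ) else 0) =
      if (a : ℕ) < k + 1 then 1 else 0 := by
    intro a
    split_ifs with h
    · obtain ⟨c, rfl⟩ := (hr a).mpr h
      rw [Finset.sum_eq_single c (fun b _ hb => if_neg fun h => hb (hg h)) (by simp), if_pos rfl]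
    · exact Finset.sum_eq_zero fun c _ => if_neg fun hc => h ((hr a).mp ⟨c, hc⟩)
  -- The trace only asks whether a or its opposite lies in the initial segment; the coroots are
  -- differences of such diagonal vectors, or a single one for the long root.
  have htr : ∀ a : Fin (2 * n), (Matrix.of fun c c' => rootMat n a a (g c) (g c')).trace =
      (if (a : ℕ) < k + 1 then 1 else 0) - (if (a.rev : ℕ) < k + 1 then 1 else 0) := by
    intro a
    rw [← hsum, ← hsum, ← Finset.sum_sub_distrib]
    simp [Matrix.trace, rootMat_self_apply]
  refine exists_embedding (wedgeVec_colMat_ne_zero hg) (fun α => ?_) (fun j => ?_)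
  · rw [tensHom_eVec, tensAct_wedgeVec (colMat_invariant hr hg (rootMat_upper α.2.1.le))]
    have h0 : ∀ a : Fin (2 * n), rootMat n α.1.1 α.1.2 a a = 0 := by
      intro a
      have h := α.2.1.ne
      simp only [rootMat, Matrix.of_apply]
      rw [if_neg, if_neg]
      · rintro ⟨h1, h2⟩
        exact h (by simpa [h1] using h2.symm)
      · rintro ⟨h1, h2⟩
        exact h (h1.symm.trans h2)
    simp [Matrix.trace, h0]
  · have hj := j.2
    have hk := k.2
    have e1 : ((simpleRoot j).1.1 : ℕ) = j := rfl
    have e2 : ((simpleRoot j).1.2 : ℕ) = j + 1 := rfl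
    rw [hVec, tensHom_iota]
    by_cases h : (j : ℕ) + 1 < n
    · rw [lie_simpleRoot_of_lt j h]
      change tensAct _ (rootMat n _ _ - rootMat n _ _) _ = _
      rw [sub_eq_add_neg, tensAct_add, ← neg_one_smul ℂ, tensAct_smul, LinearMap.add_apply,
        LinearMap.smul_apply, tensAct_wedgeVec (colMat_invariant hr hg (rootMat_upper le_rfl)),
        tensAct_wedgeVec (colMat_invariant hr hg (rootMat_upper le_rfl)), htr, htr, e1, e2,
        Fin.val_rev, Fin.val_rev, e1, e2, smul_smul, ← add_smul]
      congr 1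
      simp only [Fintype.card_fin, fundWeight, Pi.smul_apply, Pi.single_apply, smul_eq_mul]
      rw [if_neg (show ¬ 2 * n - (j + 1) < (k : ℕ) + 1 by omega),
        if_neg (show ¬ 2 * n - (j + 1 + 1) < (k : ℕ) + 1 by omega)]
      by_cases hjk : j = k
      · subst hjk; simp
      · have : (j : ℕ) ≠ k := fun h => hjk (Fin.ext h)
        by_cases hlt : (j : ℕ) < k
        · rw [if_pos (by omega), if_pos (by omega)]; simp [hjk]
        · rw [if_neg (by omega), if_neg (by omega)]; simp [hjk]
    · rw [lie_simpleRoot_of_eq j (by omega)]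
      change tensAct _ (rootMat n _ _) _ = _
      rw [tensAct_wedgeVec (colMat_invariant hr hg (rootMat_upper le_rfl)), htr, e1, Fin.val_rev, e1]
      congr 1
      simp only [Fintype.card_fin, fundWeight, Pi.smul_apply, Pi.single_apply, smul_eq_mul]
      rw [if_neg (show ¬ 2 * n - (j + 1) < (k : ℕ) + 1 by omega)]
      by_cases hjk : j = k
      · subst hjk; simp
      · have : (j : ℕ) ≠ k := fun h => hjk (Fin.ext h)
        rw [if_neg (by omega)]; simp [hjk]

end

section

/-! ### Extremal vectors -/

section Exp

variable {n : ℕ} {lam : Weight n} {J κ : Type*} [Fintype J] [DecidableEq J] [Fintype κ]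
  [DecidableEq κ]

/-- The exponential of an element of square zero acts on exterior products through its matrix. -/
theorem map_expAct {Θ : V lam →+ ((J × κ → Fin (2 * n)) → ℂ)} (hΘ : Function.Injective Θ)
    (hx : ∀ (x : U n) (w : V lam), Θ (x • w) = tensHom (J × κ) n x (Θ w)) (Y : sp n)
    (hY : Y.1 * Y.1 = 0) {w : V lam} {K : Matrix (Fin (2 * n)) κ ℂ} (hw : Θ w = wedgeVec J K) :
    Θ (expAct (UniversalEnvelopingAlgebra.ι ℂ Y) w) = wedgeVec J ((1 + Y.1) * K) := by
  let F : (J × κ → Fin (2 * n)) → MvPolynomial Unit ℂ := fun t =>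
    wedgeVec J (expFactor (fun _ : Unit => Y.1) () * constMat Unit K) t
  have hF : ∀ (k : ℕ) (t), MvPolynomial.coeff (Finsupp.single () k) (F t) =
      Θ (divPow (UniversalEnvelopingAlgebra.ι ℂ Y) k • w) t := by
    intro k t
    have h := congrFun (coeff_wedgeVec_expFactor (J := J) (X := fun _ : Unit => Y.1) (a := ()) hY
      (K := constMat Unit K) (fun x c => by rw [constMat_apply, MvPolynomial.pderiv_C])
      (Finsupp.single () k)) t
    rw [h, hx, map_divPow, tensHom_iota, hw, Finsupp.single_eq_same, Finsupp.erase_single]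
    have h0 : (fun t => MvPolynomial.coeff 0 (wedgeVec J (constMat Unit K) t)) = wedgeVec J K := by
      ext1 t
      rw [constMat, wedgeVec_map, MvPolynomial.coeff_zero_C]
    rw [h0]
  -- The coordinates of the divided powers are coefficients of finitely many polynomials, so they
  -- vanish for large exponents. By injectivity of Θ the sum defining the exponential is then
  -- finite.
  obtain ⟨D, hD⟩ : ∃ D : ℕ, ∀ t, (F t).totalDegree ≤ D :=
    ⟨Finset.univ.sup fun t => (F t).totalDegree, fun t =>
      Finset.le_sup (f := fun t => (F t).totalDegree) (Finset.mem_univ t)⟩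
  have hzero : ∀ k, D < k → divPow (UniversalEnvelopingAlgebra.ι ℂ Y) k • w = 0 := by
    intro k hk
    apply hΘ
    rw [map_zero]
    ext t
    rw [← hF]
    apply MvPolynomial.coeff_eq_zero_of_totalDegree_lt
    refine (hD t).trans_lt (hk.trans_le ?_)
    by_cases h0 : k = 0
    · omega
    · simp [Finsupp.support_single, h0]
  rw [expAct, finsum_eq_sum_of_support_subset (s := Finset.range (D + 1)), map_sum]
  · ext t
    rw [Finset.sum_apply]
    simp_rw [← hF]
    -- The exponential is the sum of all coefficients of the generating function, that is, its value
    -- at 1.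
    have hev : wedgeVec J ((1 + Y.1) * K) t = MvPolynomial.eval (fun _ => (1 : ℂ)) (F t) := by
      rw [← wedgeVec_map, Matrix.map_mul]
      congr 2
      · ext a b
        simp [expFactor, constMat_apply, Matrix.one_apply]
      · ext a b
        simp [constMat_apply]
    rw [hev, MvPolynomial.eval_eq]
    simp only [one_pow, Finset.prod_const_one, mul_one]
    rw [← Finset.sum_image (g := fun k : ℕ => Finsupp.single () k)
      (f := fun s => MvPolynomial.coeff s (F t))]
    · refine (Finset.sum_subset ?_ ?_).symm
      · intro s hs
        rw [Finset.mem_image]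
        refine ⟨s (), ?_, by ext; simp⟩
        have h1 := MvPolynomial.le_totalDegree hs
        have h2 : s.sum (fun _ e => e) = s () := by
          rw [Finsupp.sum_fintype _ _ (fun _ => rfl)]; simp
        rw [Finset.mem_range]
        have := hD t
        omega
      · intro s _ hs
        exact MvPolynomial.notMem_support_iff.mp hs
    · intro a _ b _ h
      simpa using DFunLike.congr_fun h ()
  · intro k hk
    rw [Finset.coe_range, Set.mem_Iio]
    by_contra hcon
    exact hk (hzero k (by omega))

theorem rootMat_sq {n : ℕ} {i j : Fin (2 * n)} (h : i ≠ j) :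
    rootMat n i j * rootMat n i j = 0 := by
  have h0 : ∀ a : Fin (2 * n), a ≠ a.rev := by
    intro a h; have := a.2; rw [Fin.ext_iff, Fin.val_rev] at h; omega
  exact rootMat_mul_zero h.symm (h0 j) (h0 i) h

/-- The matrix of the representative of a simple reflection. -/
def reflMat {n : ℕ} (k : Fin n) : Matrix (Fin (2 * n)) (Fin (2 * n)) ℂ :=
  (1 + rootMat n (simpleRoot k).1.1 (simpleRoot k).1.2) *
    ((1 - rootMat n (simpleRoot k).1.2 (simpleRoot k).1.1) *
      (1 + rootMat n (simpleRoot k).1.1 (simpleRoot k).1.2))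

theorem map_extremalVec {Θ : V lam →+ ((J × κ → Fin (2 * n)) → ℂ)} (hΘ : Function.Injective Θ)
    (hx : ∀ (x : U n) (w : V lam), Θ (x • w) = tensHom (J × κ) n x (Θ w))
    {K : Matrix (Fin (2 * n)) κ ℂ} (hw : Θ (hwVec lam) = wedgeVec J K) (L : List (Fin n)) :
    Θ (extremalVec lam L) = wedgeVec J ((L.map reflMat).prod * K) := by
  induction L with
  | nil => rw [List.map_nil, List.prod_nil, Matrix.one_mul]; exact hw
  | cons k L ih =>
    have hk := (simpleRoot k).2.1.ne
    have he : ∀ {w : V lam} {K : Matrix (Fin (2 * n)) κ ℂ}, Θ w = wedgeVec J K →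
        Θ (expAct (eVec (simpleRoot k)) w) =
          wedgeVec J ((1 + rootMat n (simpleRoot k).1.1 (simpleRoot k).1.2) * K) :=
      fun h => map_expAct hΘ hx (rootVec n _ _) (rootMat_sq hk) h
    have hf : ∀ {w : V lam} {K : Matrix (Fin (2 * n)) κ ℂ}, Θ w = wedgeVec J K →
        Θ (expAct (-fVec (simpleRoot k)) w) =
          wedgeVec J ((1 - rootMat n (simpleRoot k).1.2 (simpleRoot k).1.1) * K) := by
      intro w K h
      have := map_expAct hΘ hx (-rootVec n (simpleRoot k).1.2 (simpleRoot k).1.1)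
        (by
          change -rootMat n _ _ * -rootMat n _ _ = 0
          rw [neg_mul_neg, rootMat_sq hk.symm]) h
      rw [map_neg] at this
      rw [sub_eq_add_neg]
      exact this
    have := he (hf (he ih))
    rw [List.map_cons, List.prod_cons, reflMat]
    simp only [Matrix.mul_assoc] at this ⊢
    exact this

end Exp

/-- The action of a simple reflection on the indices of the basis vectors. -/
def reflIdx (n k x : ℕ) : ℕ :=
  if x = k then k + 1 else if x = k + 1 then k else
    if x = 2 * n - 1 - k then 2 * n - 2 - k else if x = 2 * n - 2 - k then 2 * n - 1 - k else x

theorem rootMat_mulVec {n : ℕ} (i j x : Fin (2 * n)) : rootMat n i j *ᵥ Pi.single x 1 =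
    if x = j then Pi.single i 1 else
      if x = i.rev then Pi.single j.rev (-(sgn n i * sgn n j)) else 0 := by
  rw [rootMat_eq, Matrix.mulVec_single_one]
  ext y
  simp only [Matrix.col_apply, Matrix.add_apply, Matrix.single_apply]
  by_cases h1 : x = j
  · subst h1
    by_cases h2 : x = i.rev
    · simp [h2, Pi.single_apply, eq_comm]
    · simp [Ne.symm h2, Pi.single_apply, eq_comm]
  · by_cases h2 : x = i.rev
    · subst h2
      simp [h1, Ne.symm h1, Pi.single_apply, eq_comm]
    · simp [h1, Ne.symm h1, h2, Ne.symm h2]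

/-- The representatives of the simple reflections permute the basis vectors up to signs. -/
theorem reflMat_mulVec {n : ℕ} (k : Fin n) (x : Fin (2 * n)) : ∃ y : Fin (2 * n), ∃ ε : ℤ,
    (y : ℕ) = reflIdx n k x ∧ ε ^ 2 = 1 ∧
      reflMat k *ᵥ Pi.single x 1 = (ε : ℂ) • Pi.single y 1 := by
  obtain ⟨c, hc⟩ := exists_sgn n (simpleRoot k).1.1 (simpleRoot k).1.2
  have hcc : c ^ 2 = 1 := by
    have h1 := sgn_mul_self n (simpleRoot k).1.1
    have h2 := sgn_mul_self n (simpleRoot k).1.2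
    have : (c : ℂ) ^ 2 = 1 := by
      rw [← hc]; linear_combination (sgn n (simpleRoot k).1.2 * sgn n (simpleRoot k).1.2) * h1 + h2
    exact_mod_cast this
  have hcc' : (c : ℂ) * c = 1 := by rw [← pow_two]; exact_mod_cast hcc
  have hk := k.2
  have hx := x.2
  simp only [reflMat, ← Matrix.mulVec_mulVec]
  rw [mul_comm] at hc
  have hc' := hc
  rw [mul_comm] at hc'
  set a := (simpleRoot k).1.1
  set b := (simpleRoot k).1.2
  have ha' : (a : ℕ) = k := rfl
  have hb' : (b : ℕ) = k + 1 := rfl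
  have hab : a ≠ b := by rw [ne_eq, Fin.ext_iff]; omega
  have haa : a ≠ a.rev := by rw [ne_eq, Fin.ext_iff, Fin.val_rev]; omega
  have hbb : b ≠ b.rev := by rw [ne_eq, Fin.ext_iff, Fin.val_rev]; omega
  have hrr : a.rev ≠ b.rev := fun h => hab (by simpa using h)
  have hs : ∀ (z : Fin (2 * n)) (d : ℂ), (Pi.single z d : Fin (2 * n) → ℂ) =
      d • Pi.single z 1 := by
    intro z d
    rw [← Pi.single_smul, smul_eq_mul, mul_one]
  have he : ∀ z : Fin (2 * n), rootMat n a b *ᵥ Pi.single z 1 =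
      if z = b then Pi.single a 1 else
        if z = a.rev then (-c : ℂ) • Pi.single b.rev 1 else 0 := by
    intro z
    rw [rootMat_mulVec, hc', hs b.rev]
  have hf : ∀ z : Fin (2 * n), rootMat n b a *ᵥ Pi.single z 1 =
      if z = a then Pi.single b 1 else
        if z = b.rev then (-c : ℂ) • Pi.single a.rev 1 else 0 := by
    intro z
    rw [rootMat_mulVec, hc, hs a.rev]
  have ra : (a.rev : ℕ) = 2 * n - 1 - k := by rw [Fin.val_rev]; omega
  have rb : (b.rev : ℕ) = 2 * n - 2 - k := by rw [Fin.val_rev]; omega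
  have ea : rootMat n a b *ᵥ Pi.single a 1 = 0 := by rw [he, if_neg hab, if_neg haa]
  have eb : rootMat n a b *ᵥ Pi.single b 1 = Pi.single a 1 := by rw [he, if_pos rfl]
  have fa : rootMat n b a *ᵥ Pi.single a 1 = Pi.single b 1 := by rw [hf, if_pos rfl]
  have fb : rootMat n b a *ᵥ Pi.single b 1 = 0 := by rw [hf, if_neg hab.symm, if_neg hbb]
  by_cases h1 : x = a
  · refine ⟨b, -1, ?_, by simp, ?_⟩
    · rw [reflIdx, if_pos (by rw [h1]; exact ha'), hb']
    · simp only [h1, Matrix.add_mulVec, Matrix.sub_mulVec, Matrix.one_mulVec, Matrix.mulVec_sub,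
        ea, eb, fa, add_zero, Int.cast_neg, Int.cast_one]
      module
  have n1 : (x : ℕ) ≠ k := fun h => h1 (Fin.ext h)
  by_cases h2 : x = b
  · refine ⟨a, 1, ?_, by simp, ?_⟩
    · rw [reflIdx, if_neg n1, if_pos (by rw [h2]; exact hb'), ha']
    · simp only [h2, Matrix.add_mulVec, Matrix.sub_mulVec, Matrix.one_mulVec, Matrix.mulVec_sub,
        Matrix.mulVec_add, Matrix.mulVec_zero, ea, eb, fa, fb, Int.cast_one]
      module
  have n2 : (x : ℕ) ≠ k + 1 := fun h => h2 (Fin.ext h)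
  by_cases h3 : x = a.rev
  · have hnb : b.rev ≠ a := fun h => h2 (by rw [h3, ← h, Fin.rev_rev])
    have hna : a.rev ≠ b := fun h => h2 (h3.trans h)
    have ea' : rootMat n a b *ᵥ Pi.single a.rev 1 = (-c : ℂ) • Pi.single b.rev 1 := by
      rw [he, if_neg hna, if_pos rfl]
    have eb' : rootMat n a b *ᵥ Pi.single b.rev 1 = 0 := by
      rw [he, if_neg hbb.symm, if_neg hrr.symm]
    have fa' : rootMat n b a *ᵥ Pi.single a.rev 1 = 0 := by
      rw [hf, if_neg haa.symm, if_neg hrr]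
    have fb' : rootMat n b a *ᵥ Pi.single b.rev 1 = (-c : ℂ) • Pi.single a.rev 1 := by
      rw [hf, if_neg hnb, if_pos rfl]
    refine ⟨b.rev, -c, ?_, by simpa using hcc, ?_⟩
    · rw [reflIdx, if_neg n1, if_neg n2, if_pos (by rw [h3]; exact ra), rb]
    · simp only [h3, Matrix.add_mulVec, Matrix.sub_mulVec, Matrix.one_mulVec, Matrix.mulVec_sub,
        Matrix.mulVec_add, Matrix.mulVec_zero, Matrix.mulVec_smul, ea', eb', fa', fb', Int.cast_neg]
      linear_combination (norm := module) (-hcc') • (Pi.single a.rev (1 : ℂ) : Fin (2 * n) → ℂ) +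
        ((c : ℂ) * hcc') • (Pi.single b.rev (1 : ℂ) : Fin (2 * n) → ℂ)
  have n3 : (x : ℕ) ≠ 2 * n - 1 - k := fun h => h3 (Fin.ext (h.trans ra.symm))
  by_cases h4 : x = b.rev
  · have hna : a.rev ≠ b := fun h => h1 (by rw [h4, ← h, Fin.rev_rev])
    have hnb : b.rev ≠ a := fun h => h1 (h4.trans h)
    have ea' : rootMat n a b *ᵥ Pi.single a.rev 1 = (-c : ℂ) • Pi.single b.rev 1 := by
      rw [he, if_neg hna, if_pos rfl]
    have eb' : rootMat n a b *ᵥ Pi.single b.rev 1 = 0 := by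
      rw [he, if_neg hbb.symm, if_neg hrr.symm]
    have fb' : rootMat n b a *ᵥ Pi.single b.rev 1 = (-c : ℂ) • Pi.single a.rev 1 := by
      rw [hf, if_neg hnb, if_pos rfl]
    refine ⟨a.rev, c, ?_, hcc, ?_⟩
    · rw [reflIdx, if_neg n1, if_neg n2, if_neg n3, if_pos (by rw [h4]; exact rb), ra]
    · simp only [h4, Matrix.add_mulVec, Matrix.sub_mulVec, Matrix.one_mulVec, Matrix.mulVec_sub,
        Matrix.mulVec_smul, ea', eb', fb', add_zero]
      linear_combination (norm := module) (-hcc') • (Pi.single b.rev (1 : ℂ) : Fin (2 * n) → ℂ)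
  · refine ⟨x, 1, ?_, by simp, ?_⟩
    · have n4 : (x : ℕ) ≠ 2 * n - 2 - k := fun h => h4 (Fin.ext (h.trans rb.symm))
      rw [reflIdx, if_neg n1, if_neg n2, if_neg n3, if_neg n4]
    simp only [Matrix.add_mulVec, Matrix.sub_mulVec, Matrix.one_mulVec, he, hf, if_neg h1, if_neg h2,
      if_neg h3, if_neg h4, add_zero, sub_zero, Int.cast_one, one_smul]

theorem reflMat_prod_mulVec {n : ℕ} (L : List (Fin n)) (x : Fin (2 * n)) :
    ∃ y : Fin (2 * n), ∃ ε : ℤ, (y : ℕ) = (L.map Fin.val).foldr (reflIdx n) x ∧ ε ^ 2 = 1 ∧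
      (L.map reflMat).prod *ᵥ Pi.single x 1 = (ε : ℂ) • Pi.single y 1 := by
  induction L with
  | nil => exact ⟨x, 1, rfl, by simp, by
      rw [List.map_nil, List.prod_nil, Matrix.one_mulVec, Int.cast_one, one_smul]⟩
  | cons k L ih =>
    obtain ⟨y, ε, hy, hε, h⟩ := ih
    obtain ⟨z, δ, hz, hδ, h'⟩ := reflMat_mulVec k y
    refine ⟨z, δ * ε, ?_, by rw [mul_pow, hε, hδ, mul_one], ?_⟩
    · rw [List.map_cons, List.foldr_cons, ← hy, hz]
    · rw [List.map_cons, List.prod_cons, ← Matrix.mulVec_mulVec, h, Matrix.mulVec_smul, h', smul_smul]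
      push_cast
      rw [mul_comm (ε : ℂ)]

/-! ### The word `τ` -/

theorem map_val_tauWord (m : ℕ) : (tauWord m).map Fin.val =
    ((List.range m).reverse.flatMap fun k => (List.range (k + 1)).map fun j => 2 * m - 1 - j) ++
    ((List.range m).reverse.flatMap fun k => (List.range k).map fun j => k + j) := by
  simp only [tauWord, List.map_append, List.map_flatMap, List.map_map]
  congr 1
  · rw [← List.map_coe_finRange_eq_range, ← List.map_reverse, List.flatMap_map]
    refine List.flatMap_congr fun k _ => ?_
    rw [← List.map_coe_finRange_eq_range, List.map_map]
    rfl
  · rw [← List.map_coe_finRange_eq_range, ← List.map_reverse, List.flatMap_map]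
    refine List.flatMap_congr fun k _ => ?_
    rw [← List.map_coe_finRange_eq_range, List.map_map]
    rfl

/-- The last letter acts first, so the transpositions carry k + q down to k and push the indices in
between up by one. Since q ≤ k < m, the mirrored transpositions only touch indices from 2m on. -/
theorem foldr_ascending_block {m k : ℕ} (hk : k < m) {q : ℕ} (hq : q ≤ k) {x : ℕ}
    (hx : x < 2 * m) : ((List.range q).map fun j => k + j).foldr (reflIdx (2 * m)) x =
      if x = k + q then k else if k ≤ x ∧ x < k + q then x + 1 else x := by
  induction q generalizing x with
  | zero => simp only [List.range_zero, List.map_nil, List.foldr_nil]; split_ifs <;> omega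
  | succ q ih =>
    rw [List.range_succ, List.map_append, List.foldr_append]
    simp only [List.map_cons, List.map_nil, List.foldr_cons, List.foldr_nil]
    have h1 : reflIdx (2 * m) (k + q) x =
        if x = k + q then k + q + 1 else if x = k + q + 1 then k + q else x := by
      unfold reflIdx; split_ifs <;> omega
    generalize reflIdx (2 * m) (k + q) x = y at h1 ⊢
    rw [ih (by omega) (by split_ifs at h1 <;> omega)]
    split_ifs at h1 <;> split_ifs <;> omega

/-- The block numbered k pulls the even index 2k down to place k. After q blocks the indices below
2q - 1 are unshuffled, the even ones before the odd ones. -/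
theorem foldr_ascending {m q : ℕ} (hq : q ≤ m) {x : ℕ} (hx : x < 2 * m) :
    ((List.range q).reverse.flatMap fun k => (List.range k).map fun j => k + j).foldr
      (reflIdx (2 * m)) x =
    if 2 * q ≤ x + 1 then x else if x % 2 = 0 then x / 2 else q + x / 2 := by
  induction q with
  | zero => simp
  | succ q ih =>
    rw [List.range_succ, List.reverse_append, List.reverse_singleton, List.singleton_append,
      List.flatMap_cons, List.foldr_append, ih (by omega)]
    generalize hy : (if 2 * q ≤ x + 1 then x else if x % 2 = 0 then x / 2 else q + x / 2) = y
    rw [foldr_ascending_block (by omega) le_rfl (by split_ifs at hy <;> omega)]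
    split_ifs at hy <;> split_ifs <;> omega

/-- The excluded index 2m + q - 1 would descend through all the mirrored transpositions and cross to
2m - 1. It never occurs when the blocks act in order of increasing length. -/
theorem foldr_descending_block {m q : ℕ} (hq : q ≤ m) {x : ℕ} (hx : x + 1 ≠ 2 * m + q) :
    ((List.range q).map fun j => 2 * m - 1 - j).foldr (reflIdx (2 * m)) x =
      if q = 0 then x else if x + q = 2 * m then 2 * m else
        if 2 * m < x + q ∧ x < 2 * m then x - 1 else
          if 2 * m ≤ x ∧ x + 1 < 2 * m + q then x + 1 else x := by
  induction q generalizing x with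
  | zero => simp
  | succ q ih =>
    rw [List.range_succ, List.map_append, List.foldr_append]
    simp only [List.map_cons, List.map_nil, List.foldr_cons, List.foldr_nil]
    have h1 : reflIdx (2 * m) (2 * m - 1 - q) x =
        if x = 2 * m - 1 - q then 2 * m - q else if x = 2 * m - q then 2 * m - 1 - q else
          if x = 2 * m + q then 2 * m + q - 1 else if x = 2 * m + q - 1 then 2 * m + q else x := by
      unfold reflIdx; split_ifs <;> omega
    generalize reflIdx (2 * m) (2 * m - 1 - q) x = y at h1 ⊢
    rw [ih (by omega) (by split_ifs at h1 <;> omega)]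
    rcases Nat.eq_zero_or_pos q with rfl | hq0
    · rw [if_pos rfl, if_neg (Nat.succ_ne_zero 0)]
      split_ifs at h1 <;> split_ifs <;> omega
    · rw [if_neg hq0.ne', if_neg (Nat.succ_ne_zero q)]
      split_ifs at h1 <;> split_ifs <;> omega

/-- Each longer block lifts the indices already moved by one and brings one more index across the
middle to 2m. -/
theorem foldr_descending {m q : ℕ} (hq : q ≤ m) {x : ℕ} (hx : x < 2 * m) :
    ((List.range q).reverse.flatMap fun k => (List.range (k + 1)).map fun j => 2 * m - 1 - j).foldr
      (reflIdx (2 * m)) x = if x + q < 2 * m then x else x + q := by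
  induction q with
  | zero => simp
  | succ q ih =>
    rw [List.range_succ, List.reverse_append, List.reverse_singleton, List.singleton_append,
      List.flatMap_cons, List.foldr_append, ih (by omega)]
    generalize hy : (if x + q < 2 * m then x else x + q) = y
    rw [foldr_descending_block (by omega) (by split_ifs at hy <;> omega), if_neg (Nat.succ_ne_zero q)]
    split_ifs at hy <;> split_ifs <;> omega

theorem foldr_tauWord {m x : ℕ} (hx : x < 2 * m) :
    ((tauWord m).map Fin.val).foldr (reflIdx (2 * m)) x =
      if x % 2 = 0 then x / 2 else 2 * m + x / 2 := by
  rw [map_val_tauWord, List.foldr_append, foldr_ascending le_rfl hx,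
    foldr_descending le_rfl (by split_ifs <;> omega)]
  split_ifs <;> omega

/-! ### The extremal vector of weight `τ(λ)` -/

/-- The indices of the columns of the highest weight vector. -/
def hwCol (m r : ℕ) (hr : r ≤ m) : Fin r ⊕ Fin r → Fin (2 * (2 * m)) :=
  Sum.elim (fun j => ⟨2 * j, by omega⟩) (fun j => ⟨2 * j + 1, by omega⟩)

/-- The indices of the columns of the extremal vector. -/
def tauCol (m r : ℕ) (hr : r ≤ m) : Fin r ⊕ Fin r → Fin (2 * (2 * m)) :=
  Sum.elim (fun j => ⟨j, by omega⟩) (fun j => ⟨2 * m + j, by omega⟩)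

/-- The word sends the initial segment of length 2r to {0, …, r-1} ∪ {2m, …, 2m+r-1}: even indices
give the first set and odd ones the second. The columns of the highest weight vector are therefore
listed by parity. -/
theorem exists_realization_tau (m : ℕ) (i : Fin m) (ℓ : ℕ) :
    ∃ Θ : V (Psi ((ℓ : ℤ) • fundWeight i)) →+
        ((Fin ℓ × (Fin (i + 1) ⊕ Fin (i + 1)) → Fin (2 * (2 * m))) → ℂ),
      Function.Injective Θ ∧
      (∀ (x : U (2 * m)) (w : V (Psi ((ℓ : ℤ) • fundWeight i))),
        Θ (x • w) = tensHom (Fin ℓ × (Fin (i + 1) ⊕ Fin (i + 1))) (2 * m) x (Θ w)) ∧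
      Θ (extremalVec (Psi ((ℓ : ℤ) • fundWeight i)) (tauWord m)) =
        wedgeVec (Fin ℓ) (colMat ℂ (tauCol m (i + 1) i.2)) := by
  have hPsi : Psi ((ℓ : ℤ) • fundWeight i) =
      (ℓ : ℤ) • fundWeight (⟨2 * (i : ℕ) + 1, by omega⟩ : Fin (2 * m)) := by
    rw [Psi, Finset.sum_eq_single i]
    · simp [fundWeight]
    · intro j _ hj
      simp [fundWeight, hj]
    · simp
  rw [hPsi]
  have hg : Function.Injective (hwCol m (i + 1) i.2) := by
    rintro (a | a) (b | b) h <;> simp [hwCol, Fin.ext_iff] at h ⊢ <;> omega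
  have hr : ∀ x, x ∈ Set.range (hwCol m (i + 1) i.2) ↔
      (x : ℕ) < (⟨2 * (i : ℕ) + 1, by omega⟩ : Fin (2 * m)).1 + 1 := by
    intro x
    constructor
    · rintro ⟨a | a, rfl⟩ <;> simp [hwCol] <;> omega
    · intro h
      simp only at h
      rcases Nat.mod_two_eq_zero_or_one x with h' | h'
      · exact ⟨Sum.inl ⟨x / 2, by omega⟩, by simp [hwCol, Fin.ext_iff]; omega⟩
      · exact ⟨Sum.inr ⟨x / 2, by omega⟩, by simp [hwCol, Fin.ext_iff]; omega⟩
  obtain ⟨Θ, h1, h2, h3⟩ := exists_realization (⟨2 * (i : ℕ) + 1, by omega⟩ : Fin (2 * m)) ℓ hg hr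
  have h4 := map_extremalVec h1 h2 h3 (tauWord m)
  have hcol : ∀ c, ∃ ε : ℤ, ε ^ 2 = 1 ∧ ((tauWord m).map reflMat).prod *ᵥ
      Pi.single (hwCol m (i + 1) i.2 c) 1 =
        (ε : ℂ) • Pi.single (tauCol m (i + 1) i.2 c) 1 := by
    intro c
    obtain ⟨y, ε, hy, hε, h⟩ := reflMat_prod_mulVec (tauWord m) (hwCol m (i + 1) i.2 c)
    have : y = tauCol m (i + 1) i.2 c := by
      rw [Fin.ext_iff, hy]
      rcases c with c | c
      · rw [foldr_tauWord (by simp [hwCol]; omega)]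
        simp [hwCol, tauCol]
      · rw [foldr_tauWord (by simp [hwCol]; omega)]
        simp [hwCol, tauCol, Nat.add_mod]
        omega
    exact ⟨ε, hε, by rw [h, this]⟩
  choose ε hε hcol using hcol
  have hmul : ((tauWord m).map reflMat).prod * colMat ℂ (hwCol m (i + 1) i.2) =
      colMat ℂ (tauCol m (i + 1) i.2) * Matrix.diagonal fun c => (ε c : ℂ) := by
    ext x c
    have := congrFun (hcol c) x
    rw [Matrix.mulVec_single_one, Matrix.col_apply] at this
    rw [mul_colMat, this, Matrix.mul_diagonal]
    simp [colMat, Pi.single_apply, mul_comm]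
  -- The signs of the permuted columns multiply to d = ±1, which is moved into the embedding.
  set d : ℤ := (∏ c, ε c) ^ ℓ with hd
  have hdd : (d : ℂ) * d = 1 := by
    have : d * d = 1 := by
      rw [hd, ← mul_pow, ← Finset.prod_mul_distrib]
      simp [← pow_two, hε]
    exact_mod_cast this
  have h5 : Θ (extremalVec _ (tauWord m)) =
      (d : ℂ) • wedgeVec (Fin ℓ) (colMat ℂ (tauCol m (i + 1) i.2)) := by
    rw [h4, hmul]
    ext t
    rw [wedgeVec_mul, Matrix.det_diagonal, Fintype.card_fin, Pi.smul_apply, smul_eq_mul, hd]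
    push_cast
    rfl
  refine ⟨d • Θ, ?_, ?_, ?_⟩
  · intro a b hab
    apply h1
    have : d • d • Θ a = d • d • Θ b := congrArg (fun z => d • z) hab
    have hd1 : d * d = 1 := by exact_mod_cast hdd
    rwa [smul_smul, smul_smul, hd1, one_smul, one_smul] at this
  · intro x w
    rw [AddMonoidHom.smul_apply, AddMonoidHom.smul_apply, h2, map_zsmul]
  · rw [AddMonoidHom.smul_apply, h5, ← Int.cast_smul_eq_zsmul ℂ, smul_smul, hdd, one_smul]

end

section

/-! ### Intervals and their nesting -/

/-- The intervals `[lo, hi]` with `r ≤ lo ≤ hi < 2m` and `2m - r ≤ hi`; the interval `[b, c]` stands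
for the positive root `α_{2m-1-c, b}`. -/
@[ext]
structure Edge (m r : ℕ) where
  /-- The left end. -/
  lo : Fin (2 * m)
  /-- The right end. -/
  hi : Fin (2 * m)
  le_lo : r ≤ (lo : ℕ)
  lo_le_hi : lo ≤ hi
  le_hi : 2 * m ≤ (hi : ℕ) + r

namespace Edge

variable {m r : ℕ}

theorem ends_injective :
    Function.Injective fun e : Edge m r => (OrderDual.toDual e.lo, e.hi) := fun e e' h => by
  simp only [Prod.mk.injEq, EmbeddingLike.apply_eq_iff_eq] at h
  exact Edge.ext h.1 h.2

instance : DecidableEq (Edge m r) := Classical.decEq _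

instance : Fintype (Edge m r) :=
  Fintype.ofInjective (fun e : Edge m r => (e.lo, e.hi)) fun e e' h => by
    simp only [Prod.mk.injEq] at h
    exact Edge.ext h.1 h.2

/-- Intervals are ordered by inclusion. -/
instance : PartialOrder (Edge m r) := PartialOrder.lift _ ends_injective

theorem le_iff {e e' : Edge m r} : e ≤ e' ↔ e'.lo ≤ e.lo ∧ e.hi ≤ e'.hi := Iff.rfl

/-- The interval with the given ends, in either order. -/
def ofPair (hr : r ≤ m) (b c : Fin (2 * m)) (hb : r ≤ (b : ℕ)) (hc : 2 * m ≤ (c : ℕ) + r) :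
    Edge m r where
  lo := min b c
  hi := max b c
  le_lo := by rcases min_choice b c with h | h <;> rw [h] <;> omega
  lo_le_hi := min_le_max
  le_hi := by
    have : c ≤ max b c := le_max_right b c
    rw [Fin.le_def] at this
    omega

/-- The end points of a family of intervals, with multiplicities. -/
def ends (m r : ℕ) : (Edge m r →₀ ℕ) →ₗ[ℕ] (Fin (2 * m) →₀ ℕ) :=
  Finsupp.linearCombination ℕ fun e : Edge m r => Finsupp.single e.lo 1 + Finsupp.single e.hi 1

/-- The sum of the products of the end points of a family of intervals. -/
def wt (m r : ℕ) : (Edge m r →₀ ℕ) →ₗ[ℕ] ℕ :=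
  Finsupp.linearCombination ℕ fun e : Edge m r => (e.lo : ℕ) * e.hi

theorem ends_single (e : Edge m r) :
    ends m r (Finsupp.single e 1) = Finsupp.single e.lo 1 + Finsupp.single e.hi 1 := by
  simp [ends]

theorem wt_single (e : Edge m r) : wt m r (Finsupp.single e 1) = (e.lo : ℕ) * e.hi := by
  simp [wt]

theorem ends_ofPair (hr : r ≤ m) (b c : Fin (2 * m)) (hb : r ≤ (b : ℕ))
    (hc : 2 * m ≤ (c : ℕ) + r) : ends m r (Finsupp.single (ofPair hr b c hb hc) 1) =
      Finsupp.single b 1 + Finsupp.single c 1 := by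
  rw [ends_single]
  rcases le_total b c with h | h
  · simp [ofPair, h]
  · simp [ofPair, h, add_comm]

theorem wt_ofPair (hr : r ≤ m) (b c : Fin (2 * m)) (hb : r ≤ (b : ℕ))
    (hc : 2 * m ≤ (c : ℕ) + r) :
    wt m r (Finsupp.single (ofPair hr b c hb hc) 1) = (b : ℕ) * c := by
  rw [wt_single]
  rcases le_total b c with h | h
  · simp [ofPair, h]
  · simp [ofPair, h, mul_comm]

theorem ends_apply (u : Edge m r →₀ ℕ) (v : Fin (2 * m)) :
    ends m r u v = u.sum fun e k => k * ((if e.lo = v then 1 else 0) + if e.hi = v then 1 else 0) := by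
  simp [ends, Finsupp.linearCombination_apply, Finsupp.sum, Finsupp.single_apply, mul_add]

theorem ends_apply_ne_zero {u : Edge m r →₀ ℕ} {v : Fin (2 * m)} :
    ends m r u v ≠ 0 ↔ ∃ e ∈ u.support, e.lo = v ∨ e.hi = v := by
  rw [ends_apply, Finsupp.sum, ne_eq, Finset.sum_eq_zero_iff]
  push Not
  constructor
  · rintro ⟨e, he, h⟩
    refine ⟨e, he, ?_⟩
    by_contra! h'
    simp [h'.1, h'.2] at h
  · rintro ⟨e, he, h⟩
    refine ⟨e, he, ?_⟩
    rw [Finsupp.mem_support_iff] at he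
    rcases h with h | h <;> simp [he, h]

theorem exists_eq_add_single {σ : Type*} [DecidableEq σ] {u : σ →₀ ℕ} {e : σ} (h : e ∈ u.support) :
    ∃ v, u = v + Finsupp.single e 1 := by
  refine ⟨u - Finsupp.single e 1, (tsub_add_cancel_of_le ?_).symm⟩
  rw [Finsupp.single_le_iff]
  exact Nat.one_le_iff_ne_zero.mpr (Finsupp.mem_support_iff.mp h)

/-- A chain of nested intervals has the smallest weight among the families of intervals with the
same end points. -/
theorem eq_or_wt_lt_of_isChain (hr : r ≤ m) {u u' : Edge m r →₀ ℕ}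
    (hu : IsChain (· ≤ ·) (u.support : Set (Edge m r))) (h : ends m r u = ends m r u') :
    u' = u ∨ wt m r u < wt m r u' := by
  obtain ⟨n, hn⟩ : ∃ n, u.degree = n := ⟨_, rfl⟩
  induction n generalizing u u' with
  | zero =>
    obtain rfl : u = 0 := (Finsupp.degree_eq_zero_iff u).mp hn
    left
    by_contra hne
    obtain ⟨e, he⟩ := Finsupp.support_nonempty_iff.mpr hne
    exact ends_apply_ne_zero.mpr ⟨e, he, Or.inl rfl⟩ (by rw [← h]; simp)
  | succ n ih =>
    have hne : u.support.Nonempty := by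
      rw [Finsupp.support_nonempty_iff]
      rintro rfl
      simp at hn
    obtain ⟨q, hq, hmax⟩ := u.support.exists_maximal hne
    have htop : ∀ e ∈ u.support, e ≤ q := fun e he => by
      rcases hu.total he hq with h' | h'
      · exact h'
      · exact hmax he h'
    -- The largest member q of the chain contains all end points of u, and u' has the same end
    -- points.
    have hbound : ∀ e ∈ u'.support, q.lo ≤ e.lo ∧ e.hi ≤ q.hi := by
      have key : ∀ v, ends m r u' v ≠ 0 → q.lo ≤ v ∧ v ≤ q.hi := by
        intro v hv
        rw [← h, ends_apply_ne_zero] at hv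
        obtain ⟨e, he, hv⟩ := hv
        obtain ⟨h1, h2⟩ := le_iff.mp (htop e he)
        have h3 := e.lo_le_hi
        rcases hv with rfl | rfl
        · exact ⟨h1, h3.trans h2⟩
        · exact ⟨h1.trans h3, h2⟩
      exact fun e he => ⟨(key _ (ends_apply_ne_zero.mpr ⟨e, he, Or.inl rfl⟩)).1,
        (key _ (ends_apply_ne_zero.mpr ⟨e, he, Or.inr rfl⟩)).2⟩
    obtain ⟨v, rfl⟩ := exists_eq_add_single hq
    have hv : IsChain (· ≤ ·) (v.support : Set (Edge m r)) := by
      refine hu.mono fun e he => ?_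
      simp only [Finset.mem_coe, Finsupp.mem_support_iff, Finsupp.add_apply] at he ⊢
      omega
    have hvn : v.degree = n := by
      rw [map_add, Finsupp.degree_single] at hn
      omega
    have hcase : ∀ {p}, p ∈ u'.support → p = q →
        u' = v + Finsupp.single q 1 ∨ wt m r (v + Finsupp.single q 1) < wt m r u' := by
      rintro p hp rfl
      obtain ⟨w, rfl⟩ := exists_eq_add_single hp
      rw [map_add, map_add, add_left_inj] at h
      rcases ih hv h hvn with h' | h'
      · exact Or.inl (by rw [h'])
      · refine Or.inr ?_
        rw [map_add, map_add]
        omega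
    have hlo : ends m r u' q.lo ≠ 0 := by
      rw [← h, ends_apply_ne_zero]
      exact ⟨q, hq, Or.inl rfl⟩
    have hhi : ends m r u' q.hi ≠ 0 := by
      rw [← h, ends_apply_ne_zero]
      exact ⟨q, hq, Or.inr rfl⟩
    obtain ⟨p, hp, hp'⟩ := ends_apply_ne_zero.mp hlo
    obtain ⟨p', hp2, hp2'⟩ := ends_apply_ne_zero.mp hhi
    have e1 : p.lo = q.lo := by
      rcases hp' with h' | h'
      · exact h'
      · exact le_antisymm (p.lo_le_hi.trans_eq h') (hbound p hp).1
    have e2 : p'.hi = q.hi := by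
      rcases hp2' with h' | h'
      · exact le_antisymm (hbound p' hp2).2 (h'.symm.le.trans p'.lo_le_hi)
      · exact h'
    by_cases hpq : p.hi = q.hi
    · exact hcase hp (Edge.ext e1 hpq)
    by_cases hpq' : p'.lo = q.lo
    · exact hcase hp2 (Edge.ext hpq' e2)
    have hne' : p ≠ p' := fun h' => hpq (by rw [h', e2])
    obtain ⟨w, rfl⟩ := exists_eq_add_single hp
    have hp3 : p' ∈ w.support := by
      rw [Finsupp.mem_support_iff, Finsupp.add_apply, Finsupp.single_eq_of_ne hne'.symm] at hp2
      rwa [Finsupp.mem_support_iff]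
    obtain ⟨w, rfl⟩ := exists_eq_add_single hp3
    -- If the extreme end points belong to two different members of u', an exchange replaces these
    -- by q and the interval on the two inner end points. Removing q on both sides allows induction.
    have hh : ends m r v = ends m r (w + Finsupp.single
        (ofPair hr p'.lo p.hi p'.le_lo p.le_hi) 1) := by
      rw [map_add, ends_ofPair]
      simp only [map_add, ends_single, e1, e2] at h
      apply add_right_cancel (b := Finsupp.single q.lo 1 + Finsupp.single q.hi 1)
      rw [h]
      abel
    have hle : wt m r v ≤ wt m r (w + Finsupp.single
        (ofPair hr p'.lo p.hi p'.le_lo p.le_hi) 1) := by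
      rcases ih hv hh hvn with h' | h'
      · rw [h']
      · exact h'.le
    right
    rw [map_add, wt_ofPair] at hle
    simp only [map_add, wt_single, e1, e2]
    have l1 : q.lo < p'.lo := lt_of_le_of_ne (hbound p' hp2).1 (Ne.symm hpq')
    have l2 : p.hi < q.hi := lt_of_le_of_ne (hbound p hp).2 hpq
    rw [Fin.lt_def] at l1 l2
    obtain ⟨x, hx⟩ := Nat.exists_eq_add_of_lt l1
    obtain ⟨y, hy⟩ := Nat.exists_eq_add_of_lt l2
    rw [hx] at hle ⊢
    rw [hy]
    -- The exchange lowers the weight by (p'.lo - q.lo)(q.hi - p.hi), which is positive.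
    nlinarith [hle]

/-- The families of intervals that meet every chain of nested intervals in at most `ℓ` members. -/
def IsAdmissible (ℓ : ℕ) (s : Edge m r →₀ ℕ) : Prop :=
  ∀ C : Finset (Edge m r), IsChain (· ≤ ·) (C : Set (Edge m r)) → ∑ q ∈ C, s q ≤ ℓ

/-- Mirsky's theorem with multiplicities: peel off the minimal members of the support, once each. A
chain that meets them loses at least one. A chain that misses them either carries no weight or,
restricted to the support, extends downwards by a minimal member, so in every case what remains is
bounded by one less. -/
theorem exists_antichains {ℓ : ℕ} {s : Edge m r →₀ ℕ} (hs : IsAdmissible ℓ s) :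
    ∃ S : Fin ℓ → Finset (Edge m r), (∀ j, IsAntichain (· ≤ ·) (S j : Set (Edge m r))) ∧
      s = ∑ j, ∑ q ∈ S j, Finsupp.single q 1 := by
  classical
  induction ℓ generalizing s with
  | zero =>
    refine ⟨Fin.elim0, fun j => j.elim0, ?_⟩
    ext q
    have := hs {q} (by simp)
    simpa using this
  | succ ℓ ih =>
    set S : Finset (Edge m r) := s.support.filter fun q => ∀ p ∈ s.support, p ≤ q → p = q with hS
    have hanti : IsAntichain (· ≤ ·) (S : Set (Edge m r)) := by
      intro p hp q hq hne hle
      rw [Finset.mem_coe, hS, Finset.mem_filter] at hp hq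
      exact hne (hq.2 p hp.1 hle)
    have hone : ∀ q, (∑ q ∈ S, Finsupp.single q 1 : Edge m r →₀ ℕ) q = if q ∈ S then 1 else 0 := by
      intro q
      rw [Finsupp.finsetSum_apply]
      simp [Finsupp.single_apply]
    have hle : (∑ q ∈ S, Finsupp.single q 1 : Edge m r →₀ ℕ) ≤ s := by
      intro q
      rw [hone]
      split_ifs with h
      · rw [hS, Finset.mem_filter, Finsupp.mem_support_iff] at h
        omega
      · exact Nat.zero_le _
    set s' := s - ∑ q ∈ S, Finsupp.single q 1 with hs'
    have hadd : s = ∑ q ∈ S, Finsupp.single q 1 + s' := by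
      rw [hs', add_tsub_cancel_of_le hle]
    have hs1 : ∀ q, s q = (if q ∈ S then 1 else 0) + s' q := fun q => by
      rw [← hone, ← Finsupp.add_apply, ← hadd]
    have hmin : ∀ q ∈ s.support, ∃ p ∈ S, p ≤ q := by
      intro q hq
      obtain ⟨p, hpq, hp, hp'⟩ := s.support.exists_le_minimal hq
      exact ⟨p, by
        rw [hS, Finset.mem_filter]
        exact ⟨hp, fun p' h1 h2 => le_antisymm h2 (hp' h1 h2)⟩, hpq⟩
    have hs'a : IsAdmissible ℓ s' := by
      intro C hC
      have hle' : ∑ q ∈ C, s' q ≤ ∑ q ∈ C, s q :=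
        Finset.sum_le_sum fun q _ => by rw [hs1 q]; omega
      by_cases hCS : ∃ p ∈ C, p ∈ S
      · obtain ⟨p, hp, hpS⟩ := hCS
        have h1 : ∑ q ∈ C, s' q < ∑ q ∈ C, s q :=
          Finset.sum_lt_sum (fun q _ => by rw [hs1 q]; omega)
            ⟨p, hp, by rw [hs1 p, if_pos hpS]; omega⟩
        have := hs C hC
        omega
      · push Not at hCS
        set D := C.filter fun q => q ∈ s.support with hD
        have hDs : ∑ q ∈ C, s q = ∑ q ∈ D, s q := by
          rw [hD, Finset.sum_filter_of_ne]
          intro q _ hq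
          exact Finsupp.mem_support_iff.mpr hq
        rcases D.eq_empty_or_nonempty with h0 | hne
        · rw [h0, Finset.sum_empty] at hDs
          omega
        · obtain ⟨q, hq, hqmin⟩ := D.exists_minimal hne
          have hqD := hq
          rw [hD, Finset.mem_filter] at hq
          obtain ⟨p, hp, hpq⟩ := hmin q hq.2
          have hpC : p ∉ D := fun h => hCS p (Finset.mem_filter.mp h).1 hp
          have hleast : ∀ x ∈ D, p ≤ x := fun x hx => by
            rcases hC.total (Finset.mem_filter.mp hx).1 hq.1 with h | h
            · exact hpq.trans (hqmin hx h)
            · exact hpq.trans h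
          have hch : IsChain (· ≤ ·) ((insert p D : Finset (Edge m r)) : Set (Edge m r)) := by
            rw [Finset.coe_insert]
            exact (hC.mono (by rw [hD]; exact_mod_cast Finset.filter_subset _ _)).insert
              fun x hx _ => Or.inl (hleast x hx)
          have h1 := hs _ hch
          rw [Finset.sum_insert hpC, hs1 p, if_pos hp] at h1
          omega
    obtain ⟨T, hT, hT'⟩ := ih hs'a
    refine ⟨Fin.cons S T, fun j => ?_, ?_⟩
    · refine Fin.cases ?_ (fun j => ?_) j
      · exact hanti
      · exact hT j
    · rw [Fin.sum_univ_succ]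
      simp only [Fin.cons_zero, Fin.cons_succ]
      rw [← hT', ← hadd]

end Edge

end

section

open MvPolynomial

/-! ### Minors of the affine chart of linear forms -/

section Chart

variable {m r : ℕ}

theorem le_rev_castLE (hr : r ≤ m) (a : Fin r) :
    2 * m ≤ ((Fin.castLE (show r ≤ 2 * m by omega) a).rev : ℕ) + r := by
  have := a.2
  rw [Fin.val_rev, Fin.val_castLE]
  omega

/-- The interval attached to the row `b ≥ r` and the column `a < r`. -/
def Edge.ofEntry (hr : r ≤ m) (b : Fin (2 * m)) (hb : r ≤ (b : ℕ)) (a : Fin r) : Edge m r :=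
  Edge.ofPair hr b (Fin.castLE (by omega) a).rev hb (le_rev_castLE hr a)

/-- The matrix with rows `δ_b` for `b < r` and entries `x_{b, 2m-1-a}` for `b ≥ r`. -/
def chartMat {R : Type*} [CommRing R] (hr : r ≤ m) (x : Edge m r → R) :
    Matrix (Fin (2 * m)) (Fin r) R :=
  Matrix.of fun b a => if h : r ≤ (b : ℕ) then x (Edge.ofEntry hr b h a) else
    if (b : ℕ) = a then 1 else 0

theorem chartMat_of_le {R : Type*} [CommRing R] (hr : r ≤ m) (x : Edge m r → R) {b : Fin (2 * m)}
    (h : r ≤ (b : ℕ)) (a : Fin r) : chartMat hr x b a = x (Edge.ofEntry hr b h a) := by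
  rw [chartMat, Matrix.of_apply, dif_pos h]

theorem chartMat_of_lt {R : Type*} [CommRing R] (hr : r ≤ m) (x : Edge m r → R) {b : Fin (2 * m)}
    (h : (b : ℕ) < r) (a : Fin r) : chartMat hr x b a = if (b : ℕ) = a then 1 else 0 := by
  rw [chartMat, Matrix.of_apply, dif_neg (not_le.mpr h)]

/-- The number of positions of `t` in the rows from `r` on. -/
def height {P : Type*} [Fintype P] (r : ℕ) (t : P → Fin (2 * m)) : ℕ :=
  ∑ p, if r ≤ (t p : ℕ) then 1 else 0

/-- Every row from r on contributes one linear factor to each Leibniz term, the others a constant. A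
given coordinate therefore sees monomials of a single degree. -/
theorem isHomogeneous_wedgeVec_chartMat (hr : r ≤ m) {J : Type*} [Fintype J] [DecidableEq J]
    (t : J × Fin r → Fin (2 * m)) :
    (wedgeVec J (chartMat hr (X : Edge m r → MvPolynomial (Edge m r) ℂ)) t).IsHomogeneous
      (height r t) := by
  rw [wedgeVec_eq_sum]
  refine IsHomogeneous.sum _ _ _ fun g _ => ?_
  have h1 : (∏ j, ((Equiv.Perm.sign (g j) : ℤ) : MvPolynomial (Edge m r) ℂ)) =
      C (((∏ j, (Equiv.Perm.sign (g j) : ℤ)) : ℤ) : ℂ) := by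
    simp
  rw [h1, ← zero_add (height r t)]
  refine (isHomogeneous_C _ _).mul (IsHomogeneous.prod _ _ _ fun p _ => ?_)
  split_ifs with h
  · rw [chartMat_of_le hr _ h]
    exact isHomogeneous_X _ _
  · rw [chartMat_of_lt hr _ (not_le.mp h)]
    split_ifs
    · exact isHomogeneous_one _ _
    · exact isHomogeneous_zero _ _ _

/-! #### Leading terms -/

/-- The monomial `s` occurs in `f` with coefficient one, and all others have smaller weight. -/
def IsLead (s : Edge m r →₀ ℕ) (f : MvPolynomial (Edge m r) ℂ) : Prop :=
  coeff s f = 1 ∧ ∀ s', coeff s' f ≠ 0 → s' = s ∨ Edge.wt m r s' < Edge.wt m r s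

theorem isLead_one : IsLead (0 : Edge m r →₀ ℕ) 1 := by
  refine ⟨by simp, fun s' h => Or.inl ?_⟩
  by_contra hne
  exact h (by rw [coeff_one, if_neg (Ne.symm hne)])

/-- The weight is additive, so only the pair of leading monomials reaches the total weight. -/
theorem IsLead.mul {s s' : Edge m r →₀ ℕ} {f f' : MvPolynomial (Edge m r) ℂ} (h : IsLead s f)
    (h' : IsLead s' f') : IsLead (s + s') (f * f') := by
  constructor
  · rw [coeff_mul, Finset.sum_eq_single (s, s')]
    · rw [h.1, h'.1, one_mul]
    · rintro ⟨a, b⟩ hab hne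
      by_contra h0
      rw [Finset.HasAntidiagonal.mem_antidiagonal] at hab
      have hW := congrArg (Edge.wt m r) hab
      simp only [map_add] at hW
      rcases h.2 a (left_ne_zero_of_mul h0) with rfl | h1 <;>
        rcases h'.2 b (right_ne_zero_of_mul h0) with rfl | h2
      · exact hne rfl
      all_goals omega
    · intro h0
      rw [Finset.HasAntidiagonal.mem_antidiagonal] at h0
      exact absurd rfl h0
  · intro u hu
    rw [coeff_mul] at hu
    obtain ⟨⟨a, b⟩, hab, h0⟩ := Finset.exists_ne_zero_of_sum_ne_zero hu
    rw [Finset.HasAntidiagonal.mem_antidiagonal] at hab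
    simp only at hab h0
    rw [← hab, map_add, map_add]
    rcases h.2 a (left_ne_zero_of_mul h0) with rfl | h1 <;>
      rcases h'.2 b (right_ne_zero_of_mul h0) with rfl | h2
    · exact Or.inl rfl
    all_goals exact Or.inr (by omega)

theorem IsLead.prod {ι : Type*} (T : Finset ι) {s : ι → Edge m r →₀ ℕ}
    {f : ι → MvPolynomial (Edge m r) ℂ} (h : ∀ j ∈ T, IsLead (s j) (f j)) :
    IsLead (∑ j ∈ T, s j) (∏ j ∈ T, f j) := by
  classical
  induction T using Finset.induction_on with
  | empty => simpa using isLead_one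
  | insert j T hj ih =>
    rw [Finset.sum_insert hj, Finset.prod_insert hj]
    exact (h j (Finset.mem_insert_self j T)).mul (ih fun k hk => h k (Finset.mem_insert_of_mem hk))

/-- Applied to the Leibniz expansion of a minor: the identity permutation supplies the coefficient
one, and the other terms are too light for their signs or coincidences to matter. -/
theorem isLead_sum_perm {A : Type*} [Fintype A] [DecidableEq A] {s : Edge m r →₀ ℕ}
    {f : Equiv.Perm A → MvPolynomial (Edge m r) ℂ} (h1 : f 1 = monomial s 1)
    (h : ∀ g, g ≠ 1 → f g = 0 ∨ ∃ s', f g = monomial s' 1 ∧ Edge.wt m r s' < Edge.wt m r s) :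
    IsLead s (∑ g : Equiv.Perm A, ((Equiv.Perm.sign g : ℤ) : MvPolynomial (Edge m r) ℂ) * f g) := by
  have hc : ∀ (g : Equiv.Perm A) s', coeff s' (((Equiv.Perm.sign g : ℤ) :
      MvPolynomial (Edge m r) ℂ) * f g) = ((Equiv.Perm.sign g : ℤ) : ℂ) * coeff s' (f g) := by
    intro g s'
    rw [← coeff_C_mul]
    simp
  constructor
  · rw [coeff_sum, Finset.sum_eq_single 1]
    · rw [hc, h1]
      simp
    · intro g _ hg
      rw [hc]
      rcases h g hg with h0 | ⟨s', hs', hlt⟩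
      · rw [h0, coeff_zero, mul_zero]
      · rw [hs', coeff_monomial, if_neg (by rintro rfl; exact lt_irrefl _ hlt), mul_zero]
    · intro h0
      exact absurd (Finset.mem_univ _) h0
  · intro u hu
    rw [coeff_sum] at hu
    obtain ⟨g, -, h0⟩ := Finset.exists_ne_zero_of_sum_ne_zero hu
    rw [hc] at h0
    have h0 := right_ne_zero_of_mul h0
    by_cases hg : g = 1
    · rw [hg, h1, coeff_monomial] at h0
      left
      by_contra hne
      exact h0 (if_neg (Ne.symm hne))
    · rcases h g hg with h2 | ⟨s', hs', hlt⟩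
      · rw [h2, coeff_zero] at h0
        exact absurd rfl h0
      · rw [hs', coeff_monomial] at h0
        right
        by_cases hs : s' = u
        · rwa [← hs]
        · exact absurd (if_neg hs) h0

/-- The strict rearrangement inequality for two strictly decreasing functions. -/
theorem sum_mul_comp_perm_lt {A : Finset (Fin r)} {f g : Fin r → ℕ}
    (hf : StrictAntiOn f (A : Set (Fin r))) (hg : StrictAntiOn g (A : Set (Fin r)))
    {e : Equiv.Perm (Fin r)} (he : ∀ a, e a ≠ a → a ∈ A) (h1 : e ≠ 1) :
    ∑ a ∈ A, f a * g (e a) < ∑ a ∈ A, f a * g a := by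
  have hmono : MonovaryOn f g (A : Set (Fin r)) := by
    intro a ha b hb hab
    rcases lt_trichotomy a b with h | h | h
    · exact absurd (hg ha hb h) (by omega)
    · rw [h]
    · exact (hf hb ha h).le
  refine (hmono.sum_smul_comp_perm_lt_sum_smul_iff (fun a ha => he a ha)).mpr ?_
  intro hmono'
  have hne : (Finset.univ.filter fun a => e a ≠ a).Nonempty := by
    by_contra hempty
    rw [Finset.not_nonempty_iff_eq_empty] at hempty
    apply h1
    ext a : 1
    by_contra ha
    have : a ∈ (Finset.univ.filter fun a => e a ≠ a) := by simpa using ha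
    rw [hempty] at this
    simp at this
  -- For the least moved point a, both e a and its preimage exceed a; these two positions violate
  -- the monotonicity that equality would force.
  obtain ⟨a, ha, hmin⟩ := Finset.exists_minimal hne
  rw [Finset.mem_filter] at ha
  have hmin' : ∀ b, e b ≠ b → a ≤ b := fun b hb => by
    rcases le_total a b with h | h
    · exact h
    · exact hmin (by simpa using hb) h
  have hb : e (e.symm a) ≠ e.symm a := by
    rw [e.apply_symm_apply]
    intro h
    exact ha.2 (by conv_lhs => rw [h, e.apply_symm_apply])
  have hab : a < e.symm a := lt_of_le_of_ne (hmin' _ hb) (by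
    intro h
    exact ha.2 (by conv_lhs => rw [h, e.apply_symm_apply]))
  have hea : e (e a) ≠ e a := fun h => ha.2 (e.injective h)
  have hae : a < e a := lt_of_le_of_ne (hmin' _ hea) (Ne.symm ha.2)
  have hA : a ∈ A := he _ ha.2
  have := hmono' hA (he _ hb) (show g (e a) < g (e (e.symm a)) by
    rw [e.apply_symm_apply]
    exact hg hA (he _ hea) hae)
  exact absurd (hf hA (he _ hb) hab) (by omega)

/-- Every antichain of intervals is the leading term of a minor. -/
theorem exists_isLead_det (hr : r ≤ m) {S : Finset (Edge m r)}
    (hS : IsAntichain (· ≤ ·) (S : Set (Edge m r))) :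
    ∃ t : Fin r → Fin (2 * m), IsLead (∑ q ∈ S, Finsupp.single q 1)
      ((chartMat hr (X : Edge m r → MvPolynomial (Edge m r) ℂ)).submatrix t id).det := by
  classical
  -- A collects the columns whose mirrored index is the right end of a member of S; an antichain has
  -- at most one member per right end. Its left end is the row chosen for that column, and the
  -- unused columns take their own unit row.
  set A : Finset (Fin r) := Finset.univ.filter fun a => ∃ q ∈ S,
    q.hi = (Fin.castLE (show r ≤ 2 * m by omega) a).rev with hA
  have hch : ∀ a : Fin r, ∃ q : Edge m r, a ∈ A →
      q ∈ S ∧ q.hi = (Fin.castLE (show r ≤ 2 * m by omega) a).rev := by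
    intro a
    by_cases ha : a ∈ A
    · obtain ⟨q, hq⟩ := (Finset.mem_filter.mp ha).2
      exact ⟨q, fun _ => hq⟩
    · by_cases hne : Nonempty (Edge m r)
      · exact ⟨hne.some, fun h => absurd h ha⟩
      · have ha2 := a.2
        exact absurd ⟨Edge.ofPair hr (Fin.castLE (show r ≤ 2 * m by omega) a).rev
          (Fin.castLE (show r ≤ 2 * m by omega) a).rev (by rw [Fin.val_rev, Fin.val_castLE]; omega)
          (le_rev_castLE hr a)⟩ hne
  choose q hq using hch
  set t : Fin r → Fin (2 * m) := fun a =>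
    if a ∈ A then (q a).lo else Fin.castLE (show r ≤ 2 * m by omega) a with ht
  have htA : ∀ a ∈ A, t a = (q a).lo := fun a ha => by rw [ht]; exact if_pos ha
  have htA' : ∀ a, a ∉ A → t a = Fin.castLE (show r ≤ 2 * m by omega) a := fun a ha => by
    rw [ht]; exact if_neg ha
  have htr : ∀ a ∈ A, r ≤ (t a : ℕ) := fun a ha => by rw [htA a ha]; exact (q a).le_lo
  have hsum : ∑ p ∈ S, Finsupp.single p 1 = ∑ a ∈ A, (Finsupp.single (q a) 1 : Edge m r →₀ ℕ) := by
    symm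
    refine Finset.sum_bij (fun a _ => q a) (fun a ha => (hq a ha).1) ?_ ?_ (fun _ _ => rfl)
    · intro a ha b hb hab
      have h := (hq a ha).2
      rw [hab, (hq b hb).2] at h
      have := Fin.rev_injective h
      rw [Fin.ext_iff] at this ⊢
      simpa using this.symm
    · intro p hp
      have hp1 := p.le_hi
      have hp2 := p.hi.2
      have haA : (⟨2 * m - 1 - p.hi, by omega⟩ : Fin r) ∈ A := by
        rw [hA, Finset.mem_filter]
        refine ⟨Finset.mem_univ _, p, hp, ?_⟩
        rw [Fin.ext_iff, Fin.val_rev, Fin.val_castLE]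
        simp only
        omega
      refine ⟨_, haA, ?_⟩
      obtain ⟨h1, h2⟩ := hq _ haA
      have h3 : (q ⟨2 * m - 1 - p.hi, by omega⟩).hi = p.hi := by
        rw [h2, Fin.ext_iff, Fin.val_rev, Fin.val_castLE]
        simp only
        omega
      by_contra hne
      rcases le_total (q ⟨2 * m - 1 - p.hi, by omega⟩).lo p.lo with h | h
      · exact hS hp h1 (Ne.symm hne) (Edge.le_iff.mpr ⟨h, h3.ge⟩)
      · exact hS h1 hp hne (Edge.le_iff.mpr ⟨h, h3.le⟩)
  -- In an antichain a smaller right end forces a smaller left end, and the right end decreases as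
  -- the column index grows. So rows and mirrored columns are similarly ordered, and the identity
  -- permutation maximizes the weight.
  have hanti : StrictAntiOn (fun a => (t a : ℕ)) (A : Set (Fin r)) := by
    intro a ha b hb hab
    simp only [htA a ha, htA b hb]
    by_contra! h
    obtain ⟨h1, h2⟩ := hq a ha
    obtain ⟨h3, h4⟩ := hq b hb
    rw [Fin.ext_iff, Fin.val_rev, Fin.val_castLE] at h2 h4
    have hb' := b.2
    rw [Fin.lt_def] at hab
    refine hS h3 h1 ?_ (Edge.le_iff.mpr ⟨Fin.le_def.mpr h, Fin.le_def.mpr (by omega)⟩)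
    intro h5
    rw [h5] at h4
    omega
  have hprod : ∀ e : Equiv.Perm (Fin r), (∀ a, e a ∉ A → e a = a) →
      ∏ a, chartMat hr (X : Edge m r → MvPolynomial (Edge m r) ℂ) (t (e a)) a =
        monomial (∑ a ∈ A.attach, Finsupp.single
          (Edge.ofEntry hr (t a) (htr a a.2) (e.symm a)) 1) 1 := by
    intro e he
    rw [← Equiv.prod_comp e.symm]
    simp only [Equiv.apply_symm_apply]
    rw [← Finset.prod_subset (Finset.subset_univ A), ← Finset.prod_attach, monomial_sum_one]
    · refine Finset.prod_congr rfl fun a _ => ?_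
      rw [chartMat_of_le hr _ (htr a a.2)]
      rfl
    · intro a _ ha
      have h1 : e.symm a = a := by
        have := he (e.symm a) (by rwa [e.apply_symm_apply])
        rwa [e.apply_symm_apply, eq_comm] at this
      rw [htA' a ha, chartMat_of_lt hr _ (by simp), h1, if_pos (by simp)]
  refine ⟨t, ?_⟩
  rw [Matrix.det_apply']
  simp only [Matrix.submatrix_apply, id_eq]
  refine isLead_sum_perm (f := fun e => ∏ a, chartMat hr X (t (e a)) a) ?_ ?_
  · have := hprod 1 (fun a _ => rfl)
    refine this.trans (congrArg (fun u => monomial u (1 : ℂ)) ?_)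
    rw [hsum, ← Finset.sum_attach A]
    refine Finset.sum_congr rfl fun a _ => ?_
    congr 1
    obtain ⟨h1, h2⟩ := hq a a.2
    have h3 := (q a).lo_le_hi
    have h4 := htA a a.2
    rw [h2] at h3
    apply Edge.ext
    · change min (t a) _ = _
      rw [h4]
      exact min_eq_left h3
    · change max (t a) _ = _
      rw [h4, h2]
      exact max_eq_right h3
  · intro e he
    -- A permutation that moves a unit row away from its own column contributes zero; the others
    -- only permute A.
    by_cases h : ∀ a, e a ∉ A → e a = a
    · right
      refine ⟨_, hprod e h, ?_⟩
      have hfix : ∀ a, e.symm a ≠ a → a ∈ A := by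
        intro a ha
        by_contra haA
        have := h (e.symm a) (by rwa [e.apply_symm_apply])
        rw [e.apply_symm_apply] at this
        exact ha this.symm
      have hw : ∀ (g : Fin r → Fin r), Edge.wt m r (∑ a ∈ A.attach, Finsupp.single
          (Edge.ofEntry hr (t a) (htr a a.2) (g a)) 1) = ∑ a ∈ A, (t a : ℕ) *
            ((Fin.castLE (show r ≤ 2 * m by omega) (g a)).rev : Fin (2 * m)) := by
        intro g
        rw [map_sum, ← Finset.sum_attach A]
        exact Finset.sum_congr rfl fun a _ => Edge.wt_ofPair hr _ _ _ _
      have hs : Edge.wt m r (∑ q ∈ S, Finsupp.single q 1) = ∑ a ∈ A, (t a : ℕ) *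
            ((Fin.castLE (show r ≤ 2 * m by omega) a).rev : Fin (2 * m)) := by
        rw [hsum, map_sum]
        refine Finset.sum_congr rfl fun a ha => ?_
        rw [Edge.wt_single, htA a ha, (hq a ha).2]
      rw [hw, hs]
      refine sum_mul_comp_perm_lt (f := fun a => (t a : ℕ)) (g := fun a =>
        (((Fin.castLE (show r ≤ 2 * m by omega) a).rev : Fin (2 * m)) : ℕ)) hanti ?_ hfix ?_
      · intro a _ b _ hab
        have := b.2
        simp only [Fin.val_rev, Fin.val_castLE]
        rw [Fin.lt_def] at hab
        omega
      · intro h1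
        exact he (inv_eq_one.mp h1)
    · left
      push Not at h
      obtain ⟨a, ha, hne⟩ := h
      refine Finset.prod_eq_zero (Finset.mem_univ a) ?_
      rw [htA' _ ha, chartMat_of_lt hr _ (by simp), if_neg]
      rw [Fin.val_castLE]
      exact fun h => hne (Fin.ext h)

/-- Every admissible family of intervals is the leading term of a product of minors. -/
theorem exists_isLead_wedgeVec (hr : r ≤ m) {ℓ : ℕ} {s : Edge m r →₀ ℕ}
    (hs : Edge.IsAdmissible ℓ s) : ∃ t : Fin ℓ × Fin r → Fin (2 * m),
      IsLead s (wedgeVec (Fin ℓ) (chartMat hr (X : Edge m r → MvPolynomial (Edge m r) ℂ)) t) := by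
  obtain ⟨S, hS, rfl⟩ := Edge.exists_antichains hs
  choose t ht using fun j => exists_isLead_det hr (hS j)
  exact ⟨fun p => t p.1 p.2, IsLead.prod Finset.univ fun j _ => ht j⟩

end Chart

/-! #### Orders of vanishing -/

section Order

variable {σ : Type*}

/-- All terms of `f` have degree at least `k`. -/
def VanishesTo (k : ℕ) (f : MvPolynomial σ ℂ) : Prop := ∀ s : σ →₀ ℕ, s.degree < k → coeff s f = 0

theorem VanishesTo.mul {k l : ℕ} {f g : MvPolynomial σ ℂ} (hf : VanishesTo k f)
    (hg : VanishesTo l g) : VanishesTo (k + l) (f * g) := by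
  classical
  intro s hs
  rw [coeff_mul]
  refine Finset.sum_eq_zero fun p hp => ?_
  rw [Finset.HasAntidiagonal.mem_antidiagonal] at hp
  have := congrArg Finsupp.degree hp
  rw [map_add] at this
  by_cases h : p.1.degree < k
  · rw [hf _ h, zero_mul]
  · rw [hg _ (by omega), mul_zero]

theorem VanishesTo.mono {k l : ℕ} {f : MvPolynomial σ ℂ} (hf : VanishesTo k f) (h : l ≤ k) :
    VanishesTo l f := fun s hs => hf s (hs.trans_le h)

theorem VanishesTo.add {k : ℕ} {f g : MvPolynomial σ ℂ} (hf : VanishesTo k f)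
    (hg : VanishesTo k g) : VanishesTo k (f + g) := fun s hs => by
  rw [coeff_add, hf s hs, hg s hs, add_zero]

theorem VanishesTo.sum {ι : Type*} {T : Finset ι} {k : ℕ} {f : ι → MvPolynomial σ ℂ}
    (hf : ∀ j ∈ T, VanishesTo k (f j)) : VanishesTo k (∑ j ∈ T, f j) := fun s hs => by
  rw [coeff_sum]
  exact Finset.sum_eq_zero fun j hj => hf j hj s hs

theorem vanishesTo_zero (f : MvPolynomial σ ℂ) : VanishesTo 0 f := fun _ h => absurd h (Nat.not_lt_zero _)

theorem vanishesTo_X (a : σ) : VanishesTo 1 (X a : MvPolynomial σ ℂ) := fun s hs => by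
  classical
  rw [coeff_X, if_neg]
  rintro rfl
  simp at hs

/-- Telescoping: replacing a single factor gains one order of vanishing and the remaining factors
keep theirs. -/
theorem vanishesTo_prod_sub_prod {P : Type*} (T : Finset P) {f g : P → MvPolynomial σ ℂ} {d : P → ℕ}
    (hg : ∀ p, VanishesTo (d p) (g p)) (hfg : ∀ p, VanishesTo (d p + 1) (f p - g p)) :
    VanishesTo (∑ p ∈ T, d p + 1) (∏ p ∈ T, f p - ∏ p ∈ T, g p) := by
  classical
  have hf : ∀ p, VanishesTo (d p) (f p) := fun p => by
    have := ((hfg p).mono (Nat.le_succ _)).add (hg p)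
    rwa [sub_add_cancel] at this
  have hp : ∀ T : Finset P, VanishesTo (∑ p ∈ T, d p) (∏ p ∈ T, g p) := fun T => by
    induction T using Finset.induction_on with
    | empty => exact vanishesTo_zero _
    | insert p T hp ih =>
      rw [Finset.sum_insert hp, Finset.prod_insert hp]
      exact (hg p).mul ih
  induction T using Finset.induction_on with
  | empty => simp [VanishesTo]
  | insert p T hpT ih =>
    rw [Finset.sum_insert hpT, Finset.prod_insert hpT, Finset.prod_insert hpT]
    have e : f p * ∏ q ∈ T, f q - g p * ∏ q ∈ T, g q =
        f p * (∏ q ∈ T, f q - ∏ q ∈ T, g q) + (f p - g p) * ∏ q ∈ T, g q := by ring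
    rw [e]
    refine VanishesTo.add ?_ ?_
    · have := (hf p).mul ih
      rwa [← add_assoc] at this
    · exact ((hfg p).mul (hp T)).mono (by omega)

theorem vanishesTo_wedgeVec_sub {I κ J : Type*} [Fintype I] [DecidableEq I] [Fintype κ]
    [DecidableEq κ] [Fintype J] [DecidableEq J] {K K' : Matrix I κ (MvPolynomial σ ℂ)} {d : I → ℕ}
    (hK : ∀ b c, VanishesTo (d b) (K' b c)) (hKK : ∀ b c, VanishesTo (d b + 1) (K b c - K' b c))
    (t : J × κ → I) :
    VanishesTo (∑ p, d (t p) + 1) (wedgeVec J K t - wedgeVec J K' t) := by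
  rw [wedgeVec_eq_sum, wedgeVec_eq_sum, ← Finset.sum_sub_distrib]
  refine VanishesTo.sum fun g _ => ?_
  rw [← mul_sub]
  have := (vanishesTo_zero (∏ j, ((Equiv.Perm.sign (g j) : ℤ) : MvPolynomial σ ℂ))).mul
    (vanishesTo_prod_sub_prod Finset.univ (fun p => hK (t p) (g p.1 p.2))
      fun p => hKK (t p) (g p.1 p.2))
  rwa [zero_add] at this

end Order

end

section

open MvPolynomial

/-! ### The generating function of the integral form -/

theorem expProd_append {σ I : Type*} [Fintype I] [DecidableEq I] (X : σ → Matrix I I ℂ)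
    (L L' : List σ) : expProd X (L ++ L') = expProd X L * expProd X L' := by
  rw [expProd, List.map_append, List.prod_append, expProd, expProd]

/-- All terms of degree two and higher contain a vanishing product of two of the matrices. -/
theorem expProd_of_mul_eq_zero {σ I : Type*} [Fintype I] [DecidableEq I] {X : σ → Matrix I I ℂ}
    {L : List σ} (hL : ∀ a ∈ L, ∀ b ∈ L, X a * X b = 0) : expProd X L =
      1 + (L.map fun a => (MvPolynomial.X a : MvPolynomial σ ℂ) • constMat σ (X a)).sum := by
  induction L with
  | nil => rw [expProd, List.map_nil, List.prod_nil, List.map_nil, List.sum_nil, add_zero]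
  | cons a L ih =>
    have h0 : ∀ L' : List σ, (∀ b ∈ L', X a * X b = 0) → constMat σ (X a) *
        (L'.map fun a => (MvPolynomial.X a : MvPolynomial σ ℂ) • constMat σ (X a)).sum = 0 := by
      intro L' hL'
      induction L' with
      | nil => rw [List.map_nil, List.sum_nil, mul_zero]
      | cons b L' ih' =>
        rw [List.map_cons, List.sum_cons, mul_add, ih' fun c hc => hL' c (List.mem_cons_of_mem _ hc),
          mul_smul_comm]
        have : constMat σ (X a) * constMat σ (X b) = constMat σ (X a * X b) :=
          (Matrix.map_mul (f := (C : ℂ →+* MvPolynomial σ ℂ))).symm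
        rw [this, hL' b (List.mem_cons_self ..)]
        ext
        simp [constMat]
    have hprod : expProd X (a :: L) = expFactor X a * expProd X L := by
      rw [expProd, List.map_cons, List.prod_cons, expProd]
    rw [hprod, ih fun b hb c hc => hL b (List.mem_cons_of_mem _ hb) c (List.mem_cons_of_mem _ hc),
      expFactor, add_mul, mul_add, mul_add, smul_mul_assoc, smul_mul_assoc,
      h0 L fun b hb => hL a (List.mem_cons_self ..) b (List.mem_cons_of_mem _ hb), smul_zero,
      one_mul, one_mul, mul_one, add_zero, List.map_cons, List.sum_cons]
    abel

theorem expProd_toList {σ I : Type*} [Fintype I] [DecidableEq I] {X : σ → Matrix I I ℂ}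
    {T : Finset σ} (h : ∀ a ∈ T, ∀ b ∈ T, X a * X b = 0) : expProd X T.toList =
      1 + ∑ a ∈ T, (MvPolynomial.X a : MvPolynomial σ ℂ) • constMat σ (X a) := by
  rw [expProd_of_mul_eq_zero fun a ha b hb =>
    h a (Finset.mem_toList.mp ha) b (Finset.mem_toList.mp hb), Finset.sum_map_toList]

section Chart

variable {m r : ℕ}

/-- The positive root that corresponds to an interval. -/
def Edge.root (e : Edge m r) : PosRoot m :=
  ⟨(e.hi.rev, e.lo), by
    have h1 := e.le_lo
    have h2 := e.le_hi
    have h3 := e.hi.2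
    have h4 := Fin.le_def.mp e.lo_le_hi
    simp only [Fin.lt_def, Fin.val_rev]
    omega⟩

theorem Edge.val_root (e : Edge m r) :
    ((e.root).1.1 : ℕ) = 2 * m - 1 - e.hi ∧ (e.root).1.2 = e.lo := by
  refine ⟨?_, rfl⟩
  change (e.hi.rev : ℕ) = _
  rw [Fin.val_rev]
  omega

/-- The matrix of `f_α` for the root of an interval. -/
def Edge.lowMat (e : Edge m r) : Matrix (Fin (2 * m)) (Fin (2 * m)) ℂ := rootMat m e.lo e.hi.rev

/-- The intervals, those that start in the first half first. -/
def edgeList (m r : ℕ) : List (Edge m r) :=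
  (Finset.univ.filter fun e : Edge m r => (e.lo : ℕ) < m).toList ++
    (Finset.univ.filter fun e : Edge m r => ¬ (e.lo : ℕ) < m).toList

theorem nodup_edgeList : (edgeList m r).Nodup := by
  rw [edgeList, List.nodup_append]
  refine ⟨Finset.nodup_toList _, Finset.nodup_toList _, ?_⟩
  rintro a ha b hb rfl
  simp only [Finset.mem_toList, Finset.mem_filter] at ha hb
  exact hb.2 ha.2

theorem mem_edgeList (e : Edge m r) : e ∈ edgeList m r := by
  simp only [edgeList, List.mem_append, Finset.mem_toList, Finset.mem_filter, Finset.mem_univ,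
    true_and]
  exact em _

/-- The columns of the highest weight vector. -/
def topCol (hr : r ≤ m) : Fin r → Fin (2 * m) := Fin.castLE (by omega)

theorem val_topCol (hr : r ≤ m) (a : Fin r) : (topCol hr a : ℕ) = a := rfl

theorem lowMat_apply (e : Edge m r) (x y : Fin (2 * m)) : e.lowMat x y =
    if x = e.lo ∧ y = e.hi.rev then 1 else if x = e.hi ∧ y = e.lo.rev then
      -(sgn m e.lo * sgn m e.hi.rev) else 0 := by
  simp only [Edge.lowMat, rootMat, Matrix.of_apply, Fin.rev_rev]

theorem sgn_hi_rev (hr : r ≤ m) (e : Edge m r) : sgn m e.hi.rev = 1 := by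
  have h2 := e.le_hi
  have h3 := e.hi.2
  rw [sgn, if_pos]
  rw [Fin.val_rev]
  omega

/-- The entries in the first `r` columns of a sum of lower triangular root vectors. -/
theorem sum_lowMat_topCol (hr : r ≤ m) (T : Finset (Edge m r)) (x : Fin (2 * m)) (a : Fin r) :
    (∑ e ∈ T, (X e : MvPolynomial (Edge m r) ℂ) • constMat (Edge m r) e.lowMat) x (topCol hr a) =
      if h : r ≤ (x : ℕ) then (if Edge.ofEntry hr x h a ∈ T then X (Edge.ofEntry hr x h a) else 0)
        else 0 := by
  have hent : ∀ e : Edge m r, ((X e : MvPolynomial (Edge m r) ℂ) •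
      constMat (Edge m r) e.lowMat) x (topCol hr a) = X e * C (e.lowMat x (topCol hr a)) :=
    fun e => rfl
  have ha := a.2
  rw [Matrix.sum_apply]
  simp only [hent]
  have hzero : ∀ e : Edge m r, (∀ h : r ≤ (x : ℕ), e ≠ Edge.ofEntry hr x h a) →
      e.lowMat x (topCol hr a) = 0 := by
    intro e he
    rw [lowMat_apply, if_neg, if_neg]
    · rintro ⟨rfl, h⟩
      have h1 := Fin.le_def.mp e.lo_le_hi
      refine he (e.le_lo.trans h1) (Edge.ext ?_ ?_)
      · change _ = min e.hi (topCol hr a).rev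
        rw [h, Fin.rev_rev, min_eq_right e.lo_le_hi]
      · change _ = max e.hi (topCol hr a).rev
        rw [h, Fin.rev_rev, max_eq_left e.lo_le_hi]
    · rintro ⟨rfl, h⟩
      refine he e.le_lo (Edge.ext ?_ ?_)
      · change _ = min e.lo (topCol hr a).rev
        rw [h, Fin.rev_rev, min_eq_left e.lo_le_hi]
      · change _ = max e.lo (topCol hr a).rev
        rw [h, Fin.rev_rev, max_eq_right e.lo_le_hi]
  split_ifs with h h'
  · rw [Finset.sum_eq_single (Edge.ofEntry hr x h a)]
    · have : (Edge.ofEntry hr x h a).lowMat x (topCol hr a) = 1 := by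
        have hs := sgn_hi_rev hr (Edge.ofEntry hr x h a)
        rw [lowMat_apply]
        rcases le_total x (topCol hr a).rev with hx | hx
        · have e1 : (Edge.ofEntry hr x h a).lo = x := min_eq_left hx
          have e2 : (Edge.ofEntry hr x h a).hi = (topCol hr a).rev := max_eq_right hx
          rw [if_pos ⟨e1.symm, by rw [e2, Fin.rev_rev]⟩]
        · have e1 : (Edge.ofEntry hr x h a).lo = (topCol hr a).rev := min_eq_right hx
          have e2 : (Edge.ofEntry hr x h a).hi = x := max_eq_left hx
          have e3 : sgn m (topCol hr a).rev = -1 := by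
            rw [sgn, if_neg]
            rw [Fin.val_rev, val_topCol]
            omega
          rw [hs, e1, e2, e3, Fin.rev_rev]
          split_ifs
          · rfl
          · simp
          · simp_all
      rw [this, C_1, mul_one]
    · intro e _ he
      rw [hzero e fun _ => he, C_0, mul_zero]
    · intro h0
      exact absurd h' h0
  · refine Finset.sum_eq_zero fun e he => ?_
    rw [hzero e fun _ h0 => h' (h0 ▸ he), C_0, mul_zero]
  · refine Finset.sum_eq_zero fun e he => ?_
    rw [hzero e fun h0 => absurd h0 h, C_0, mul_zero]

/-- The entries in the columns `y ≥ m` of the sum of the root vectors with `e.lo < m`. -/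
theorem sum_lowMat_of_le (hr : r ≤ m) (x y : Fin (2 * m)) (hy : m ≤ (y : ℕ)) :
    (∑ e : Edge m r with (e.lo : ℕ) < m, (X e : MvPolynomial (Edge m r) ℂ) •
      constMat (Edge m r) e.lowMat) x y =
      if h : r ≤ (y.rev : ℕ) ∧ 2 * m ≤ (x : ℕ) + r then -X (Edge.ofPair hr y.rev x h.1 h.2)
        else 0 := by
  have hent : ∀ e : Edge m r, ((X e : MvPolynomial (Edge m r) ℂ) •
      constMat (Edge m r) e.lowMat) x y = X e * C (e.lowMat x y) := fun e => rfl
  have hy2 := y.2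
  rw [Matrix.sum_apply]
  simp only [hent]
  have hzero : ∀ e : Edge m r, (x ≠ e.hi ∨ y ≠ e.lo.rev) → e.lowMat x y = 0 := by
    intro e he
    have h2 := e.le_hi
    have h3 := e.hi.2
    rw [lowMat_apply, if_neg, if_neg]
    · rintro ⟨h4, h5⟩
      exact he.elim (fun h => h h4) (fun h => h h5)
    · rintro ⟨_, h4⟩
      rw [Fin.ext_iff, Fin.val_rev] at h4
      omega
  split_ifs with h
  · have hle : y.rev ≤ x := by
      rw [Fin.le_def, Fin.val_rev]
      omega
    have e1 : (Edge.ofPair hr y.rev x h.1 h.2).lo = y.rev := min_eq_left hle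
    have e2 : (Edge.ofPair hr y.rev x h.1 h.2).hi = x := max_eq_right hle
    rw [Finset.sum_eq_single (Edge.ofPair hr y.rev x h.1 h.2)]
    · have hs := sgn_hi_rev hr (Edge.ofPair hr y.rev x h.1 h.2)
      have h4 := h.1
      have e3 : sgn m y.rev = 1 := by
        rw [sgn, if_pos]
        rw [Fin.val_rev]
        omega
      rw [lowMat_apply, if_neg, if_pos, hs, e1, e3]
      · simp
      · rw [e1, e2, Fin.rev_rev]
        exact ⟨rfl, rfl⟩
      · rintro ⟨_, h5⟩
        rw [e2, Fin.ext_iff, Fin.val_rev] at h5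
        omega
    · intro e _ he
      rw [hzero, C_0, mul_zero]
      by_contra! h5
      refine he (Edge.ext ?_ ?_)
      · rw [e1, h5.2, Fin.rev_rev]
      · rw [e2, h5.1]
    · intro h0
      exact absurd (Finset.mem_filter.mpr ⟨Finset.mem_univ _, by
        rw [e1, Fin.val_rev]; omega⟩) h0
  · refine Finset.sum_eq_zero fun e he => ?_
    rw [hzero, C_0, mul_zero]
    by_contra! h5
    apply h
    rw [h5.1, h5.2, Fin.rev_rev]
    exact ⟨e.le_lo, e.le_hi⟩

/-- Nonzero rows sit at the end points, nonzero columns at the mirrored end points. A product can be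
nonzero only if the mirror of the first left end is the second left end, so these two lie in
different halves. -/
theorem lowMat_mul_lowMat {e e' : Edge m r}
    (h : (e.lo : ℕ) < m ∧ (e'.lo : ℕ) < m ∨ ¬ (e.lo : ℕ) < m ∧ ¬ (e'.lo : ℕ) < m) :
    e.lowMat * e'.lowMat = 0 := by
  have h1 := e.le_lo
  have h2 := e.le_hi
  have h3 := e.hi.2
  have h1' := e'.le_lo
  have h2' := e'.le_hi
  have h3' := e'.hi.2
  have h4 := Fin.le_def.mp e.lo_le_hi
  have h5 := Fin.le_def.mp e'.lo_le_hi
  unfold Edge.lowMat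
  apply rootMat_mul_zero <;>
    simp only [ne_eq, Fin.ext_iff, Fin.val_rev] <;> omega

theorem lowMat_sq (e : Edge m r) : e.lowMat * e.lowMat = 0 :=
  lowMat_mul_lowMat (by tauto)

/-- The quadratic part of the generating function. -/
def quadTerm {R : Type*} [CommRing R] (hr : r ≤ m) (z : Edge m r → R) (x : Fin (2 * m)) (a : Fin r)
    (y : Fin (2 * m)) : R :=
  if h : (r ≤ (y.rev : ℕ) ∧ 2 * m ≤ (x : ℕ) + r) ∧ m ≤ (y : ℕ) then
    z (Edge.ofPair hr y.rev x h.1.1 h.1.2) * z (Edge.ofEntry hr y (hr.trans h.2) a) else 0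

/-- The first `r` columns of the generating function for the lower triangular root vectors. -/
theorem expProd_lowMat_apply (hr : r ≤ m) (x : Fin (2 * m)) (a : Fin r) :
    (expProd Edge.lowMat (edgeList m r) * constMat (Edge m r) (colMat ℂ (topCol hr))) x a =
      chartMat hr X x a - ∑ y, quadTerm hr X x a y := by
  have hcol : constMat (Edge m r) (colMat ℂ (topCol hr)) =
      colMat (MvPolynomial (Edge m r) ℂ) (topCol hr) := by
    ext x a
    rw [constMat_apply, colMat, colMat, Matrix.of_apply, Matrix.of_apply]
    split_ifs <;> simp
  -- Within each half of `edgeList` all products vanish, so the generating matrix is (1 + A)(1 + B)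
  -- = 1 + A + B + AB; AB is the source of the quadratic terms.
  rw [hcol, mul_colMat, edgeList, expProd_append, expProd_toList, expProd_toList]
  rotate_left
  · intro e he e' he'
    rw [Finset.mem_filter] at he he'
    exact lowMat_mul_lowMat (Or.inr ⟨he.2, he'.2⟩)
  · intro e he e' he'
    rw [Finset.mem_filter] at he he'
    exact lowMat_mul_lowMat (Or.inl ⟨he.2, he'.2⟩)
  rw [mul_add, mul_one, Matrix.add_apply, Matrix.add_apply, add_mul, one_mul, Matrix.add_apply,
    Matrix.mul_apply, sum_lowMat_topCol, sum_lowMat_topCol]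
  simp only [sum_lowMat_topCol]
  -- The mirrored column index is at least m, so even when the pair gets reordered the left end lies
  -- in the same half as the row.
  have hlo : ∀ (y : Fin (2 * m)) (h : r ≤ (y : ℕ)), ((Edge.ofEntry hr y h a).lo : ℕ) < m ↔
      (y : ℕ) < m := by
    intro y h
    have ha := a.2
    have : (Edge.ofEntry hr y h a).lo = min y (topCol hr a).rev := rfl
    rw [this]
    rcases min_choice y (topCol hr a).rev with h0 | h0
    · rw [h0]
    · have h1 := Fin.le_def.mp (min_eq_right_iff.mp h0)
      rw [h0]
      rw [Fin.val_rev, val_topCol] at h1 ⊢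
      omega
  have hq : ∀ y, (∑ e : Edge m r with (e.lo : ℕ) < m, (X e : MvPolynomial (Edge m r) ℂ) •
      constMat (Edge m r) e.lowMat) x y * (if h : r ≤ (y : ℕ) then
        (if Edge.ofEntry hr y h a ∈ Finset.univ.filter (fun e : Edge m r => ¬ (e.lo : ℕ) < m) then
          X (Edge.ofEntry hr y h a) else 0) else 0) = -quadTerm hr X x a y := by
    intro y
    by_cases hy : m ≤ (y : ℕ)
    · rw [sum_lowMat_of_le hr x y hy, dif_pos (hr.trans hy), if_pos (by
        rw [Finset.mem_filter, hlo]
        exact ⟨Finset.mem_univ _, not_lt.mpr hy⟩), quadTerm]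
      by_cases h : r ≤ (y.rev : ℕ) ∧ 2 * m ≤ (x : ℕ) + r
      · rw [dif_pos h, dif_pos ⟨h, hy⟩, neg_mul]
      · rw [dif_neg h, dif_neg fun h' => h h'.1, zero_mul, neg_zero]
    · have h0 : quadTerm hr (X : Edge m r → MvPolynomial (Edge m r) ℂ) x a y = 0 := by
        rw [quadTerm, dif_neg fun h' => hy h'.2]
      rw [h0, neg_zero]
      split_ifs with h h'
      · rw [Finset.mem_filter, hlo] at h'
        exact absurd (not_le.mp hy) h'.2
      · rw [mul_zero]
      · rw [mul_zero]
  rw [Finset.sum_congr rfl fun y _ => hq y, Finset.sum_neg_distrib, ← add_assoc, ← sub_eq_add_neg]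
  congr 1
  rw [Matrix.one_apply]
  by_cases hx : r ≤ (x : ℕ)
  · have : x ≠ topCol hr a := by
      intro h
      have ha := a.2
      rw [h, val_topCol] at hx
      omega
    rw [chartMat_of_le hr _ hx, dif_pos hx, dif_pos hx, if_neg this, zero_add]
    simp only [Finset.mem_filter, Finset.mem_univ, true_and, hlo]
    by_cases h : (x : ℕ) < m
    · rw [if_pos h, if_neg (not_not.mpr h), add_zero]
    · rw [if_neg h, if_pos h, zero_add]
  · rw [chartMat_of_lt hr _ (not_le.mp hx), dif_neg hx, dif_neg hx, add_zero, add_zero]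
    simp only [Fin.ext_iff, val_topCol]

end Chart

end

section

open MvPolynomial

variable {m r : ℕ}

/-! ### Products of divided powers of lower triangular root vectors -/

theorem map_edgeList_sum (s : Edge m r →₀ ℕ) : ((edgeList m r).map s).sum = s.degree := by
  have h : (edgeList m r).toFinset = Finset.univ := by
    ext e
    simp [mem_edgeList]
  rw [← List.sum_toFinset _ nodup_edgeList, h, Finsupp.degree_eq_sum]

/-- The product of the divided powers `f_α^{(s_α)}`. -/
def lowOp (s : Edge m r →₀ ℕ) : U m :=
  ((edgeList m r).map fun e => divPow (fVec e.root) (s e)).prod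

theorem lowOp_mem_pbw (s : Edge m r →₀ ℕ) : lowOp s ∈ pbw m (s.degree + 1) := by
  refine Submodule.subset_span ⟨(edgeList m r).map fun e => (e.root, s e), ?_, ?_⟩
  · rw [List.map_map]
    change ((edgeList m r).map s).sum < _
    rw [map_edgeList_sum]
    omega
  · rw [List.map_map]
    rfl

theorem tensHom_lowOp (P : Type*) [Fintype P] [DecidableEq P] (s : Edge m r →₀ ℕ) :
    tensHom P m (lowOp s) =
      ((edgeList m r).map fun e => divPow (tensAct P e.lowMat) (s e)).prod := by
  rw [lowOp, map_list_prod, List.map_map]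
  congr 1
  refine List.map_congr_left fun e _ => ?_
  rw [Function.comp_apply, map_divPow, tensHom_fVec]
  rfl

theorem tensHom_lowOp_apply (hr : r ≤ m) (ℓ : ℕ) (s : Edge m r →₀ ℕ)
    (t : Fin ℓ × Fin r → Fin (2 * m)) :
    tensHom (Fin ℓ × Fin r) m (lowOp s) (wedgeVec (Fin ℓ) (colMat ℂ (topCol hr))) t =
      coeff s (wedgeVec (Fin ℓ) (expProd Edge.lowMat (edgeList m r) *
        constMat (Edge m r) (colMat ℂ (topCol hr))) t) := by
  rw [tensHom_lowOp, ← coeff_wedgeVec_expProd (J := Fin ℓ) (colMat ℂ (topCol hr))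
    (fun e _ => lowMat_sq e) nodup_edgeList s fun e he => absurd (mem_edgeList e) he]

/-! #### The support of the filtration -/

section Support

variable {P : Type*} [Fintype P] [DecidableEq P]

/-- The tensor vanishes at all positions of height at least `k`. -/
def SupportedBelow (r k : ℕ) (F : (P → Fin (2 * m)) → ℂ) : Prop := ∀ t, k ≤ height r t → F t = 0

theorem height_update (t : P → Fin (2 * m)) (p : P) (y : Fin (2 * m)) :
    height r t ≤ height r (Function.update t p y) + 1 := by
  rw [height, height, ← Finset.add_sum_erase _ _ (Finset.mem_univ p),
    ← Finset.add_sum_erase _ _ (Finset.mem_univ p)]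
  have : ∑ q ∈ Finset.univ.erase p, (if r ≤ (Function.update t p y q : ℕ) then 1 else 0) =
      ∑ q ∈ Finset.univ.erase p, if r ≤ (t q : ℕ) then 1 else 0 := by
    refine Finset.sum_congr rfl fun q hq => ?_
    rw [Function.update_of_ne (Finset.ne_of_mem_erase hq)]
  rw [this]
  split_ifs <;> omega

theorem SupportedBelow.tensAct {k : ℕ} {F : (P → Fin (2 * m)) → ℂ} (hF : SupportedBelow r k F)
    (X : Matrix (Fin (2 * m)) (Fin (2 * m)) ℂ) : SupportedBelow r (k + 1) (tensAct P X F) := by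
  intro t ht
  rw [tensAct_apply]
  refine Finset.sum_eq_zero fun p _ => Finset.sum_eq_zero fun y _ => ?_
  have := height_update (r := r) t p y
  rw [hF _ (by omega), mul_zero]

theorem SupportedBelow.divPow {k : ℕ} {F : (P → Fin (2 * m)) → ℂ} (hF : SupportedBelow r k F)
    (X : Matrix (Fin (2 * m)) (Fin (2 * m)) ℂ) (l : ℕ) :
    SupportedBelow r (k + l) (divPow (SympPBW.tensAct P X) l F) := by
  have key : SupportedBelow r (k + l) ((SympPBW.tensAct P X ^ l) F) := by
    induction l with
    | zero => simpa using hF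
    | succ l ih =>
      rw [pow_succ', Module.End.mul_apply, ← add_assoc]
      exact ih.tensAct X
  intro t ht
  rw [SympPBW.divPow, LinearMap.smul_apply, Pi.smul_apply, key t ht, smul_zero]

/-- A Lie algebra element changes one tensor index at a time, hence raises the height of the support
by at most one; the height thus bounds the filtration degree from below. -/
theorem supportedBelow_of_mem_pbw {n k : ℕ} {F : (P → Fin (2 * m)) → ℂ} (hF : SupportedBelow r 1 F)
    {x : U m} (hx : x ∈ pbw m n) (hk : n ≤ k) : SupportedBelow r k (tensHom P m x F) := by
  have key : ∀ L : List (PosRoot m × ℕ), SupportedBelow r (1 + (L.map Prod.snd).sum)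
      (tensHom P m (L.map fun p => SympPBW.divPow (fVec p.1) p.2).prod F) := by
    intro L
    induction L with
    | nil => simpa using hF
    | cons p L ih =>
      rw [List.map_cons, List.map_cons, List.prod_cons, map_mul, Module.End.mul_apply, map_divPow,
        tensHom_fVec, List.sum_cons, add_comm p.2, ← add_assoc]
      exact ih.divPow _ _
  induction hx using Submodule.span_induction with
  | mem x hx =>
    obtain ⟨L, hL, rfl⟩ := hx
    exact fun t ht => key L t (by omega)
  | zero => intro t _; simp
  | add x y _ _ hx hy =>
    intro t ht
    rw [map_add, LinearMap.add_apply, Pi.add_apply, hx t ht, hy t ht, add_zero]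
  | smul c x _ hx =>
    intro t ht
    rw [map_zsmul, LinearMap.smul_apply, Pi.smul_apply, hx t ht, smul_zero]

end Support

theorem supportedBelow_wedgeVec (hr : r ≤ m) (ℓ : ℕ) :
    SupportedBelow r 1 (wedgeVec (Fin ℓ) (colMat ℂ (topCol hr))) := by
  intro t ht
  obtain ⟨p, -, hp⟩ := Finset.exists_ne_zero_of_sum_ne_zero
    (show height r t ≠ 0 by omega)
  have hp : r ≤ (t p : ℕ) := by
    by_contra h
    exact hp (if_neg h)
  refine Finset.prod_eq_zero (Finset.mem_univ p.1) (Matrix.det_eq_zero_of_row_eq_zero p.2 fun c => ?_)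
  rw [Matrix.submatrix_apply, colMat, Matrix.of_apply, if_neg]
  intro h
  have h1 := congrArg Fin.val h
  simp only [id_eq, val_topCol] at h1
  have h2 := c.2
  rw [Prod.mk.eta] at h1
  omega

/-- Quadratic terms occur only in rows from 2m - r on. These are at least r, where the chart entry
is already linear, so the correction is one order higher in every row. -/
theorem vanishesTo_quadTerm (hr : r ≤ m) (x : Fin (2 * m)) (a : Fin r) (y : Fin (2 * m)) :
    VanishesTo ((if r ≤ (x : ℕ) then 1 else 0) + 1)
      (quadTerm hr (X : Edge m r → MvPolynomial (Edge m r) ℂ) x a y) := by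
  rw [quadTerm]
  by_cases h : (r ≤ (y.rev : ℕ) ∧ 2 * m ≤ (x : ℕ) + r) ∧ m ≤ (y : ℕ)
  · rw [dif_pos h, if_pos (by omega)]
    exact (vanishesTo_X _).mul (vanishesTo_X _)
  · rw [dif_neg h]
    exact fun _ _ => coeff_zero _

/-- In degree equal to the height, the generating function agrees with the product of minors of
linear forms. -/
theorem coeff_wedgeVec_expProd_lowMat (hr : r ≤ m) {ℓ : ℕ} {s : Edge m r →₀ ℕ}
    {t : Fin ℓ × Fin r → Fin (2 * m)} (hs : s.degree = height r t) :
    coeff s (wedgeVec (Fin ℓ) (expProd Edge.lowMat (edgeList m r) *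
      constMat (Edge m r) (colMat ℂ (topCol hr))) t) = coeff s (wedgeVec (Fin ℓ) (chartMat hr X) t) := by
  rw [← sub_eq_zero, ← coeff_sub]
  -- The expected order of vanishing of row b is 1 if b ≥ r and 0 otherwise; these orders add up to
  -- the height of t.
  have key := vanishesTo_wedgeVec_sub (J := Fin ℓ) (K := expProd Edge.lowMat (edgeList m r) *
    constMat (Edge m r) (colMat ℂ (topCol hr))) (K' := chartMat hr X)
    (d := fun b => if r ≤ (b : ℕ) then 1 else 0) ?_ ?_ t
  · apply key s
    rw [hs, height]
    exact Nat.lt_succ_self _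
  · intro b c
    split_ifs with h
    · rw [chartMat_of_le hr _ h]
      exact vanishesTo_X _
    · exact vanishesTo_zero _
  · intro b c
    rw [expProd_lowMat_apply, sub_sub_cancel_left, ← Finset.sum_neg_distrib]
    refine VanishesTo.sum fun y _ s hs => ?_
    rw [coeff_neg, vanishesTo_quadTerm hr b c y s hs, neg_zero]

/-! ### Relations from a rank one evaluation -/

section RankOne

variable {B : Type*} [CommRing B]

/-- The sum of the products `u_y u_{2m-1-y}` over `m ≤ y < 2m - r`. -/
def kappa (r : ℕ) (u : Fin (2 * m) → B) : B :=
  ∑ y : Fin (2 * m), if r ≤ (y.rev : ℕ) ∧ m ≤ (y : ℕ) then u y * u y.rev else 0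

/-- The values of the variables that turn the generating function into a matrix of rank one. -/
def rankOneVal (u : Fin (2 * m) → B) (e : Edge m r) : Polynomial B :=
  Polynomial.X * Polynomial.C (u e.lo * u e.hi) *
    (1 + if 2 * m ≤ (e.lo : ℕ) + r then Polynomial.X * Polynomial.C (kappa r u) else 0)

theorem rankOneVal_map {B' : Type*} [CommRing B'] (f : B →+* B') (u : Fin (2 * m) → B)
    (e : Edge m r) : (rankOneVal u e).map f = rankOneVal (fun a => f (u a)) e := by
  have hk : f (kappa r u) = kappa r fun a => f (u a) := by
    rw [kappa, kappa, map_sum]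
    refine Finset.sum_congr rfl fun y _ => ?_
    split_ifs
    · rw [map_mul]
    · rw [map_zero]
  rw [rankOneVal, rankOneVal]
  split_ifs <;> simp [hk]

theorem rankOneVal_ofPair (hr : r ≤ m) (u : Fin (2 * m) → B) (b c : Fin (2 * m)) (hb : r ≤ (b : ℕ))
    (hc : 2 * m ≤ (c : ℕ) + r) : rankOneVal u (Edge.ofPair hr b c hb hc) =
      Polynomial.X * Polynomial.C (u b * u c) *
    (1 + if 2 * m ≤ (b : ℕ) + r then Polynomial.X * Polynomial.C (kappa r u) else 0) := by
  rw [rankOneVal]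
  rcases le_total b c with h | h
  · have e1 : (Edge.ofPair hr b c hb hc).lo = b := min_eq_left h
    have e2 : (Edge.ofPair hr b c hb hc).hi = c := max_eq_right h
    rw [e1, e2]
  · have e1 : (Edge.ofPair hr b c hb hc).lo = c := min_eq_right h
    have e2 : (Edge.ofPair hr b c hb hc).hi = b := max_eq_left h
    rw [Fin.le_def] at h
    rw [e1, e2, if_pos hc, if_pos (by omega), mul_comm (u c)]

/-- In a quadratic term neither interval starts at or beyond 2m - r, so neither value carries the
correction. Each term equals T² u_x u_c u_y u_{y.rev}, with c the mirror of the column index a.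
Their sum T² u_x u_c κ is exactly what the correction adds to the linear entry. -/
theorem chartMat_rankOneVal (hr : r ≤ m) (u : Fin (2 * m) → B) (x : Fin (2 * m)) (a : Fin r) :
    chartMat hr (rankOneVal u) x a - ∑ y, quadTerm hr (rankOneVal u) x a y =
      if r ≤ (x : ℕ) then Polynomial.X * Polynomial.C (u x * u (topCol hr a).rev) else
        if (x : ℕ) = a then 1 else 0 := by
  have hq : ∀ y, quadTerm hr (rankOneVal u) x a y = if 2 * m ≤ (x : ℕ) + r then
      Polynomial.X * Polynomial.X * Polynomial.C (u x * u (topCol hr a).rev) *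
        Polynomial.C (if r ≤ (y.rev : ℕ) ∧ m ≤ (y : ℕ) then u y * u y.rev else 0) else 0 := by
    intro y
    rw [quadTerm]
    by_cases hx : 2 * m ≤ (x : ℕ) + r
    · by_cases hy : r ≤ (y.rev : ℕ) ∧ m ≤ (y : ℕ)
      · have hy1 := hy.1
        have hy3 := y.2
        rw [dif_pos ⟨⟨hy.1, hx⟩, hy.2⟩, if_pos hx, if_pos hy, Edge.ofEntry, rankOneVal_ofPair,
          rankOneVal_ofPair, if_neg (by rw [Fin.val_rev]; omega), if_neg (by
            rw [Fin.val_rev] at hy1; omega)]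
        change _ * (_ * Polynomial.C (u y * u (topCol hr a).rev) * _) = _
        simp only [map_mul]
        ring
      · rw [dif_neg fun h => hy ⟨h.1.1, h.2⟩, if_pos hx, if_neg hy, map_zero, mul_zero]
    · rw [dif_neg fun h => hx h.1.2, if_neg hx]
  simp only [hq]
  by_cases hx : r ≤ (x : ℕ)
  · rw [if_pos hx, chartMat_of_le hr _ hx, Edge.ofEntry, rankOneVal_ofPair]
    change _ * Polynomial.C (u x * u (topCol hr a).rev) * _ - _ = _
    by_cases hx' : 2 * m ≤ (x : ℕ) + r
    · simp only [if_pos hx']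
      rw [← Finset.mul_sum, ← map_sum]
      change _ - _ * Polynomial.C (kappa r u) = _
      ring
    · simp only [if_neg hx']
      rw [Finset.sum_const_zero, add_zero, mul_one, sub_zero]
  · rw [if_neg hx, chartMat_of_lt hr _ (not_le.mp hx), Finset.sum_eq_zero, sub_zero]
    intro y _
    rw [if_neg]
    omega

/-- Two rows from T are multiples of the same w and make the determinant vanish. With at most one
such row, each Leibniz term has at most one factor of positive degree. -/
theorem natDegree_det_le_one {r : ℕ} {M : Matrix (Fin r) (Fin r) (Polynomial B)} {T : Finset (Fin r)}
    {c : Fin r → Polynomial B} {w : Fin r → Polynomial B} (hc : ∀ k a, (c k * w a).natDegree ≤ 1)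
    (hT : ∀ k ∈ T, ∀ a, M k a = c k * w a) (hT' : ∀ k ∉ T, ∀ a, (M k a).natDegree ≤ 0) :
    M.det.natDegree ≤ 1 := by
  by_cases h : ∃ k ∈ T, ∃ k' ∈ T, k ≠ k'
  · obtain ⟨k, hk, k', hk', hne⟩ := h
    have h0 : M.det = 0 := by
      have hk1 : M k = c k • w := funext (hT k hk)
      have hk2 : M.updateRow k w k' = c k' • w := by
        rw [Matrix.updateRow_ne hne.symm]
        exact funext (hT k' hk')
      have e1 : M = (M.updateRow k (c k • w)) := by
        rw [← hk1, Matrix.updateRow_eq_self]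
      have e2 : M.updateRow k w = (M.updateRow k w).updateRow k' (c k' • w) := by
        rw [← hk2, Matrix.updateRow_eq_self]
      rw [e1, Matrix.det_updateRow_smul, e2, Matrix.det_updateRow_smul,
        Matrix.det_zero_of_row_eq hne, mul_zero, mul_zero]
      rw [Matrix.updateRow_self, Matrix.updateRow_ne hne, Matrix.updateRow_self]
    rw [h0, Polynomial.natDegree_zero]
    exact zero_le_one
  · push Not at h
    rw [Matrix.det_apply]
    refine Polynomial.natDegree_sum_le_of_forall_le _ _ fun g _ => ?_
    refine (Polynomial.natDegree_smul_le _ _).trans ((Polynomial.natDegree_prod_le _ _).trans ?_)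
    calc ∑ a, (M (g a) a).natDegree ≤ ∑ a, if g a ∈ T then 1 else 0 := by
          refine Finset.sum_le_sum fun a _ => ?_
          split_ifs with ha
          · rw [hT _ ha]
            exact hc _ _
          · exact hT' _ ha _
      _ = ∑ k, if k ∈ T then 1 else 0 := Equiv.sum_comp g fun k => if k ∈ T then 1 else 0
      _ = T.card := by simp
      _ ≤ 1 := Finset.card_le_one.mpr fun k hk k' hk' => h k hk k' hk'

theorem natDegree_wedgeVec_le (hr : r ≤ m) (u : Fin (2 * m) → B) {ℓ : ℕ}
    {N : Matrix (Fin (2 * m)) (Fin r) (Polynomial B)} (hN : ∀ x a, N x a =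
      if r ≤ (x : ℕ) then Polynomial.X * Polynomial.C (u x * u (topCol hr a).rev) else
        if (x : ℕ) = a then 1 else 0) (t : Fin ℓ × Fin r → Fin (2 * m)) :
    (wedgeVec (Fin ℓ) N t).natDegree ≤ ℓ := by
  refine (Polynomial.natDegree_prod_le _ _).trans ?_
  calc ∑ j : Fin ℓ, ((N.submatrix (fun k => t (j, k)) id).det).natDegree ≤ ∑ j : Fin ℓ, 1 := by
        refine Finset.sum_le_sum fun j _ => natDegree_det_le_one
          (T := Finset.univ.filter fun k => r ≤ (t (j, k) : ℕ))
          (c := fun k => Polynomial.X * Polynomial.C (u (t (j, k))))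
          (w := fun a => Polynomial.C (u (topCol hr a).rev)) ?_ ?_ ?_
        · intro k a
          rw [mul_assoc, ← Polynomial.C_mul]
          exact Polynomial.natDegree_mul_C_le _ _ |>.trans Polynomial.natDegree_X_le
        · intro k hk a
          rw [Matrix.submatrix_apply, hN, if_pos (Finset.mem_filter.mp hk).2, Polynomial.C_mul,
            mul_assoc]
          rfl
        · intro k hk a
          rw [Finset.mem_filter] at hk
          rw [Matrix.submatrix_apply, hN, if_neg fun h => hk ⟨Finset.mem_univ _, h⟩]
          split_ifs <;> simp
    _ = ℓ := by simp

/-- Each variable becomes T u_lo u_hi times 1 + O(T). Only the lowest power of T is needed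
explicitly: it records the number of intervals and their end points, while the rest feeds lower
filtration steps. The coefficients are kept integral. -/
theorem prod_rankOneVal (s : Edge m r →₀ ℕ) : ∃ q : Polynomial (MvPolynomial (Fin (2 * m)) ℤ),
    q.coeff 0 = 1 ∧ (s.prod fun e k => rankOneVal (B := MvPolynomial (Fin (2 * m)) ℤ) X e ^ k) =
      Polynomial.X ^ s.degree * Polynomial.C (monomial (Edge.ends m r s) 1) * q := by
  induction s using Finsupp.induction_linear with
  | zero => exact ⟨1, by simp, by simp⟩
  | add s s' hs hs' =>
    obtain ⟨q, hq, h⟩ := hs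
    obtain ⟨q', hq', h'⟩ := hs'
    refine ⟨q * q', by rw [Polynomial.mul_coeff_zero, hq, hq', one_mul], ?_⟩
    rw [Finsupp.prod_add_index' (fun _ => pow_zero _) fun _ _ _ => pow_add _ _ _, h, h', map_add,
      map_add, pow_add, show monomial (Edge.ends m r s + Edge.ends m r s') (1 : ℤ) =
        monomial (Edge.ends m r s) 1 * monomial (Edge.ends m r s') 1 by
          rw [monomial_mul, one_mul], Polynomial.C_mul]
    ring
  | single e k =>
    refine ⟨(1 + if 2 * m ≤ (e.lo : ℕ) + r then Polynomial.X * Polynomial.C (kappa r X) else 0) ^ k,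
      ?_, ?_⟩
    · rw [Polynomial.coeff_zero_eq_eval_zero]
      split_ifs <;> simp
    · have he : Edge.ends m r (Finsupp.single e k) =
          k • (Finsupp.single e.lo 1 + Finsupp.single e.hi 1) := by
        rw [Edge.ends, Finsupp.linearCombination_single]
      have hm : (monomial (Finsupp.single e.lo 1 + Finsupp.single e.hi 1) (1 : ℤ)) =
          X e.lo * X e.hi := by
        rw [X, X, monomial_mul, one_mul]
      rw [Finsupp.prod_single_index (h := fun e k => rankOneVal X e ^ k) (pow_zero _), rankOneVal,
        mul_pow, mul_pow, ← Polynomial.C_pow, Finsupp.degree_single, he, ← hm, monomial_pow, one_pow]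

end RankOne

end

/-! ### Integral straightening relations in the filtered module -/

section

open MvPolynomial

variable {m r : ℕ}

/-- The families of `n` intervals. -/
def edgeFamilies (m r n : ℕ) : Finset (Edge m r →₀ ℕ) := Finset.univ.finsuppAntidiag n

theorem mem_edgeFamilies {n : ℕ} {s : Edge m r →₀ ℕ} : s ∈ edgeFamilies m r n ↔ s.degree = n := by
  rw [edgeFamilies, Finset.mem_finsuppAntidiag, Finsupp.degree_eq_sum]
  simp

/-- The families of at most `n` intervals. -/
def edgeFamiliesLE (m r n : ℕ) : Finset (Edge m r →₀ ℕ) :=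
  (Finset.range (n + 1)).biUnion (edgeFamilies m r)

theorem mem_edgeFamiliesLE {n : ℕ} {s : Edge m r →₀ ℕ} :
    s ∈ edgeFamiliesLE m r n ↔ s.degree ≤ n := by
  simp only [edgeFamiliesLE, Finset.mem_biUnion, Finset.mem_range, mem_edgeFamilies]
  constructor
  · rintro ⟨k, hk, rfl⟩
    omega
  · exact fun h => ⟨_, by omega, rfl⟩

/-- The coefficients of the relations. -/
def relCoeff (n : ℕ) (d : Fin (2 * m) →₀ ℕ) (s : Edge m r →₀ ℕ) : ℤ :=
  coeff d ((s.prod fun e k => rankOneVal (B := MvPolynomial (Fin (2 * m)) ℤ) X e ^ k).coeff n)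

theorem relCoeff_of_lt {n : ℕ} (d : Fin (2 * m) →₀ ℕ) {s : Edge m r →₀ ℕ} (h : n < s.degree) :
    relCoeff n d s = 0 := by
  obtain ⟨q, -, hq⟩ := prod_rankOneVal s
  rw [relCoeff, hq, mul_assoc, Polynomial.coeff_X_pow_mul', if_neg (not_le.mpr h), coeff_zero]

theorem relCoeff_of_eq {n : ℕ} (d : Fin (2 * m) →₀ ℕ) {s : Edge m r →₀ ℕ} (h : s.degree = n) :
    relCoeff n d s = if Edge.ends m r s = d then 1 else 0 := by
  obtain ⟨q, hq0, hq⟩ := prod_rankOneVal s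
  rw [relCoeff, hq, mul_assoc, Polynomial.coeff_X_pow_mul', if_pos h.le, h, Nat.sub_self,
    Polynomial.coeff_C_mul, hq0, mul_one, coeff_monomial]

/-- The evaluation of the generating function. -/
def rankOneHom (m r : ℕ) :
    MvPolynomial (Edge m r) ℂ →+* Polynomial (MvPolynomial (Fin (2 * m)) ℂ) :=
  eval₂Hom (Polynomial.C.comp C) (rankOneVal X)

/-- Taking this coefficient is linear in f with integral weights, and a monomial of degree above n
cannot reach T^n; a finite sum over s suffices for every f. -/
theorem coeff_rankOneHom (n : ℕ) (d : Fin (2 * m) →₀ ℕ) (f : MvPolynomial (Edge m r) ℂ) :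
    coeff d ((rankOneHom m r f).coeff n) =
      ∑ s ∈ edgeFamiliesLE m r n, coeff s f * (relCoeff n d s : ℂ) := by
  induction f using MvPolynomial.induction_on' with
  | add p q hp hq =>
    rw [map_add, Polynomial.coeff_add, coeff_add, hp, hq, ← Finset.sum_add_distrib]
    refine Finset.sum_congr rfl fun s _ => ?_
    rw [coeff_add, add_mul]
  | monomial u a =>
    have h1 : rankOneHom m r (monomial u a) = Polynomial.C (C a) * ((u.prod fun e k =>
        rankOneVal (B := MvPolynomial (Fin (2 * m)) ℤ) X e ^ k).map
          (MvPolynomial.map (Int.castRingHom ℂ))) := by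
      rw [rankOneHom, eval₂Hom_monomial, RingHom.comp_apply, ← Polynomial.coe_mapRingHom,
        Finsupp.prod, Finsupp.prod, map_prod]
      congr 1
      refine Finset.prod_congr rfl fun e _ => ?_
      rw [map_pow, Polynomial.coe_mapRingHom, rankOneVal_map]
      simp only [map_X]
    have h2 : coeff d ((rankOneHom m r (monomial u a)).coeff n) = a * (relCoeff n d u : ℂ) := by
      rw [h1, Polynomial.coeff_C_mul, coeff_C_mul, Polynomial.coeff_map, coeff_map, relCoeff]
      rfl
    rw [h2]
    by_cases hu : u ∈ edgeFamiliesLE m r n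
    · rw [Finset.sum_eq_single_of_mem u hu, coeff_monomial, if_pos rfl]
      intro s _ hs
      rw [coeff_monomial, if_neg hs.symm, zero_mul]
    · rw [Finset.sum_eq_zero, relCoeff_of_lt d (by rw [mem_edgeFamiliesLE] at hu; omega),
        Int.cast_zero, mul_zero]
      intro s hs
      rw [coeff_monomial, if_neg (by rintro rfl; exact hu hs), zero_mul]

/-- After the substitution each of the ℓ minors has degree at most one in T, so their product has no
term in T^n. -/
theorem sum_coeff_mul_relCoeff (hr : r ≤ m) {ℓ n : ℕ} (hn : ℓ < n) (d : Fin (2 * m) →₀ ℕ)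
    (t : Fin ℓ × Fin r → Fin (2 * m)) : ∑ s ∈ edgeFamiliesLE m r n,
      coeff s (wedgeVec (Fin ℓ) (expProd Edge.lowMat (edgeList m r) *
        constMat (Edge m r) (colMat ℂ (topCol hr))) t) * (relCoeff n d s : ℂ) = 0 := by
  rw [← coeff_rankOneHom, ← wedgeVec_map, Polynomial.coeff_eq_zero_of_natDegree_lt, coeff_zero]
  refine (natDegree_wedgeVec_le hr X (fun x a => ?_) t).trans_lt hn
  rw [← chartMat_rankOneVal, Matrix.map_apply, expProd_lowMat_apply, map_sub, map_sum]
  have hX : ∀ e : Edge m r, rankOneHom m r (X e) = rankOneVal X e := fun e => eval₂Hom_X' _ _ _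
  congr 1
  · rw [chartMat, chartMat, Matrix.of_apply, Matrix.of_apply]
    split_ifs <;> simp [hX]
  · refine Finset.sum_congr rfl fun y _ => ?_
    rw [quadTerm, quadTerm]
    split_ifs <;> simp [hX]

variable {ℓ : ℕ} (i : Fin m)

theorem exists_realization_topCol (ℓ : ℕ) :
    ∃ Θ : V ((ℓ : ℤ) • fundWeight i) →+ ((Fin ℓ × Fin (i + 1) → Fin (2 * m)) → ℂ),
      Function.Injective Θ ∧ (∀ (x : U m) (w : V ((ℓ : ℤ) • fundWeight i)),
        Θ (x • w) = tensHom (Fin ℓ × Fin (i + 1)) m x (Θ w)) ∧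
      Θ (hwVec ((ℓ : ℤ) • fundWeight i)) = wedgeVec (Fin ℓ) (colMat ℂ (topCol (r := i + 1) i.2)) := by
  refine exists_realization i ℓ (Fin.castLE_injective _) fun x => ?_
  constructor
  · rintro ⟨a, rfl⟩
    exact a.2
  · exact fun h => ⟨⟨x, h⟩, rfl⟩

/-- For more than `ℓ` intervals, the sum over all families with prescribed end points lies in a
smaller filtration step. -/
theorem sum_lowOp_mem_pbwV {n : ℕ} (hn : ℓ < n) (d : Fin (2 * m) →₀ ℕ) :
    ∑ s ∈ edgeFamilies m (i + 1) n with Edge.ends m (i + 1) s = d,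
      lowOp s • hwVec ((ℓ : ℤ) • fundWeight i) ∈ pbwV ((ℓ : ℤ) • fundWeight i) n := by
  obtain ⟨Θ, hΘ, hΘ1, hΘ2⟩ := exists_realization_topCol i ℓ
  -- An exact relation in the module, checked coordinatewise in the tensor model.
  have hzero : ∑ s ∈ edgeFamiliesLE m (i + 1) n, relCoeff n d s • lowOp s •
      hwVec ((ℓ : ℤ) • fundWeight i) = 0 := by
    apply hΘ
    rw [map_zero, map_sum]
    ext t
    rw [Finset.sum_apply, Pi.zero_apply, ← sum_coeff_mul_relCoeff i.2 hn d t]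
    refine Finset.sum_congr rfl fun s _ => ?_
    rw [map_zsmul, hΘ1, hΘ2, Pi.smul_apply, tensHom_lowOp_apply, zsmul_eq_mul, mul_comm]
  -- In degree n the coefficients are 1 or 0 according to the end points; all the other terms
  -- already lie in a smaller step.
  have hsplit := Finset.sum_filter_add_sum_filter_not (edgeFamiliesLE m (i + 1) n)
    (fun s => s.degree = n) (fun s => relCoeff n d s • lowOp s • hwVec ((ℓ : ℤ) • fundWeight i))
  rw [hzero] at hsplit
  have h1 : ∑ s ∈ edgeFamiliesLE m (i + 1) n with s.degree = n,
      relCoeff n d s • lowOp s • hwVec ((ℓ : ℤ) • fundWeight i) =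
      ∑ s ∈ edgeFamilies m (i + 1) n with Edge.ends m (i + 1) s = d,
      lowOp s • hwVec ((ℓ : ℤ) • fundWeight i) := by
    have hset : (edgeFamiliesLE m (i + 1) n).filter (fun s => s.degree = n) =
        edgeFamilies m (i + 1) n := by
      ext s
      rw [Finset.mem_filter, mem_edgeFamiliesLE, mem_edgeFamilies]
      omega
    rw [hset, Finset.sum_filter]
    refine Finset.sum_congr rfl fun s hs => ?_
    rw [relCoeff_of_eq d (mem_edgeFamilies.mp hs)]
    split_ifs
    · rw [one_smul]
    · rw [zero_smul]
  rw [← h1, eq_neg_of_add_eq_zero_left hsplit]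
  refine neg_mem (sum_mem fun s hs => zsmul_mem ?_ _)
  rw [Finset.mem_filter, mem_edgeFamiliesLE] at hs
  exact ⟨lowOp s, pbw_mono (by omega) (lowOp_mem_pbw s), rfl⟩

/-- A relation of degree `n` modulo smaller filtration steps is a relation between the coefficients of
the products of minors of linear forms. -/
theorem sum_mul_coeff_eq_zero {n : ℕ} {T : Finset (Edge m (i + 1) →₀ ℕ)}
    (hT : ∀ s ∈ T, s.degree = n) (c : (Edge m (i + 1) →₀ ℕ) → ℤ)
    (h : ∑ s ∈ T, c s • lowOp s • hwVec ((ℓ : ℤ) • fundWeight i) ∈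
      pbwV ((ℓ : ℤ) • fundWeight i) n) {t : Fin ℓ × Fin (i + 1) → Fin (2 * m)}
    (ht : height (i + 1) t = n) :
    ∑ s ∈ T, (c s : ℂ) * coeff s (wedgeVec (Fin ℓ) (chartMat (r := i + 1) i.2 X) t) = 0 := by
  obtain ⟨Θ, hΘ, hΘ1, hΘ2⟩ := exists_realization_topCol i ℓ
  obtain ⟨x, hx, hxw⟩ := h
  have h1 := congrFun (congrArg Θ hxw) t
  -- A coordinate of height n does not see the filtration step of degree below n.
  rw [hΘ1, hΘ2, supportedBelow_of_mem_pbw (supportedBelow_wedgeVec i.2 ℓ) hx le_rfl t ht.ge,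
    map_sum, Finset.sum_apply] at h1
  rw [← h1]
  refine Finset.sum_congr rfl fun s hs => ?_
  rw [map_zsmul, hΘ1, hΘ2, Pi.smul_apply, tensHom_lowOp_apply,
    coeff_wedgeVec_expProd_lowMat _ ((hT s hs).trans ht.symm), zsmul_eq_mul]

end

section

open MvPolynomial

variable {m r : ℕ}

/-! ### The generating function of the Demazure module -/

/-- The symmetric matrix of the values of a function on intervals. -/
def Edge.val {R : Type*} [CommRing R] (z : Edge m r → R) (b c : Fin (2 * m)) : R :=
  if h : r ≤ ((min b c : Fin (2 * m)) : ℕ) ∧ 2 * m ≤ ((max b c : Fin (2 * m)) : ℕ) + r then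
    z ⟨min b c, max b c, h.1, min_le_max, h.2⟩ else 0

theorem Edge.val_comm {R : Type*} [CommRing R] (z : Edge m r → R) (b c : Fin (2 * m)) :
    Edge.val z b c = Edge.val z c b := by
  simp only [Edge.val, min_comm b c, max_comm b c]

theorem Edge.val_lo_hi {R : Type*} [CommRing R] (z : Edge m r → R) (e : Edge m r) :
    Edge.val z e.lo e.hi = z e := by
  have h1 : min e.lo e.hi = e.lo := min_eq_left e.lo_le_hi
  have h2 : max e.lo e.hi = e.hi := max_eq_right e.lo_le_hi
  rw [Edge.val, dif_pos]
  · congr 1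
    exact Edge.ext h1 h2
  · rw [h1, h2]
    exact ⟨e.le_lo, e.le_hi⟩

theorem Edge.val_ofPair {R : Type*} [CommRing R] (hr : r ≤ m) (z : Edge m r → R)
    (b c : Fin (2 * m)) (hb : r ≤ (b : ℕ)) (hc : 2 * m ≤ (c : ℕ) + r) :
    Edge.val z b c = z (Edge.ofPair hr b c hb hc) := by
  rw [← Edge.val_lo_hi z (Edge.ofPair hr b c hb hc)]
  change _ = Edge.val z (min b c) (max b c)
  rcases le_total b c with h | h
  · rw [min_eq_left h, max_eq_right h]
  · rw [min_eq_right h, max_eq_left h, Edge.val_comm]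

theorem Edge.val_of_lt {R : Type*} [CommRing R] (z : Edge m r → R) {b : Fin (2 * m)}
    (c : Fin (2 * m)) (hb : (b : ℕ) < r) : Edge.val z b c = 0 := by
  rw [Edge.val, dif_neg]
  intro h
  have := Fin.le_def.mp (min_le_left b c)
  omega

/-- The matrix with unit columns `δ_j` and columns `δ_{2m+a} + ∑ z_{b, 2m-1-a} δ_b`. -/
def tauChart {R : Type*} [CommRing R] (hr : r ≤ m) (z : Edge m r → R) :
    Matrix (Fin (2 * (2 * m))) (Fin r ⊕ Fin r) R :=
  Matrix.of fun x => Sum.elim (fun j => if (x : ℕ) = j then 1 else 0) fun a =>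
    if h : (x : ℕ) < 2 * m then Edge.val z ⟨x, h⟩ (topCol hr a).rev else
      if (x : ℕ) = 2 * m + a then 1 else 0

theorem tauChart_inl {R : Type*} [CommRing R] (hr : r ≤ m) (z : Edge m r → R)
    (x : Fin (2 * (2 * m))) (j : Fin r) :
    tauChart hr z x (Sum.inl j) = if (x : ℕ) = j then 1 else 0 := rfl

theorem tauChart_inr {R : Type*} [CommRing R] (hr : r ≤ m) (z : Edge m r → R)
    (x : Fin (2 * (2 * m))) (a : Fin r) : tauChart hr z x (Sum.inr a) =
      if h : (x : ℕ) < 2 * m then Edge.val z ⟨x, h⟩ (topCol hr a).rev else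
        if (x : ℕ) = 2 * m + a then 1 else 0 := rfl

theorem le_rev_topCol (hr : r ≤ m) (a : Fin r) : 2 * m ≤ ((topCol hr a).rev : ℕ) + r :=
  le_rev_castLE hr a

/-- The matrix of `e_{φ(α)}` for the root of an interval. -/
def Edge.highMat (e : Edge m r) : Matrix (Fin (2 * (2 * m))) (Fin (2 * (2 * m))) ℂ :=
  rootMat (2 * m) (phi e.root).1.1 (phi e.root).1.2

/-- Both matrices live in the upper right block, with rows below 2m and columns from 2m on. -/
theorem highMat_mul_highMat (e e' : Edge m r) : e.highMat * e'.highMat = 0 := by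
  have h1 := e.lo.2
  have h2 := e.hi.2
  have h3 := e'.lo.2
  have h4 := e'.hi.2
  obtain ⟨h5, h6⟩ := e.val_root
  obtain ⟨h7, h8⟩ := e'.val_root
  unfold Edge.highMat
  apply rootMat_mul_zero <;>
    simp only [phi, ne_eq, Fin.ext_iff, Fin.val_rev, h5, h6, h7, h8] <;> omega

theorem highMat_apply (e : Edge m r) (x y : Fin (2 * (2 * m))) : e.highMat x y =
    if (x : ℕ) = e.lo ∧ (y : ℕ) + e.hi + 1 = 4 * m then 1 else
      if (x : ℕ) = e.hi ∧ (y : ℕ) + e.lo + 1 = 4 * m then 1 else 0 := by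
  have h1 := e.lo.2
  have h2 := e.hi.2
  have h3 := y.2
  obtain ⟨h5, h6⟩ := e.val_root
  have s1 : sgn (2 * m) (phi e.root).1.1 = 1 := by
    rw [sgn, if_pos]
    simp only [phi, h6]
    omega
  have s2 : sgn (2 * m) (phi e.root).1.2 = -1 := by
    rw [sgn, if_neg]
    simp only [phi]
    omega
  rw [Edge.highMat, rootMat, Matrix.of_apply, s1, s2]
  have e1 : (x = (phi e.root).1.1 ∧ y = (phi e.root).1.2) ↔
      ((x : ℕ) = e.lo ∧ (y : ℕ) + e.hi + 1 = 4 * m) := by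
    simp only [phi, Fin.ext_iff, h5, h6]
    omega
  have e2 : (x = (phi e.root).1.2.rev ∧ y = (phi e.root).1.1.rev) ↔
      ((x : ℕ) = e.hi ∧ (y : ℕ) + e.lo + 1 = 4 * m) := by
    simp only [phi, Fin.ext_iff, Fin.val_rev, h5, h6]
    omega
  simp only [e1, e2]
  norm_num

theorem sum_highMat (hr : r ≤ m) {σ : Type*} (z : Edge m r → MvPolynomial σ ℂ)
    (x : Fin (2 * (2 * m))) (a : Fin r) :
    ∑ e, z e * C (e.highMat x (tauCol m r hr (Sum.inr a))) =
      if h : (x : ℕ) < 2 * m then Edge.val z ⟨x, h⟩ (topCol hr a).rev else 0 := by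
  have ha := a.2
  have hcol : ((tauCol m r hr (Sum.inr a) : Fin (2 * (2 * m))) : ℕ) = 2 * m + a := rfl
  have hrev : ((topCol hr a).rev : ℕ) = 2 * m - 1 - a := by
    rw [Fin.val_rev, val_topCol]
    omega
  have hent : ∀ e : Edge m r, e.highMat x (tauCol m r hr (Sum.inr a)) =
      if ∃ h : (x : ℕ) < 2 * m, e.lo = min ⟨x, h⟩ (topCol hr a).rev ∧
        e.hi = max ⟨x, h⟩ (topCol hr a).rev then 1 else 0 := by
    intro e
    have h1 := e.lo.2
    have h2 := e.hi.2
    have h3 := Fin.le_def.mp e.lo_le_hi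
    rw [highMat_apply, hcol]
    by_cases hx : (x : ℕ) < 2 * m
    · have : (∃ h : (x : ℕ) < 2 * m, e.lo = min ⟨x, h⟩ (topCol hr a).rev ∧
          e.hi = max ⟨x, h⟩ (topCol hr a).rev) ↔ ((x : ℕ) = e.lo ∧ 2 * m + (a : ℕ) + e.hi + 1 = 4 * m) ∨
            ((x : ℕ) = e.hi ∧ 2 * m + (a : ℕ) + e.lo + 1 = 4 * m) := by
        rw [exists_prop_of_true hx]
        rcases le_total (⟨x, hx⟩ : Fin (2 * m)) (topCol hr a).rev with h | h
        · rw [min_eq_left h, max_eq_right h, Fin.ext_iff, Fin.ext_iff, hrev]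
          rw [Fin.le_def, hrev] at h
          simp only at h ⊢
          omega
        · rw [min_eq_right h, max_eq_left h, Fin.ext_iff, Fin.ext_iff, hrev]
          rw [Fin.le_def, hrev] at h
          simp only at h ⊢
          omega
      rw [if_congr this rfl rfl]
      split_ifs <;> first | rfl | (exfalso; omega)
    · rw [if_neg (by omega), if_neg (by omega), if_neg fun h => hx h.1]
  simp only [hent]
  by_cases hx : (x : ℕ) < 2 * m
  · rw [dif_pos hx, Edge.val]
    split_ifs with h
    · rw [Finset.sum_eq_single ⟨min ⟨x, hx⟩ (topCol hr a).rev, max ⟨x, hx⟩ (topCol hr a).rev, h.1,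
        min_le_max, h.2⟩]
      · rw [if_pos ⟨hx, rfl, rfl⟩, C_1, mul_one]
      · intro e _ he
        rw [if_neg, C_0, mul_zero]
        rintro ⟨_, h1, h2⟩
        exact he (Edge.ext h1 h2)
      · intro h0
        exact absurd (Finset.mem_univ _) h0
    · refine Finset.sum_eq_zero fun e _ => ?_
      rw [if_neg, C_0, mul_zero]
      rintro ⟨_, h1, h2⟩
      rw [← h1, ← h2] at h
      exact h ⟨e.le_lo, e.le_hi⟩
  · rw [dif_neg hx]
    refine Finset.sum_eq_zero fun e _ => ?_
    rw [if_neg fun h => hx h.1, C_0, mul_zero]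

theorem map_edgeList_sum_eq {A : Type*} [AddCommMonoid A] (g : Edge m r → A) :
    ((edgeList m r).map g).sum = ∑ e, g e := by
  have h : (edgeList m r).toFinset = Finset.univ := by
    ext e
    simp [mem_edgeList]
  rw [← List.sum_toFinset _ nodup_edgeList, h]

/-- The generating function for the root vectors `e_{φ(α)}`. -/
theorem expProd_highMat (hr : r ≤ m) {σ : Type*} (f : Edge m r → σ)
    {Y : σ → Matrix (Fin (2 * (2 * m))) (Fin (2 * (2 * m))) ℂ} (hY : ∀ e, Y (f e) = e.highMat) :
    expProd Y ((edgeList m r).map f) * constMat σ (colMat ℂ (tauCol m r hr)) =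
      tauChart hr fun e => X (f e) := by
  have hcol : constMat σ (colMat ℂ (tauCol m r hr)) =
      colMat (MvPolynomial σ ℂ) (tauCol m r hr) := by
    ext x a
    rw [constMat_apply, colMat, colMat, Matrix.of_apply, Matrix.of_apply]
    split_ifs <;> simp
  rw [expProd_of_mul_eq_zero, List.map_map, map_edgeList_sum_eq, hcol]
  swap
  · intro a ha b hb
    obtain ⟨e, -, rfl⟩ := List.mem_map.mp ha
    obtain ⟨e', -, rfl⟩ := List.mem_map.mp hb
    rw [hY, hY, highMat_mul_highMat]
  ext1 x c
  rw [mul_colMat, Matrix.add_apply, Matrix.sum_apply]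
  have hent : ∀ y, ∑ e : Edge m r, ((fun a => (X a : MvPolynomial σ ℂ) • constMat σ (Y a)) ∘ f) e x y =
      ∑ e : Edge m r, X (f e) * C (e.highMat x y) := by
    intro y
    refine Finset.sum_congr rfl fun e _ => ?_
    rw [Function.comp_apply, Matrix.smul_apply, constMat_apply, hY, smul_eq_mul]
  rw [hent, Matrix.one_apply]
  rcases c with j | a
  · have hj := j.2
    have hcol : ((tauCol m r hr (Sum.inl j) : Fin (2 * (2 * m))) : ℕ) = j := rfl
    rw [tauChart_inl, Finset.sum_eq_zero, add_zero]
    · exact if_congr (by rw [Fin.ext_iff, hcol]) rfl rfl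
    intro e _
    have h1 := e.lo.2
    have h2 := e.hi.2
    rw [highMat_apply, hcol, if_neg (by omega), if_neg (by omega), C_0, mul_zero]
  · have hcol : ((tauCol m r hr (Sum.inr a) : Fin (2 * (2 * m))) : ℕ) = 2 * m + a := rfl
    rw [tauChart_inr, sum_highMat, if_congr (show _ ↔ (x : ℕ) = 2 * m + a by rw [Fin.ext_iff, hcol])
      rfl rfl]
    by_cases hx : (x : ℕ) < 2 * m
    · rw [dif_pos hx, dif_pos hx, if_neg (by omega), zero_add]
    · rw [dif_neg hx, dif_neg hx, add_zero]

/-! #### Minors -/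

theorem chartMat_eq_val {R : Type*} [CommRing R] (hr : r ≤ m) (z : Edge m r → R)
    {b : Fin (2 * m)} (hb : r ≤ (b : ℕ)) (a : Fin r) :
    chartMat hr z b a = Edge.val z b (topCol hr a).rev := by
  rw [chartMat_of_le hr z hb, Edge.val_ofPair hr z b _ hb (le_rev_topCol hr a)]
  rfl

/-- Every product of minors of the affine chart is a product of minors of the larger matrix. -/
theorem exists_wedgeVec_tauChart_eq {R : Type*} [CommRing R] (hr : r ≤ m) (z : Edge m r → R) {ℓ : ℕ}
    (t : Fin ℓ × Fin r → Fin (2 * m)) :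
    ∃ t' : Fin ℓ × (Fin r ⊕ Fin r) → Fin (2 * (2 * m)),
      wedgeVec (Fin ℓ) (tauChart hr z) t' = wedgeVec (Fin ℓ) (chartMat hr z) t := by
  -- The first r rows take care of the unit columns. A row of the chart from r on is kept, and a
  -- unit row is replaced by its copy shifted by 2m; the selected matrix becomes block diagonal.
  refine ⟨fun p => Sum.elim (fun j : Fin r => (⟨j, by omega⟩ : Fin (2 * (2 * m)))) (fun k =>
    if r ≤ (t (p.1, k) : ℕ) then ⟨t (p.1, k), by omega⟩ else ⟨2 * m + t (p.1, k), by omega⟩) p.2, ?_⟩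
  refine Finset.prod_congr rfl fun j _ => ?_
  have hblock : (tauChart hr z).submatrix (fun k : Fin r ⊕ Fin r =>
      Sum.elim (fun j : Fin r => (⟨j, by omega⟩ : Fin (2 * (2 * m)))) (fun k : Fin r =>
        if r ≤ (t (j, k) : ℕ) then ⟨t (j, k), by omega⟩ else ⟨2 * m + t (j, k), by omega⟩) k) id =
      Matrix.fromBlocks 1 0 0 ((chartMat hr z).submatrix (fun k => t (j, k)) id) := by
    ext x c
    rcases x with x | x <;> rcases c with c | c
    · rw [Matrix.submatrix_apply, Matrix.fromBlocks_apply₁₁, Matrix.one_apply, id_eq, tauChart_inl]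
      refine if_congr ?_ rfl rfl
      rw [Fin.ext_iff]
      rfl
    · rw [Matrix.submatrix_apply, Matrix.fromBlocks_apply₁₂, id_eq, tauChart_inr,
        dif_pos (by simp only [Sum.elim_inl]; omega)]
      exact Edge.val_of_lt z _ x.2
    · have hc := c.2
      rw [Matrix.submatrix_apply, Matrix.fromBlocks_apply₂₁, id_eq, tauChart_inl, if_neg,
        Matrix.zero_apply]
      simp only [Sum.elim_inr]
      split_ifs <;> simp only <;> omega
    · rw [Matrix.submatrix_apply, Matrix.fromBlocks_apply₂₂, id_eq, tauChart_inr,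
        Matrix.submatrix_apply, id_eq]
      simp only [Sum.elim_inr]
      by_cases h : r ≤ (t (j, x) : ℕ)
      · simp only [if_pos h]
        rw [dif_pos (t (j, x)).2, chartMat_eq_val hr z h]
      · simp only [if_neg h]
        rw [dif_neg (by omega), chartMat_of_lt hr z (not_le.mp h)]
        simp only [Nat.add_left_cancel_iff]
  refine (congrArg Matrix.det hblock).trans ?_
  rw [Matrix.det_fromBlocks_zero₂₁, Matrix.det_one, one_mul]

/-- Unless all of the first r rows are selected, some unit column vanishes. Otherwise a permutation
of the rows, the source of the sign, brings them to the front and makes the matrix block triangular,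
leaving a minor of size r. -/
theorem exists_det_tauChart_eq {R : Type*} [CommRing R] (hr : r ≤ m) (z : Edge m r → R)
    (t' : Fin r ⊕ Fin r → Fin (2 * (2 * m))) : ∃ (ε : ℤ) (t : Fin r → Fin (2 * m)),
      ((tauChart hr z).submatrix t' id).det = ε * ((chartMat hr z).submatrix t id).det := by
  have hzero : ((tauChart hr z).submatrix t' id).det = 0 → ∃ (ε : ℤ) (t : Fin r → Fin (2 * m)),
      ((tauChart hr z).submatrix t' id).det = ε * ((chartMat hr z).submatrix t id).det := fun h =>
    ⟨0, topCol hr, by rw [h, Int.cast_zero, zero_mul]⟩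
  by_cases h : ∃ j : Fin r, ∀ k, (t' k : ℕ) ≠ j
  · obtain ⟨j, hj⟩ := h
    refine hzero (Matrix.det_eq_zero_of_column_eq_zero (Sum.inl j) fun k => ?_)
    rw [Matrix.submatrix_apply, id_eq, tauChart_inl, if_neg (hj k)]
  push Not at h
  choose k hk using h
  have hkinj : Function.Injective k := fun a b hab => Fin.ext (by rw [← hk a, ← hk b, hab])
  classical
  let E : {x // x ∈ Set.range (Sum.inl : Fin r → Fin r ⊕ Fin r)} ≃ {x // x ∈ Set.range k} :=
    (Equiv.ofInjective _ Sum.inl_injective).symm.trans (Equiv.ofInjective k hkinj)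
  have hE : ∀ j, E.extendSubtype (Sum.inl j) = k j := by
    intro j
    rw [Equiv.extendSubtype_apply_of_mem _ _ ⟨j, rfl⟩]
    have : (Equiv.ofInjective _ Sum.inl_injective).symm
        (⟨Sum.inl j, ⟨j, rfl⟩⟩ : Set.range (Sum.inl : Fin r → Fin r ⊕ Fin r)) = j := by
      rw [Equiv.symm_apply_eq]
      rfl
    change (Equiv.ofInjective k hkinj ((Equiv.ofInjective _ Sum.inl_injective).symm _) : Fin r ⊕ Fin r) = _
    rw [this]
    rfl
  set e := E.extendSubtype with he
  have hdet : ((tauChart hr z).submatrix t' id).det =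
      ((Equiv.Perm.sign e : ℤ) : R) * ((tauChart hr z).submatrix (fun x => t' (e x)) id).det := by
    have h1 := Matrix.det_permute e ((tauChart hr z).submatrix t' id)
    have h2 : ((Equiv.Perm.sign e : ℤ) : R) * ((Equiv.Perm.sign e : ℤ) : R) = 1 := by
      rw [← Int.cast_mul]
      rcases Int.units_eq_one_or (Equiv.Perm.sign e) with h | h <;> rw [h] <;> simp
    change ((tauChart hr z).submatrix (fun x => t' (e x)) id).det = _ at h1
    rw [h1]
    generalize ((tauChart hr z).submatrix t' id).det = δ
    linear_combination (-δ) * h2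
  set y : Fin r → Fin (2 * (2 * m)) := fun a => t' (e (Sum.inr a)) with hy
  have hblock : (tauChart hr z).submatrix (fun x => t' (e x)) id = Matrix.fromBlocks 1 0
      (Matrix.of fun a j => tauChart hr z (y a) (Sum.inl j))
      (Matrix.of fun a b => tauChart hr z (y a) (Sum.inr b)) := by
    ext x c
    rcases x with x | x <;> rcases c with c | c
    · rw [Matrix.submatrix_apply, Matrix.fromBlocks_apply₁₁, Matrix.one_apply, id_eq, tauChart_inl,
        hE, hk]
      exact if_congr Fin.ext_iff.symm rfl rfl
    · rw [Matrix.submatrix_apply, Matrix.fromBlocks_apply₁₂, id_eq, tauChart_inr, hE,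
        dif_pos (by rw [hk]; omega)]
      exact Edge.val_of_lt z _ (by simp only [hk]; exact x.2)
    · rfl
    · rfl
  rw [hblock, Matrix.det_fromBlocks_zero₁₂, Matrix.det_one, one_mul] at hdet
  -- Such a remaining row vanishes in the last r columns. All other rows are rows of the chart,
  -- those from 2m on being its unit rows.
  by_cases hrow : ∃ a, (y a : ℕ) < r ∨ 2 * m + r ≤ (y a : ℕ)
  · obtain ⟨a, ha⟩ := hrow
    refine hzero ?_
    rw [hdet, Matrix.det_eq_zero_of_row_eq_zero a fun b => ?_, mul_zero]
    have hb := b.2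
    rw [Matrix.of_apply, tauChart_inr]
    rcases ha with ha | ha
    · rw [dif_pos (by omega)]
      exact Edge.val_of_lt z _ ha
    · rw [dif_neg (by omega), if_neg (by omega)]
  · push Not at hrow
    refine ⟨Equiv.Perm.sign e, fun a => ⟨if (y a : ℕ) < 2 * m then y a else y a - 2 * m, by
      have := hrow a
      split_ifs <;> omega⟩, ?_⟩
    rw [hdet]
    congr 2
    ext a b
    have hya := hrow a
    rw [Matrix.of_apply, Matrix.submatrix_apply, id_eq, tauChart_inr]
    by_cases h : (y a : ℕ) < 2 * m
    · simp only [if_pos h]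
      rw [dif_pos h, chartMat_eq_val hr z hya.1]
    · simp only [if_neg h]
      rw [dif_neg h, chartMat_of_lt hr z (by simp only; omega)]
      refine if_congr ?_ rfl rfl
      simp only
      omega

/-- Every product of minors of the larger matrix is a multiple of a product of minors of the affine
chart. -/
theorem exists_wedgeVec_chartMat_eq {R : Type*} [CommRing R] (hr : r ≤ m) (z : Edge m r → R) {ℓ : ℕ}
    (t' : Fin ℓ × (Fin r ⊕ Fin r) → Fin (2 * (2 * m))) :
    ∃ (ε : ℤ) (t : Fin ℓ × Fin r → Fin (2 * m)),
      wedgeVec (Fin ℓ) (tauChart hr z) t' = ε * wedgeVec (Fin ℓ) (chartMat hr z) t := by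
  choose ε t ht using fun j => exists_det_tauChart_eq hr z fun k => t' (j, k)
  refine ⟨∏ j, ε j, fun p => t p.1 p.2, ?_⟩
  rw [wedgeVec, wedgeVec, Int.cast_prod, ← Finset.prod_mul_distrib]
  exact Finset.prod_congr rfl fun j _ => ht j

end

section

open MvPolynomial

variable {m r : ℕ}

/-! ### The action of the Borel subalgebra on the generating function -/

/-- The product of the divided powers `e_{φ(α)}^{(s_α)}`. -/
def highOp (s : Edge m r →₀ ℕ) : U (2 * m) :=
  ((edgeList m r).map fun e => divPow (eVec (phi e.root)) (s e)).prod

theorem tensHom_highOp (P : Type*) [Fintype P] [DecidableEq P] (s : Edge m r →₀ ℕ) :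
    tensHom P (2 * m) (highOp s) =
      ((edgeList m r).map fun e => divPow (tensAct P e.highMat) (s e)).prod := by
  rw [highOp, map_list_prod, List.map_map]
  congr 1
  refine List.map_congr_left fun e _ => ?_
  rw [Function.comp_apply, map_divPow, tensHom_eVec]
  rfl

/-- The extremal vector in the realization. -/
def tauVec (hr : r ≤ m) (ℓ : ℕ) : (Fin ℓ × (Fin r ⊕ Fin r) → Fin (2 * (2 * m))) → ℂ :=
  wedgeVec (Fin ℓ) (colMat ℂ (tauCol m r hr))

theorem tensHom_highOp_apply (hr : r ≤ m) (ℓ : ℕ) (s : Edge m r →₀ ℕ)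
    (t : Fin ℓ × (Fin r ⊕ Fin r) → Fin (2 * (2 * m))) :
    tensHom (Fin ℓ × (Fin r ⊕ Fin r)) (2 * m) (highOp s) (tauVec hr ℓ) t =
      coeff s (wedgeVec (Fin ℓ) (tauChart hr X) t) := by
  have h := expProd_highMat hr (id : Edge m r → Edge m r) (Y := Edge.highMat) fun _ => rfl
  rw [List.map_id] at h
  rw [tensHom_highOp, tauVec, ← coeff_wedgeVec_expProd (J := Fin ℓ) (colMat ℂ (tauCol m r hr))
    (fun e _ => highMat_mul_highMat e e) nodup_edgeList s fun e he => absurd (mem_edgeList e) he, h]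
  rfl

/-! #### Shears -/

section Shear

variable {R : Type*} [CommRing R]

/-- The effect on the coordinates of adding `τ` times the row `q` to the row `p`. -/
def Edge.shear (p q : Fin (2 * m)) (τ : R) (z : Edge m r → R) (e : Edge m r) : R :=
  Edge.val z e.lo e.hi + (if e.lo = p then τ * Edge.val z q e.hi else 0) +
    (if e.hi = p then τ * Edge.val z e.lo q else 0) +
      if e.lo = p ∧ e.hi = p then τ * τ * Edge.val z q q else 0

theorem Edge.map_val {R' : Type*} [CommRing R'] (g : R →+* R') (z : Edge m r → R)
    (b c : Fin (2 * m)) : g (Edge.val z b c) = Edge.val (fun e => g (z e)) b c := by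
  rw [Edge.val, Edge.val]
  split_ifs
  · rfl
  · exact map_zero g

theorem Edge.map_shear {R' : Type*} [CommRing R'] (g : R →+* R') (p q : Fin (2 * m)) (τ : R)
    (z : Edge m r → R) (e : Edge m r) :
    g (Edge.shear p q τ z e) = Edge.shear p q (g τ) (fun e => g (z e)) e := by
  simp only [Edge.shear, map_add, Edge.map_val, apply_ite g, map_mul, map_zero]

theorem map_tauChart {R' : Type*} [CommRing R'] (hr : r ≤ m) (g : R →+* R') (z : Edge m r → R) :
    (tauChart hr z).map g = tauChart hr fun e => g (z e) := by
  ext x c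
  rcases c with j | a
  · rw [Matrix.map_apply, tauChart_inl, tauChart_inl, apply_ite g, map_one, map_zero]
  · rw [Matrix.map_apply, tauChart_inr, tauChart_inr]
    split_ifs
    · exact Edge.map_val g z _ _
    · exact map_one g
    · exact map_zero g

theorem Edge.val_shear (hr : r ≤ m) (p q : Fin (2 * m)) (τ : R) (z : Edge m r → R)
    (b c : Fin (2 * m)) (hb : r ≤ (b : ℕ)) (hc : 2 * m ≤ (c : ℕ) + r) :
    Edge.val (Edge.shear p q τ z) b c = Edge.val z b c + (if b = p then τ * Edge.val z q c else 0) +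
      (if c = p then τ * Edge.val z b q else 0) +
        if b = p ∧ c = p then τ * τ * Edge.val z q q else 0 := by
  rw [Edge.val_ofPair hr _ b c hb hc, Edge.shear]
  rcases le_total b c with h | h
  · have e1 : (Edge.ofPair hr b c hb hc).lo = b := min_eq_left h
    have e2 : (Edge.ofPair hr b c hb hc).hi = c := max_eq_right h
    rw [e1, e2]
  · have e1 : (Edge.ofPair hr b c hb hc).lo = c := min_eq_right h
    have e2 : (Edge.ofPair hr b c hb hc).hi = b := max_eq_left h
    rw [e1, e2, Edge.val_comm z c b, Edge.val_comm z q b, Edge.val_comm z c q, if_congr and_comm rfl rfl]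
    ring

/-- The matrix of the shear on the columns. -/
def shearMat (hr : r ≤ m) (p q : Fin (2 * m)) (τ : R) (z : Edge m r → R) :
    Matrix (Fin r ⊕ Fin r) (Fin r ⊕ Fin r) R :=
  Matrix.fromBlocks
    (Matrix.of fun j' j => (if j' = j then 1 else 0) +
      if (j' : ℕ) = p ∧ (j : ℕ) = q then τ else 0)
    (Matrix.of fun j a => if (j : ℕ) = p then τ * Edge.val z q (topCol hr a).rev else 0) 0
    (Matrix.of fun a' a => (if a' = a then 1 else 0) -
      if (a' : ℕ) + q + 1 = 2 * m ∧ (a : ℕ) + p + 1 = 2 * m then τ else 0)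

theorem det_of_unitriangular {r : ℕ} {M : Matrix (Fin r) (Fin r) R} (h1 : ∀ j, M j j = 1)
    (h0 : ∀ j k, k < j → M j k = 0) : M.det = 1 := by
  rw [Matrix.det_of_isUpperTriangular (fun j k h => h0 j k h), Finset.prod_eq_one fun j _ => h1 j]

theorem det_shearMat (hr : r ≤ m) {p q : Fin (2 * m)} (hpq : p < q) (τ : R) (z : Edge m r → R) :
    (shearMat hr p q τ z).det = 1 := by
  rw [Fin.lt_def] at hpq
  rw [shearMat, Matrix.det_fromBlocks_zero₂₁, det_of_unitriangular, det_of_unitriangular, mul_one]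
  · intro j
    rw [Matrix.of_apply, if_pos rfl, if_neg (by omega), sub_zero]
  · intro j k hjk
    rw [Fin.lt_def] at hjk
    rw [Matrix.of_apply, if_neg (by rw [Fin.ext_iff]; omega), if_neg (by omega), sub_zero]
  · intro j
    rw [Matrix.of_apply, if_pos rfl, if_neg (by omega), add_zero]
  · intro j k hjk
    rw [Fin.lt_def] at hjk
    rw [Matrix.of_apply, if_neg (by rw [Fin.ext_iff]; omega), if_neg (by omega), add_zero]

theorem sum_ite_val (x : ℕ) (f : Fin r → R) :
    ∑ j : Fin r, (if x = (j : ℕ) then 1 else 0) * f j = if h : x < r then f ⟨x, h⟩ else 0 := by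
  split_ifs with h
  · rw [Finset.sum_eq_single ⟨x, h⟩]
    · rw [if_pos rfl, one_mul]
    · intro j _ hj
      rw [if_neg fun h' => hj (Fin.ext h'.symm), zero_mul]
    · intro h'
      exact absurd (Finset.mem_univ _) h'
  · refine Finset.sum_eq_zero fun j _ => ?_
    have := j.2
    rw [if_neg (by omega), zero_mul]

/-- A Levi element g acts on the symmetric coordinate block Z by Z ↦ g Z gᵀ, which is `Edge.shear`.
The right factor returns the columns to normal form: its diagonal blocks undo the action on the two
sets of unit columns, and its upper right block removes what lands in rows below r. -/
theorem one_add_smul_mul_tauChart (hr : r ≤ m) {p q : Fin (2 * m)} (hpq : p < q) (τ : R)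
    (z : Edge m r → R) {G : Matrix (Fin (2 * (2 * m))) (Fin (2 * (2 * m))) R}
    (hG : ∀ x y, G x y = if (x : ℕ) = p ∧ (y : ℕ) = q then 1 else
      if (x : ℕ) + q + 1 = 4 * m ∧ (y : ℕ) + p + 1 = 4 * m then -1 else 0) :
    (1 + τ • G) * tauChart hr z = tauChart hr (Edge.shear p q τ z) * shearMat hr p q τ z := by
  have hp := p.2
  have hq := q.2
  have hpq' := Fin.lt_def.mp hpq
  have hGT : ∀ (x : Fin (2 * (2 * m))) c, (G * tauChart hr z) x c =
      (if (x : ℕ) = p then tauChart hr z ⟨q, by omega⟩ c else 0) -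
        if (x : ℕ) + q + 1 = 4 * m then tauChart hr z ⟨4 * m - 1 - p, by omega⟩ c else 0 := by
    intro x c
    rw [Matrix.mul_apply]
    by_cases h1 : (x : ℕ) = p
    · rw [if_pos h1, if_neg (by omega), sub_zero, Finset.sum_eq_single ⟨q, by omega⟩]
      · rw [hG, if_pos ⟨h1, rfl⟩, one_mul]
      · intro y _ hy
        rw [hG, if_neg fun h => hy (Fin.ext h.2), if_neg (by omega), zero_mul]
      · intro h
        exact absurd (Finset.mem_univ _) h
    · rw [if_neg h1, zero_sub]
      split_ifs with h2
      · rw [Finset.sum_eq_single ⟨4 * m - 1 - p, by omega⟩]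
        · rw [hG, if_neg (by omega), if_pos ⟨h2, by simp only; omega⟩, neg_mul, one_mul]
        · intro y _ hy
          rw [hG, if_neg (by omega), if_neg, zero_mul]
          rintro ⟨_, h⟩
          exact hy (Fin.ext (by simp only; omega))
        · intro h
          exact absurd (Finset.mem_univ _) h
      · rw [neg_zero]
        refine Finset.sum_eq_zero fun y _ => ?_
        rw [hG, if_neg (by omega), if_neg (by omega), zero_mul]
  rw [Matrix.add_mul, Matrix.one_mul, Matrix.smul_mul]
  ext1 x c
  rw [Matrix.add_apply, Matrix.smul_apply, hGT, smul_eq_mul, Matrix.mul_apply,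
    Fintype.sum_sum_type]
  rcases c with j | a
  · have hj := j.2
    simp only [tauChart_inl, shearMat, Matrix.fromBlocks_apply₁₁, Matrix.fromBlocks_apply₂₁,
      Matrix.zero_apply, mul_zero, Finset.sum_const_zero, add_zero]
    rw [sum_ite_val, if_neg (show ¬ 4 * m - 1 - (p : ℕ) = j by omega), ite_self, sub_zero]
    by_cases hx : (x : ℕ) < r
    · rw [dif_pos hx, Matrix.of_apply]
      congr 1
      · exact if_congr (by rw [Fin.ext_iff]) rfl rfl
      · by_cases h1 : (x : ℕ) = p
        · by_cases h2 : (q : ℕ) = j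
          · rw [if_pos h1, if_pos h2, if_pos ⟨h1, h2.symm⟩, mul_one]
          · rw [if_pos h1, if_neg h2, if_neg fun h => h2 h.2.symm, mul_zero]
        · rw [if_neg h1, if_neg fun h => h1 h.1, mul_zero]
    · rw [dif_neg hx, if_neg (by omega), zero_add]
      by_cases h1 : (x : ℕ) = p
      · rw [if_pos h1, if_neg (by omega), mul_zero]
      · rw [if_neg h1, mul_zero]
  · have ha := a.2
    have hrev : ((topCol hr a).rev : ℕ) = 2 * m - 1 - a := by
      rw [Fin.val_rev, val_topCol]
      omega
    have hcol : ∑ a', tauChart hr (Edge.shear p q τ z) x (Sum.inr a') *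
        shearMat hr p q τ z (Sum.inr a') (Sum.inr a) =
        tauChart hr (Edge.shear p q τ z) x (Sum.inr a) -
          if h : (a : ℕ) + p + 1 = 2 * m then
            τ * tauChart hr (Edge.shear p q τ z) x (Sum.inr ⟨2 * m - 1 - q, by omega⟩) else 0 := by
      simp only [shearMat, Matrix.fromBlocks_apply₂₂, Matrix.of_apply, mul_sub,
        Finset.sum_sub_distrib, mul_ite, mul_one, mul_zero, Finset.sum_ite_eq', Finset.mem_univ,
        if_true]
      congr 1
      split_ifs with h
      · rw [Finset.sum_eq_single ⟨2 * m - 1 - q, by omega⟩]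
        · rw [if_pos ⟨by simp only; omega, h⟩, mul_comm]
        · intro a' _ ha'
          rw [if_neg]
          rintro ⟨h', _⟩
          exact ha' (Fin.ext (by simp only; omega))
        · intro h'
          exact absurd (Finset.mem_univ _) h'
      · exact Finset.sum_eq_zero fun a' _ => if_neg fun h' => h h'.2
    have hcol' : ∑ j, tauChart hr (Edge.shear p q τ z) x (Sum.inl j) *
        shearMat hr p q τ z (Sum.inl j) (Sum.inr a) =
        if (x : ℕ) < r ∧ (x : ℕ) = p then τ * Edge.val z q (topCol hr a).rev else 0 := by
      simp only [tauChart_inl, shearMat, Matrix.fromBlocks_apply₁₂, Matrix.of_apply]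
      rw [sum_ite_val]
      by_cases h1 : (x : ℕ) < r
      · rw [dif_pos h1]
        simp only [h1, true_and]
      · rw [dif_neg h1, if_neg fun h => h1 h.1]
    have hTq : tauChart hr z ⟨q, by omega⟩ (Sum.inr a) = Edge.val z q (topCol hr a).rev := by
      rw [tauChart_inr, dif_pos hq]
    have hTp : tauChart hr z ⟨4 * m - 1 - p, by omega⟩ (Sum.inr a) =
        if (a : ℕ) + p + 1 = 2 * m then 1 else 0 := by
      rw [tauChart_inr, dif_neg (by simp only; omega)]
      refine if_congr ?_ rfl rfl
      simp only
      omega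
    rw [hcol, hcol', hTq, hTp]
    by_cases hx : (x : ℕ) < 2 * m
    · rw [if_neg (show ¬ (x : ℕ) + q + 1 = 4 * m by omega), sub_zero]
      simp only [tauChart_inr, dif_pos hx]
      -- In the rows below r the coordinate block is zero, so the new entry must come entirely from
      -- the unit columns through the upper right block of `shearMat`.
      by_cases hxr : (x : ℕ) < r
      · have h0 : ∀ (z : Edge m r → R) c, Edge.val z ⟨x, hx⟩ c = 0 := fun z c =>
          Edge.val_of_lt z c hxr
        simp only [h0, mul_zero, zero_add, zero_sub, hxr, true_and]
        simp
      · have hxr' : r ≤ (x : ℕ) := not_lt.mp hxr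
        have hxp : ((⟨x, hx⟩ : Fin (2 * m)) = p) ↔ (x : ℕ) = p := Fin.ext_iff
        have hap : ((topCol hr a).rev = p) ↔ (a : ℕ) + p + 1 = 2 * m := by
          rw [Fin.ext_iff, hrev]
          omega
        rw [if_neg (show ¬ ((x : ℕ) < r ∧ (x : ℕ) = p) from fun h => hxr h.1), zero_add,
          Edge.val_shear hr p q τ z ⟨x, hx⟩ _ hxr' (le_rev_topCol hr a)]
        simp only [hxp, hap]
        by_cases hA : (a : ℕ) + p + 1 = 2 * m
        · have hrq : (topCol hr ⟨2 * m - 1 - q, by omega⟩).rev = q := by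
            rw [Fin.ext_iff, Fin.val_rev, val_topCol]
            simp only
            omega
          rw [dif_pos hA, hrq, Edge.val_shear hr p q τ z ⟨x, hx⟩ q hxr' (by omega), if_pos hA,
            if_neg (show ¬ q = p from hpq.ne'), if_neg (show ¬ (_ ∧ q = p) from fun h => hpq.ne' h.2)]
          simp only [hxp, hA, and_true]
          split_ifs <;> ring
        · rw [dif_neg hA, if_neg hA]
          simp only [hA, and_false, if_false]
          split_ifs <;> ring
    · rw [if_neg (show ¬ (x : ℕ) = p by omega), if_neg (show ¬ ((x : ℕ) < r ∧ (x : ℕ) = p) by omega)]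
      simp only [tauChart_inr, dif_neg hx]
      by_cases hA : (a : ℕ) + p + 1 = 2 * m
      · rw [dif_pos hA, if_pos hA]
        by_cases hB : (x : ℕ) + q + 1 = 4 * m
        · rw [if_pos hB, if_pos (show (x : ℕ) = 2 * m + (2 * m - 1 - q) by omega)]
          ring
        · rw [if_neg hB, if_neg (show ¬ (x : ℕ) = 2 * m + (2 * m - 1 - q) by omega)]
          ring
      · rw [dif_neg hA, if_neg hA, ite_self]
        ring

theorem wedgeVec_mul_tauChart (hr : r ≤ m) {p q : Fin (2 * m)} (hpq : p < q) (τ : R)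
    (z : Edge m r → R) {G : Matrix (Fin (2 * (2 * m))) (Fin (2 * (2 * m))) R}
    (hG : ∀ x y, G x y = if (x : ℕ) = p ∧ (y : ℕ) = q then 1 else
      if (x : ℕ) + q + 1 = 4 * m ∧ (y : ℕ) + p + 1 = 4 * m then -1 else 0)
    {K : Matrix (Fin (2 * (2 * m))) (Fin r ⊕ Fin r) R} (hK : K = (1 + τ • G) * tauChart hr z)
    {J : Type*} [Fintype J] [DecidableEq J] (t : J × (Fin r ⊕ Fin r) → Fin (2 * (2 * m))) :
    wedgeVec J K t = wedgeVec J (tauChart hr (Edge.shear p q τ z)) t := by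
  rw [hK, one_add_smul_mul_tauChart hr hpq τ z hG, wedgeVec_mul, det_shearMat hr hpq, one_pow, one_mul]

end Shear

end

/-! ### Integrality of the Levi action on the generating function -/

section

open MvPolynomial

variable {m r : ℕ}

/-- Substituting integral polynomials acts on coefficients by integers that depend only on the
substitution. As the family is finite, one support serves all t, so a relation between coordinates
becomes one between vectors. -/
theorem exists_int_coeff_eval₂ {T σ σ' : Type*} [Fintype T] (F : T → MvPolynomial σ ℂ)
    (z : σ → MvPolynomial σ' ℤ) (s : σ' →₀ ℕ) : ∃ (S : Finset (σ →₀ ℕ)) (c : (σ →₀ ℕ) → ℤ), ∀ t,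
      coeff s (eval₂Hom (C : ℂ →+* MvPolynomial σ' ℂ)
        (fun e => MvPolynomial.map (Int.castRingHom ℂ) (z e)) (F t)) =
          ∑ u ∈ S, (c u : ℂ) * coeff u (F t) := by
  classical
  refine ⟨Finset.univ.biUnion fun t => (F t).support, fun u => coeff s (u.prod fun e k => z e ^ k),
    fun t => ?_⟩
  have hsub : (F t).support ⊆ Finset.univ.biUnion fun t => (F t).support :=
    Finset.subset_biUnion_of_mem (fun t => (F t).support) (Finset.mem_univ t)
  rw [← Finset.sum_subset hsub]
  · conv_lhs => rw [coe_eval₂Hom, eval₂_eq, coeff_sum]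
    refine Finset.sum_congr rfl fun u _ => ?_
    rw [coeff_C_mul, mul_comm]
    congr 1
    have : (∏ e ∈ u.support, MvPolynomial.map (Int.castRingHom ℂ) (z e) ^ u e) =
        MvPolynomial.map (Int.castRingHom ℂ) (u.prod fun e k => z e ^ k) := by
      rw [Finsupp.prod, map_prod]
      exact Finset.prod_congr rfl fun e _ => (map_pow _ _ _).symm
    rw [this, coeff_map]
    rfl
  · intro u _ hu
    rw [notMem_support_iff.mp hu, mul_zero]

/-- The divided powers of the positive root vectors in the Levi subalgebra preserve the lattice
spanned by the coefficients of the generating function. -/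
theorem exists_int_tensHom_eVec (hr : r ≤ m) (ℓ : ℕ) {γ : PosRoot (2 * m)}
    (hγ : (γ.1.2 : ℕ) < 2 * m) (k : ℕ) (s : Edge m r →₀ ℕ) :
    ∃ (S : Finset (Edge m r →₀ ℕ)) (c : (Edge m r →₀ ℕ) → ℤ),
      tensHom (Fin ℓ × (Fin r ⊕ Fin r)) (2 * m) (divPow (eVec γ) k * highOp s) (tauVec hr ℓ) =
        ∑ u ∈ S, c u • tensHom (Fin ℓ × (Fin r ⊕ Fin r)) (2 * m) (highOp u) (tauVec hr ℓ) := by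
  classical
  have hγ1 := Fin.lt_def.mp γ.2.1
  set p : Fin (2 * m) := ⟨γ.1.1, by omega⟩ with hp
  set q : Fin (2 * m) := ⟨γ.1.2, hγ⟩ with hq
  have hpq : p < q := hγ1
  -- The extra variable `none` stands for e_γ and comes first in the list, so that its divided power
  -- acts last.
  let Y : Option (Edge m r) → Matrix (Fin (2 * (2 * m))) (Fin (2 * (2 * m))) ℂ := fun o =>
    o.elim (rootMat (2 * m) γ.1.1 γ.1.2) Edge.highMat
  let s' : Option (Edge m r) →₀ ℕ := Finsupp.equivFunOnFinite.symm fun o => o.elim k s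
  let L : List (Option (Edge m r)) := none :: (edgeList m r).map some
  have hYL : ∀ a ∈ L, Y a * Y a = 0 := by
    rintro (_ | e) _
    · exact rootMat_sq γ.2.1.ne
    · exact highMat_mul_highMat e e
  have hL : L.Nodup := by
    rw [List.nodup_cons]
    exact ⟨by simp, nodup_edgeList.map (Option.some_injective _)⟩
  have hmem : ∀ a, a ∉ L → s' a = 0 := by
    rintro (_ | e) ha
    · exact absurd (List.mem_cons_self ..) ha
    · exact absurd (List.mem_cons_of_mem _ (List.mem_map_of_mem (mem_edgeList e))) ha
  have hmaster := coeff_wedgeVec_expProd (J := Fin ℓ) (colMat ℂ (tauCol m r hr)) hYL hL s' hmem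
  have hop : tensHom (Fin ℓ × (Fin r ⊕ Fin r)) (2 * m) (divPow (eVec γ) k * highOp s) =
      (L.map fun a => divPow (tensAct (Fin ℓ × (Fin r ⊕ Fin r)) (Y a)) (s' a)).prod := by
    rw [map_mul, tensHom_highOp, map_divPow, tensHom_eVec, List.map_cons, List.prod_cons,
      List.map_map]
    rfl
  have hG : ∀ x y, constMat (Option (Edge m r)) (rootMat (2 * m) γ.1.1 γ.1.2) x y =
      if (x : ℕ) = p ∧ (y : ℕ) = q then 1 else
        if (x : ℕ) + q + 1 = 4 * m ∧ (y : ℕ) + p + 1 = 4 * m then -1 else 0 := by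
    intro x y
    have hx := x.2
    have hy := y.2
    have s1 : sgn (2 * m) γ.1.1 = 1 := if_pos (by omega)
    have s2 : sgn (2 * m) γ.1.2 = 1 := if_pos hγ
    rw [constMat_apply, rootMat, Matrix.of_apply, s1, s2]
    have e1 : (x = γ.1.1 ∧ y = γ.1.2) ↔ ((x : ℕ) = p ∧ (y : ℕ) = q) := by
      rw [Fin.ext_iff, Fin.ext_iff]
    have e2 : (x = γ.1.2.rev ∧ y = γ.1.1.rev) ↔
        ((x : ℕ) + q + 1 = 4 * m ∧ (y : ℕ) + p + 1 = 4 * m) := by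
      rw [Fin.ext_iff, Fin.ext_iff, Fin.val_rev, Fin.val_rev]
      simp only [hp, hq]
      omega
    simp only [e1, e2]
    split_ifs <;> simp
  have hmat := fun t : Fin ℓ × (Fin r ⊕ Fin r) → Fin (2 * (2 * m)) =>
    wedgeVec_mul_tauChart hr hpq (X none) (fun e => X (some e)) hG
      (K := expProd Y L * constMat (Option (Edge m r)) (colMat ℂ (tauCol m r hr)))
      (by rw [← expProd_highMat hr some (Y := Y) fun _ => rfl, ← Matrix.mul_assoc]; rfl) t
  obtain ⟨S, c, hS⟩ := exists_int_coeff_eval₂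
    (fun t : Fin ℓ × (Fin r ⊕ Fin r) → Fin (2 * (2 * m)) => wedgeVec (Fin ℓ)
      (tauChart hr (X : Edge m r → MvPolynomial (Edge m r) ℂ)) t)
    (Edge.shear p q (X none : MvPolynomial (Option (Edge m r)) ℤ) fun e => X (some e)) s'
  refine ⟨S, c, ?_⟩
  rw [hop, tauVec, ← hmaster]
  ext t
  rw [Finset.sum_apply, hmat]
  have hz : tauChart hr (Edge.shear p q (X none : MvPolynomial (Option (Edge m r)) ℂ)
      fun e => X (some e)) = (tauChart hr (X : Edge m r → MvPolynomial (Edge m r) ℂ)).map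
        (eval₂Hom (C : ℂ →+* MvPolynomial (Option (Edge m r)) ℂ)
        (fun e => MvPolynomial.map (Int.castRingHom ℂ) (Edge.shear p q
          (X none : MvPolynomial (Option (Edge m r)) ℤ) (fun e => X (some e)) e))) := by
    rw [map_tauChart]
    congr 1
    ext1 e
    rw [eval₂Hom_X', Edge.map_shear]
    simp only [map_X]
  rw [hz, wedgeVec_map, hS]
  refine Finset.sum_congr rfl fun u _ => ?_
  rw [Pi.smul_apply, zsmul_eq_mul, ← tensHom_highOp_apply]
  rfl

/-! ### Root vectors that annihilate the generators -/

/-- The root vectors `e_γ` with `γ` in the upper right block, other than those attached to intervals,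
annihilate the extremal vector. -/
theorem tensHom_eVec_tauVec (hr : r ≤ m) (ℓ : ℕ) {γ : PosRoot (2 * m)}
    (h2 : 2 * m ≤ (γ.1.2 : ℕ)) (hγ : ¬ ((γ.1.2 : ℕ) < 2 * m + r ∧ r ≤ (γ.1.1 : ℕ))) :
    tensHom (Fin ℓ × (Fin r ⊕ Fin r)) (2 * m) (eVec γ) (tauVec hr ℓ) = 0 := by
  have h3 := γ.2.2
  -- On the columns of the extremal vector the root vector can only turn a column of the second kind
  -- into one of the first. It thus preserves their span with trace zero.
  let B : Matrix (Fin r ⊕ Fin r) (Fin r ⊕ Fin r) ℂ := Matrix.fromBlocks 0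
    (Matrix.of fun j a => if (j : ℕ) = γ.1.1 ∧ 2 * m + (a : ℕ) = γ.1.2 then 1 else 0) 0 0
  have hB : rootMat (2 * m) γ.1.1 γ.1.2 * colMat ℂ (tauCol m r hr) =
      colMat ℂ (tauCol m r hr) * B := by
    ext x c
    rw [mul_colMat, Matrix.mul_apply, Fintype.sum_sum_type, rootMat, Matrix.of_apply]
    rcases c with j | a
    · have hj := j.2
      have hcol : ((tauCol m r hr (Sum.inl j) : Fin (2 * (2 * m))) : ℕ) = j := rfl
      rw [if_neg, if_neg]
      · simp [B]
      · rintro ⟨_, h⟩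
        rw [Fin.ext_iff, hcol, Fin.val_rev] at h
        omega
      · rintro ⟨_, h⟩
        rw [Fin.ext_iff, hcol] at h
        omega
    · have ha := a.2
      have hcol : ((tauCol m r hr (Sum.inr a) : Fin (2 * (2 * m))) : ℕ) = 2 * m + a := rfl
      have hcol' : ∀ j, ((tauCol m r hr (Sum.inl j) : Fin (2 * (2 * m))) : ℕ) = j := fun _ => rfl
      -- This entry would force γ to have first index 2m-1-a and second index at most 2m+a, making
      -- it the root of an interval.
      have h4 : ¬ (x = γ.1.2.rev ∧ tauCol m r hr (Sum.inr a) = γ.1.1.rev) := by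
        rintro ⟨_, h⟩
        rw [Fin.ext_iff, hcol, Fin.val_rev] at h
        omega
      simp only [if_neg h4, colMat, Matrix.of_apply, B, Matrix.fromBlocks_apply₁₂,
        Matrix.fromBlocks_apply₂₂, Matrix.zero_apply, mul_zero, Finset.sum_const_zero, add_zero]
      have h5 : ∀ j : Fin r, (if x = tauCol m r hr (Sum.inl j) then (1 : ℂ) else 0) =
          if (x : ℕ) = j then 1 else 0 := fun j =>
        if_congr (by rw [Fin.ext_iff, hcol']) rfl rfl
      simp only [h5]
      rw [sum_ite_val]
      by_cases h : x = γ.1.1 ∧ tauCol m r hr (Sum.inr a) = γ.1.2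
      · have h6 := h.2
        rw [Fin.ext_iff, hcol] at h6
        have h7 := h.1
        rw [Fin.ext_iff] at h7
        rw [if_pos h, dif_pos (show (x : ℕ) < r by omega), if_pos ⟨h7, h6⟩]
      · rw [if_neg h]
        split_ifs with h6 h7
        · exact absurd ⟨Fin.ext h7.1, Fin.ext (hcol.trans h7.2)⟩ h
        · rfl
        · rfl
  have htr : B.trace = 0 := by
    simp [B, Matrix.trace, Matrix.diag_apply, Fintype.sum_sum_type]
  rw [tensHom_eVec, tauVec, tensAct_wedgeVec hB, htr, mul_zero, zero_smul]

/-- The root vectors `f_α`, other than those attached to intervals, annihilate the highest weight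
vector. -/
theorem tensHom_fVec_wedgeVec (hr : r ≤ m) (ℓ : ℕ) {α : PosRoot m}
    (hα : ¬ ((α.1.1 : ℕ) < r ∧ r ≤ (α.1.2 : ℕ))) :
    tensHom (Fin ℓ × Fin r) m (fVec α) (wedgeVec (Fin ℓ) (colMat ℂ (topCol hr))) = 0 := by
  have h3 := α.2.2
  have h4 := Fin.lt_def.mp α.2.1
  -- Either both indices of the root are below r, and the action on the span is nilpotent of trace
  -- zero, or both are at least r and the columns are killed.
  let B : Matrix (Fin r) (Fin r) ℂ :=
    Matrix.of fun j a => if (j : ℕ) = α.1.2 ∧ (a : ℕ) = α.1.1 then 1 else 0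
  have hB : rootMat m α.1.2 α.1.1 * colMat ℂ (topCol hr) = colMat ℂ (topCol hr) * B := by
    ext x a
    have ha := a.2
    rw [mul_colMat, Matrix.mul_apply, rootMat, Matrix.of_apply]
    have h5 : ¬ (x = α.1.1.rev ∧ topCol hr a = α.1.2.rev) := by
      rintro ⟨_, h⟩
      rw [Fin.ext_iff, val_topCol, Fin.val_rev] at h
      omega
    simp only [if_neg h5, colMat, Matrix.of_apply, B]
    have h6 : ∀ j : Fin r, (if x = topCol hr j then (1 : ℂ) else 0) =
        if (x : ℕ) = j then 1 else 0 := fun j =>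
      if_congr (by rw [Fin.ext_iff, val_topCol]) rfl rfl
    simp only [h6]
    rw [sum_ite_val]
    by_cases h : x = α.1.2 ∧ topCol hr a = α.1.1
    · have h8 := h.2
      rw [Fin.ext_iff, val_topCol] at h8
      have h7 := h.1
      rw [Fin.ext_iff] at h7
      rw [if_pos h, dif_pos (show (x : ℕ) < r by omega), if_pos ⟨h7, h8⟩]
    · rw [if_neg h]
      split_ifs with h8 h7
      · exact absurd ⟨Fin.ext h7.1, Fin.ext h7.2⟩ h
      · rfl
      · rfl
  have htr : B.trace = 0 := Finset.sum_eq_zero fun j _ => by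
    rw [Matrix.diag_apply]
    exact if_neg (by omega)
  rw [tensHom_fVec, tensAct_wedgeVec hB, htr, mul_zero, zero_smul]

/-! ### Weights -/

theorem exists_hVec_eq {n : ℕ} (k : Fin n) : ∃ (d : Fin (2 * n) → ℤ)
    (hd : ∀ a : Fin (2 * n), (d a.rev : ℂ) = -(d a : ℂ)),
      hVec k = UniversalEnvelopingAlgebra.ι ℂ (diagVec (fun a => (d a : ℂ)) hd) := by
  have hdiag : ∀ a : Fin (2 * n), rootMat n a a = Matrix.diagonal fun x =>
      (((if x = a then 1 else 0) - (if x = a.rev then 1 else 0) : ℤ) : ℂ) := by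
    intro a
    ext x y
    rw [rootMat_self_apply, Matrix.diagonal_apply]
    push_cast
    rfl
  have hrev : ∀ a x : Fin (2 * n), (((if x.rev = a then 1 else 0) -
      (if x.rev = a.rev then 1 else 0) : ℤ) : ℂ) =
        -((((if x = a then 1 else 0) - (if x = a.rev then 1 else 0) : ℤ)) : ℂ) := by
    intro a x
    have e1 : (x.rev = a) = (x = a.rev) := by rw [Fin.rev_eq_iff]
    simp only [e1, Fin.rev_inj]
    push_cast
    ring
  rcases Nat.lt_or_ge ((k : ℕ) + 1) n with h | h
  · refine ⟨fun x => ((if x = (simpleRoot k).1.1 then 1 else 0) -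
      (if x = (simpleRoot k).1.1.rev then 1 else 0)) - ((if x = (simpleRoot k).1.2 then 1 else 0) -
      (if x = (simpleRoot k).1.2.rev then 1 else 0)), fun x => ?_, ?_⟩
    · rw [Int.cast_sub, hrev, hrev, Int.cast_sub (R := ℂ) (_ - _)]
      ring
    · rw [hVec, lie_simpleRoot_of_lt k h]
      congr 1
      apply Subtype.ext
      change rootMat n _ _ - rootMat n _ _ = Matrix.diagonal _
      rw [hdiag, hdiag, Matrix.diagonal_sub]
      congr 1
      ext x
      rw [Int.cast_sub (R := ℂ) (_ - _)]
  · refine ⟨fun x => (if x = (simpleRoot k).1.1 then 1 else 0) -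
      (if x = (simpleRoot k).1.1.rev then 1 else 0), fun x => hrev _ x, ?_⟩
    rw [hVec, lie_simpleRoot_of_eq k (by omega)]
    congr 1
    apply Subtype.ext
    exact hdiag _

theorem mul_divPow_of_mul_eq {A : Type*} [Ring A] [Algebra ℂ A] {x y : A} {c : ℂ}
    (h : x * y = y * x + c • y) (k : ℕ) :
    x * divPow y k = divPow y k * x + ((k : ℂ) * c) • divPow y k := by
  have key : x * y ^ k = y ^ k * x + ((k : ℂ) * c) • y ^ k := by
    induction k with
    | zero => simp
    | succ k ih =>
      rw [pow_succ, ← mul_assoc, ih, add_mul, mul_assoc, h, mul_add, smul_mul_assoc, mul_smul_comm,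
        ← mul_assoc, add_assoc, ← add_smul]
      congr 2
      push_cast
      ring
  rw [divPow, mul_smul_comm, key, smul_add, smul_mul_assoc, smul_comm]

/-- The vectors `∏ e_{φ(α)}^{(s_α)} v` are weight vectors of integral weight. -/
theorem exists_int_tensHom_hVec (hr : r ≤ m) (ℓ : ℕ) (k : Fin (2 * m)) (s : Edge m r →₀ ℕ) :
    ∃ c : ℤ, tensHom (Fin ℓ × (Fin r ⊕ Fin r)) (2 * m) (hVec k)
      (tensHom (Fin ℓ × (Fin r ⊕ Fin r)) (2 * m) (highOp s) (tauVec hr ℓ)) =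
        (c : ℂ) • tensHom (Fin ℓ × (Fin r ⊕ Fin r)) (2 * m) (highOp s) (tauVec hr ℓ) := by
  obtain ⟨d, hd, hk⟩ := exists_hVec_eq k
  have hcomm : ∀ L : List (Edge m r), ∃ c : ℤ,
      hVec k * (L.map fun e => divPow (eVec (phi e.root)) (s e)).prod =
        (L.map fun e => divPow (eVec (phi e.root)) (s e)).prod * hVec k +
          (c : ℂ) • (L.map fun e => divPow (eVec (phi e.root)) (s e)).prod := by
    intro L
    induction L with
    | nil => exact ⟨0, by simp⟩
    | cons e L ih =>
      obtain ⟨c, hc⟩ := ih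
      have h1 : hVec k * eVec (phi e.root) = eVec (phi e.root) * hVec k +
          (((d (phi e.root).1.1 - d (phi e.root).1.2 : ℤ)) : ℂ) • eVec (phi e.root) := by
        rw [hk]
        push_cast
        exact iota_diagVec_mul_rootU _ hd _ _
      refine ⟨c + s e * (d (phi e.root).1.1 - d (phi e.root).1.2), ?_⟩
      rw [List.map_cons, List.prod_cons, ← mul_assoc, mul_divPow_of_mul_eq h1, add_mul, mul_assoc, hc,
        mul_add, mul_smul_comm, smul_mul_assoc, mul_assoc, add_assoc, ← add_smul]
      push_cast
      rfl
  obtain ⟨c, hc⟩ := hcomm (edgeList m r)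
  have htau : tensHom (Fin ℓ × (Fin r ⊕ Fin r)) (2 * m) (hVec k) (tauVec hr ℓ) =
      ((ℓ * ∑ j, d (tauCol m r hr j) : ℤ) : ℂ) • tauVec hr ℓ := by
    have hB : Matrix.diagonal (fun a => (d a : ℂ)) * colMat ℂ (tauCol m r hr) =
        colMat ℂ (tauCol m r hr) * Matrix.diagonal fun j => (d (tauCol m r hr j) : ℂ) := by
      ext x c
      rw [mul_colMat, Matrix.mul_diagonal, Matrix.diagonal_apply, colMat, Matrix.of_apply]
      split_ifs with h
      · rw [h, one_mul]
      · rw [zero_mul]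
    rw [hk, tensHom_iota, tauVec]
    change tensAct _ (Matrix.diagonal _) _ = _
    rw [tensAct_wedgeVec hB, Matrix.trace_diagonal, Fintype.card_fin]
    push_cast
    rfl
  refine ⟨ℓ * ∑ j, d (tauCol m r hr j) + c, ?_⟩
  have h2 : hVec k * highOp s = highOp s * hVec k + (c : ℂ) • highOp s := hc
  rw [← Module.End.mul_apply, ← map_mul, h2, map_add, map_mul, LinearMap.add_apply,
    Module.End.mul_apply, htau, map_smul, map_smul, LinearMap.smul_apply, ← add_smul, Int.cast_add]

/-- The binomial polynomial takes integral values at all integers, negative ones included, which is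
why `Ring.choose` appears. -/
theorem binom_apply_of_eigenvector {M : Type*} [AddCommGroup M] [Module ℂ M] {h : Module.End ℂ M}
    {v : M} {c : ℤ} (hv : h v = (c : ℂ) • v) (k : ℕ) : binom h k v = Ring.choose c k • v := by
  have h1 : ∀ p : Polynomial ℂ, Polynomial.aeval h p v = p.eval (c : ℂ) • v := by
    intro p
    induction p using Polynomial.induction_on' with
    | add p q hp hq => rw [map_add, LinearMap.add_apply, hp, hq, Polynomial.eval_add, add_smul]
    | monomial n a =>
      have hpow : ∀ n : ℕ, (h ^ n) v = ((c : ℂ) ^ n) • v := by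
        intro n
        induction n with
        | zero => simp
        | succ n ih => rw [pow_succ, Module.End.mul_apply, hv, map_smul, ih, smul_smul, pow_succ']
      rw [Polynomial.aeval_monomial, Polynomial.eval_monomial, Module.End.mul_apply, hpow, map_smul,
        Module.algebraMap_end_apply, smul_smul, mul_comm]
  have h2 : (descPochhammer ℂ k).eval (c : ℂ) = (k ! : ℂ) * (Ring.choose c k : ℤ) := by
    have h3 := Ring.descPochhammer_eq_factorial_smul_choose c k
    have h4 : (descPochhammer ℂ k).eval (c : ℂ) = (((descPochhammer ℤ k).eval c : ℤ) : ℂ) := by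
      rw [← descPochhammer_map (Int.castRingHom ℂ), Polynomial.eval_intCast_map]
      rfl
    rw [h4, Polynomial.eval_eq_smeval, h3, nsmul_eq_mul]
    push_cast
    rfl
  have hne : ((k ! : ℕ) : ℂ) ≠ 0 := by exact_mod_cast k.factorial_ne_zero
  rw [binom, LinearMap.smul_apply, h1, smul_smul, h2, ← mul_assoc, inv_mul_cancel₀ hne, one_mul,
    Int.cast_smul_eq_zsmul]

end

section

open MvPolynomial

variable {m r : ℕ}

/-! ### Monomials in the divided power algebra -/

/-- The generator `f_α^{(k)}` of the divided power algebra. -/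
def gen (α : PosRoot m) (k : ℕ) : SZ m := RingQuot.mkAlgHom ℤ (SRel m) (FreeAlgebra.ι ℤ (α, k))

theorem gen_zero (α : PosRoot m) : gen α 0 = 1 := by
  rw [gen, RingQuot.mkAlgHom_rel ℤ (SRel.zero α), map_one]

theorem gen_mul (α : PosRoot m) (a b : ℕ) :
    gen α a * gen α b = (a + b).choose a • gen α (a + b) := by
  rw [gen, gen, gen, ← map_mul, RingQuot.mkAlgHom_rel ℤ (SRel.mul α a b), map_nsmul]

theorem gen_commute (α β : PosRoot m) (a b : ℕ) : Commute (gen α a) (gen β b) := by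
  rw [Commute, SemiconjBy, gen, gen, ← map_mul, RingQuot.mkAlgHom_rel ℤ (SRel.comm α β a b), map_mul]

theorem SZ_induction {p : SZ m → Prop} (hcast : ∀ c : ℤ, p (c : SZ m)) (hgen : ∀ α k, p (gen α k))
    (hadd : ∀ x y, p x → p y → p (x + y)) (hmul : ∀ x y, p x → p y → p (x * y)) (x : SZ m) : p x := by
  obtain ⟨y, rfl⟩ := RingQuot.mkAlgHom_surjective ℤ (SRel m) x
  induction y using FreeAlgebra.induction with
  | grade0 c =>
    rw [AlgHom.commutes]
    exact hcast c
  | grade1 g => exact hgen g.1 g.2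
  | mul a b ha hb =>
    rw [map_mul]
    exact hmul _ _ ha hb
  | add a b ha hb =>
    rw [map_add]
    exact hadd _ _ ha hb

/-- The monomial `∏ f_α^{(s_α)}`. -/
def mono (s : Edge m r →₀ ℕ) : SZ m := ((edgeList m r).map fun e => gen e.root (s e)).prod

theorem mono_zero : mono (0 : Edge m r →₀ ℕ) = 1 := by
  refine List.prod_eq_one fun x hx => ?_
  obtain ⟨e, -, rfl⟩ := List.mem_map.mp hx
  exact gen_zero _

theorem mono_single (e : Edge m r) (k : ℕ) : mono (Finsupp.single e k) = gen e.root k := by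
  classical
  rw [mono, List.prod_map_eq_pow_single e, List.count_eq_one_of_mem nodup_edgeList (mem_edgeList e),
    pow_one, Finsupp.single_eq_same]
  intro e' he' _
  rw [Finsupp.single_eq_of_ne he', gen_zero]

/-- The structure constant in the product of two monomials. -/
def monoConst (s s' : Edge m r →₀ ℕ) : ℕ :=
  ((edgeList m r).map fun e => (s e + s' e).choose (s e)).prod

theorem mono_mul (s s' : Edge m r →₀ ℕ) : mono s * mono s' = monoConst s s' • mono (s + s') := by
  rw [mono, mono, mono, monoConst]
  induction edgeList m r with
  | nil => simp
  | cons e L ih =>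
    simp only [List.map_cons, List.prod_cons]
    have hc : Commute ((L.map fun e => gen e.root (s e)).prod) (gen e.root (s' e)) := by
      refine Commute.list_prod_left _ _ fun x hx => ?_
      obtain ⟨e', -, rfl⟩ := List.mem_map.mp hx
      exact gen_commute _ _ _ _
    rw [mul_assoc, ← mul_assoc _ (gen _ (s' e)), hc.eq, mul_assoc, ih, ← mul_assoc, gen_mul,
      smul_mul_smul_comm]
    rfl

theorem monoConst_of_disjoint {s s' : Edge m r →₀ ℕ} (h : ∀ e, s e = 0 ∨ s' e = 0) :
    monoConst s s' = 1 := by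
  refine List.prod_eq_one fun x hx => ?_
  obtain ⟨e, -, rfl⟩ := List.mem_map.mp hx
  rcases h e with h | h
  · rw [h, Nat.choose_zero_right]
  · rw [h, add_zero, Nat.choose_self]

theorem exists_edge_root {α : PosRoot m} (h1 : (α.1.1 : ℕ) < r) (h2 : r ≤ (α.1.2 : ℕ)) :
    ∃ e : Edge m r, e.root = α := by
  have h3 := α.2.2
  refine ⟨⟨α.1.2, α.1.1.rev, h2, ?_, ?_⟩, ?_⟩
  · rw [Fin.le_def, Fin.val_rev]
    omega
  · rw [Fin.val_rev]
    omega
  · apply Subtype.ext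
    exact Prod.ext (Fin.rev_rev _) rfl

/-- In a module over the divided power algebra, a vector annihilated by the generators that are not
attached to an interval generates the span of its images under the monomials. -/
theorem smul_mem_span_mono {W : Type*} [AddCommGroup W] [Module (SZ m) W] {w : W}
    (hw : ∀ (α : PosRoot m) (k : ℕ), k ≠ 0 → ¬ ((α.1.1 : ℕ) < r ∧ r ≤ (α.1.2 : ℕ)) →
      gen α k • w = 0) (x : SZ m) :
    x • w ∈ Submodule.span ℤ (Set.range fun s : Edge m r →₀ ℕ => mono s • w) := by
  have key : ∀ x : SZ m, ∀ y ∈ Submodule.span ℤ (Set.range fun s : Edge m r →₀ ℕ => mono s • w),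
      x • y ∈ Submodule.span ℤ (Set.range fun s : Edge m r →₀ ℕ => mono s • w) := by
    refine SZ_induction ?_ ?_ ?_ ?_
    · intro c y hy
      rw [Int.cast_smul_eq_zsmul]
      exact Submodule.smul_mem _ c hy
    · intro α k y hy
      induction hy using Submodule.span_induction with
      | zero => rw [smul_zero]; exact zero_mem _
      | add a b _ _ ha hb => rw [smul_add]; exact add_mem ha hb
      | smul c a _ ha => rw [smul_comm]; exact Submodule.smul_mem _ c ha
      | mem a ha =>
        obtain ⟨s, rfl⟩ := ha
        change gen α k • mono s • w ∈ _
        rw [smul_smul]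
        by_cases h : (α.1.1 : ℕ) < r ∧ r ≤ (α.1.2 : ℕ)
        · obtain ⟨e, rfl⟩ := exists_edge_root h.1 h.2
          rw [← mono_single, mono_mul, smul_assoc]
          exact nsmul_mem (Submodule.subset_span (Set.mem_range_self _)) _
        · by_cases hk : k = 0
          · rw [hk, gen_zero, one_mul]
            exact Submodule.subset_span ⟨s, rfl⟩
          · have hc : Commute (gen α k) (mono s) := by
              refine Commute.list_prod_right _ _ fun x hx => ?_
              obtain ⟨e', -, rfl⟩ := List.mem_map.mp hx
              exact gen_commute _ _ _ _
            rw [hc.eq, mul_smul, hw α k hk h, smul_zero]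
            exact zero_mem _
    · intro x y hx hy z hz
      rw [add_smul]
      exact add_mem (hx z hz) (hy z hz)
    · intro x y hx hy z hz
      rw [mul_smul]
      exact hx _ (hy z hz)
  refine key x w (Submodule.subset_span ⟨0, ?_⟩)
  change mono 0 • w = w
  rw [mono_zero, one_smul]

theorem divPow_apply_eq_zero {M : Type*} [AddCommGroup M] [Module ℂ M] {T : Module.End ℂ M} {v : M}
    (h : T v = 0) {k : ℕ} (hk : k ≠ 0) : divPow T k v = 0 := by
  obtain ⟨j, rfl⟩ := Nat.exists_eq_succ_of_ne_zero hk
  rw [divPow, LinearMap.smul_apply, pow_succ, Module.End.mul_apply, h, map_zero, smul_zero]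

/-! ### The degenerate module -/

section Degenerate

variable {lam : Weight m}

/-- A vector in a filtration step, placed in the corresponding degree. -/
def grSingle (lam : Weight m) (n : ℕ) : pbwV lam (n + 1) →+ grTop lam :=
  ((Finsupp.singleAddHom n).comp (pbwV lam (n + 1)).subtype).codRestrict (grTop lam) fun w s => by
    change Finsupp.single n (w : V lam) s ∈ _
    by_cases h : s = n
    · rw [h, Finsupp.single_eq_same]
      exact w.2
    · rw [Finsupp.single_eq_of_ne h]
      exact (pbwV lam _).zero_mem

/-- The quotient map onto the degenerate module. -/
def vaHom (lam : Weight m) : grTop lam →+ Va lam := QuotientAddGroup.mk' _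

theorem vaHom_eq_zero_iff {p : grTop lam} : vaHom lam p = 0 ↔ (p : ℕ →₀ V lam) ∈ grBot lam :=
  QuotientAddGroup.eq_zero_iff p

/-- The class in degree `n` of a vector in the corresponding filtration step. -/
def grClass (lam : Weight m) (n : ℕ) : pbwV lam (n + 1) →+ Va lam :=
  (vaHom lam).comp (grSingle lam n)

theorem grClass_apply (n : ℕ) (w : pbwV lam (n + 1)) :
    grClass lam n w = vaHom lam (grSingle lam n w) := rfl

theorem gen_smul_mk (α : PosRoot m) (k : ℕ) (p : grTop lam) :
    gen α k • Va.mk p = Va.mk (topAct lam α k p) := by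
  change grHom lam (gen α k) (Va.mk p) = _
  rw [gen, grHom, RingQuot.liftAlgHom_mkAlgHom_apply, FreeAlgebra.lift_ι_apply]
  rfl

theorem gen_smul_grClass (α : PosRoot m) (k n : ℕ) (w : pbwV lam (n + 1)) :
    gen α k • grClass lam n w = grClass lam (n + k) ⟨divPow (fVec α) k • (w : V lam),
      smul_mem_pbwV (divPow_mem_pbw α k) w.2 (by omega)⟩ := by
  refine (gen_smul_mk α k _).trans (congrArg Va.mk (Subtype.ext ?_))
  ext s : 1
  change shiftAct lam (divPow (fVec α) k) k (Finsupp.single n (w : V lam)) s =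
    Finsupp.single (n + k) (divPow (fVec α) k • (w : V lam)) s
  rw [shiftAct_apply]
  by_cases h : s = n + k
  · rw [h, if_pos (by omega), Nat.add_sub_cancel, Finsupp.single_eq_same, Finsupp.single_eq_same]
  · rw [Finsupp.single_eq_of_ne h]
    split_ifs with h'
    · rw [Finsupp.single_eq_of_ne (by omega), smul_zero]
    · rfl

theorem grClass_congr {n n' : ℕ} (h : n = n') {w : pbwV lam (n + 1)} {w' : pbwV lam (n' + 1)}
    (hw : (w : V lam) = w') : grClass lam n w = grClass lam n' w' := by
  subst h
  rw [Subtype.ext hw]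

theorem hwVec_mem_pbwV : hwVec lam ∈ pbwV lam 1 :=
  ⟨1, Submodule.subset_span ⟨[], by simp⟩, (one_smul _ _).symm⟩

/-- The class of the highest weight vector. -/
def grGen (lam : Weight m) : Va lam := grClass lam 0 ⟨hwVec lam, hwVec_mem_pbwV⟩

theorem prod_smul_mem_pbwV {n : ℕ} (L : List (PosRoot m × ℕ)) (hn : (L.map Prod.snd).sum = n) :
    (L.map fun p => divPow (fVec p.1) p.2).prod • hwVec lam ∈ pbwV lam (n + 1) :=
  ⟨_, Submodule.subset_span ⟨L, by omega, rfl⟩, rfl⟩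

theorem prod_smul_grGen {n : ℕ} (L : List (PosRoot m × ℕ)) (hn : (L.map Prod.snd).sum = n) :
    (L.map fun p => gen p.1 p.2).prod • grGen lam =
      grClass lam n ⟨(L.map fun p => divPow (fVec p.1) p.2).prod • hwVec lam,
        prod_smul_mem_pbwV L hn⟩ := by
  subst hn
  induction L with
  | nil =>
    simp only [List.map_nil, List.prod_nil, one_smul]
    rfl
  | cons p L ih =>
    simp only [List.map_cons, List.prod_cons, mul_smul]
    rw [ih, gen_smul_grClass]
    exact grClass_congr (by rw [List.map_cons, List.sum_cons, add_comm]) rfl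

theorem mono_smul_grGen (s : Edge m r →₀ ℕ) :
    mono s • grGen lam = grClass lam s.degree ⟨lowOp s • hwVec lam, _, lowOp_mem_pbw s, rfl⟩ := by
  have h : mono s = (((edgeList m r).map fun e => (e.root, s e)).map fun p => gen p.1 p.2).prod := by
    rw [List.map_map]
    rfl
  rw [h, prod_smul_grGen (n := s.degree) _ (by rw [List.map_map]; exact map_edgeList_sum s)]
  have h' : (((edgeList m r).map fun e => (e.root, s e)).map fun p => divPow (fVec p.1) p.2).prod =
      lowOp s := by
    rw [List.map_map]
    rfl
  exact grClass_congr rfl (congrArg (· • hwVec lam) h')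

theorem grClass_eq_zero {n : ℕ} {w : pbwV lam (n + 1)} (hw : (w : V lam) ∈ pbwV lam n) :
    grClass lam n w = 0 := by
  refine vaHom_eq_zero_iff.mpr fun s => ?_
  change Finsupp.single n (w : V lam) s ∈ _
  by_cases h : s = n
  · rw [h, Finsupp.single_eq_same]
    exact hw
  · rw [Finsupp.single_eq_of_ne h]
    exact (pbwV lam _).zero_mem

/-- A relation in a graded module holds in each degree separately; lifted to the filtration, its
degree n part falls into the preceding step. -/
theorem sum_mono_smul_grGen_mem {T : Finset (Edge m r →₀ ℕ)} {c : (Edge m r →₀ ℕ) → ℤ}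
    (h : ∑ s ∈ T, c s • mono s • grGen lam = 0) (n : ℕ) :
    ∑ s ∈ T with s.degree = n, c s • lowOp s • hwVec lam ∈ pbwV lam n := by
  let p : (Edge m r →₀ ℕ) → grTop lam := fun s =>
    grSingle lam s.degree ⟨lowOp s • hwVec lam, _, lowOp_mem_pbw s, rfl⟩
  have h1 : ∑ s ∈ T, c s • mono s • grGen lam =
      vaHom lam (∑ s ∈ T, c s • p s) := by
    rw [map_sum]
    refine Finset.sum_congr rfl fun s _ => ?_
    rw [mono_smul_grGen, map_zsmul]
    rfl
  rw [h1] at h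
  have h2 := vaHom_eq_zero_iff.mp h n
  have h3 : ((∑ s ∈ T, c s • p s : grTop lam) : ℕ →₀ V lam) n =
      ∑ s ∈ T with s.degree = n, c s • lowOp s • hwVec lam := by
    rw [AddSubgroup.val_finsetSum, Finsupp.finsetSum_apply, Finset.sum_filter]
    refine Finset.sum_congr rfl fun s _ => ?_
    change c s • Finsupp.single s.degree (lowOp s • hwVec lam) n = _
    split_ifs with hs
    · rw [hs, Finsupp.single_eq_same]
    · rw [Finsupp.single_eq_of_ne (Ne.symm hs), smul_zero]
  rw [← h3]
  exact h2

/-- The degenerate module is generated by the class of the highest weight vector. -/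
theorem exists_smul_grGen (y : Va lam) : ∃ x : SZ m, x • grGen lam = y := by
  obtain ⟨p, rfl⟩ := Va.mk_surjective y
  have hclass : ∀ (n : ℕ) (w : pbwV lam (n + 1)), grClass lam n w ∈
      (LinearMap.range (LinearMap.toSpanSingleton (SZ m) (Va lam) (grGen lam))) := by
    rintro n ⟨_, x, hx, rfl⟩
    induction hx using Submodule.span_induction with
    | zero =>
      refine (grClass_eq_zero ?_).symm ▸ zero_mem _
      change (0 : U m) • hwVec lam ∈ _
      rw [zero_smul]
      exact zero_mem _
    | add a b ha hb iha ihb =>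
      have h := add_mem iha ihb
      rw [← map_add] at h
      convert h using 2
      exact Subtype.ext (add_smul a b _)
    | smul c a ha iha =>
      have h := zsmul_mem iha c
      rw [← map_zsmul] at h
      convert h using 2
      exact Subtype.ext (smul_assoc c a _)
    | mem a ha =>
      obtain ⟨L, hL, rfl⟩ := ha
      -- A product of full degree n is the image of the corresponding monomial; one of smaller
      -- degree has zero class in degree n.
      rcases (Nat.lt_succ_iff.mp hL).eq_or_lt with h | h
      · exact ⟨_, prod_smul_grGen L h⟩
      · rw [grClass_eq_zero ⟨_, Submodule.subset_span ⟨L, h, rfl⟩, rfl⟩]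
        exact zero_mem _
  have hp : Va.mk p = ∑ n ∈ (p : ℕ →₀ V lam).support, grClass lam n ⟨(p : ℕ →₀ V lam) n, p.2 n⟩ := by
    change vaHom lam p = _
    simp only [grClass_apply]
    rw [← map_sum]
    congr 1
    apply Subtype.ext
    rw [AddSubgroup.val_finsetSum]
    exact (Finsupp.sum_single (p : ℕ →₀ V lam)).symm
  rw [hp]
  obtain ⟨x, hx⟩ := Submodule.sum_mem (LinearMap.range (LinearMap.toSpanSingleton (SZ m) (Va lam)
    (grGen lam))) fun n (_ : n ∈ (p : ℕ →₀ V lam).support) => hclass n ⟨(p : ℕ →₀ V lam) n, p.2 n⟩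
  exact ⟨x, hx⟩

end Degenerate

/-! ### Straightening to admissible monomials -/

section Straightening

variable (i : Fin m) (ℓ : ℕ)

theorem fVec_smul_hwVec {α : PosRoot m} (hα : ¬ ((α.1.1 : ℕ) < i + 1 ∧ i + 1 ≤ (α.1.2 : ℕ))) {k : ℕ}
    (hk : k ≠ 0) : divPow (fVec α) k • hwVec ((ℓ : ℤ) • fundWeight i) = 0 := by
  obtain ⟨Θ, hΘ, hΘ1, hΘ2⟩ := exists_realization_topCol i ℓ
  apply hΘ
  rw [hΘ1, hΘ2, map_zero, map_divPow]
  exact divPow_apply_eq_zero (tensHom_fVec_wedgeVec i.2 ℓ hα) hk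

theorem gen_smul_grGen {α : PosRoot m} (hα : ¬ ((α.1.1 : ℕ) < i + 1 ∧ i + 1 ≤ (α.1.2 : ℕ))) {k : ℕ}
    (hk : k ≠ 0) : gen α k • grGen ((ℓ : ℤ) • fundWeight i) = 0 := by
  rw [grGen, gen_smul_grClass]
  refine grClass_eq_zero ?_
  change divPow (fVec α) k • hwVec ((ℓ : ℤ) • fundWeight i) ∈ _
  rw [fVec_smul_hwVec i ℓ hα hk]
  exact zero_mem _

theorem sum_mono_smul_grGen {n : ℕ} (hn : ℓ < n) (d : Fin (2 * m) →₀ ℕ) :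
    ∑ s ∈ edgeFamilies m (i + 1) n with Edge.ends m (i + 1) s = d,
      mono s • grGen ((ℓ : ℤ) • fundWeight i) = 0 := by
  have hmem : ∀ s ∈ (edgeFamilies m (i + 1) n).filter fun s => Edge.ends m (i + 1) s = d,
      s.degree = n := fun s hs => mem_edgeFamilies.mp (Finset.mem_filter.mp hs).1
  have h : ∑ s ∈ edgeFamilies m (i + 1) n with Edge.ends m (i + 1) s = d,
      mono s • grGen ((ℓ : ℤ) • fundWeight i) = grClass ((ℓ : ℤ) • fundWeight i) n
        (∑ s ∈ ((edgeFamilies m (i + 1) n).filter fun s => Edge.ends m (i + 1) s = d).attach,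
          ⟨lowOp s.1 • hwVec _, _, pbw_mono (by rw [hmem s.1 s.2]) (lowOp_mem_pbw s.1), rfl⟩) := by
    rw [map_sum, ← Finset.sum_attach]
    refine Finset.sum_congr rfl fun s _ => ?_
    rw [mono_smul_grGen]
    exact grClass_congr (hmem s.1 s.2) rfl
  rw [h]
  refine grClass_eq_zero ?_
  rw [AddSubgroup.val_finsetSum]
  have h2 := sum_lowOp_mem_pbwV i hn d
  rw [← Finset.sum_attach] at h2
  exact h2

/-- The weights of families of `n` intervals are bounded. -/
theorem exists_wt_le (m r n : ℕ) : ∃ N, ∀ s : Edge m r →₀ ℕ, s.degree = n → Edge.wt m r s ≤ N :=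
  ⟨(edgeFamilies m r n).sup (Edge.wt m r), fun _ hs => Finset.le_sup (mem_edgeFamilies.mpr hs)⟩

/-- The admissible monomials span the degenerate module. -/
theorem mono_smul_grGen_mem_span (s : Edge m (i + 1) →₀ ℕ) :
    mono s • grGen ((ℓ : ℤ) • fundWeight i) ∈ Submodule.span ℤ
      ((fun s : Edge m (i + 1) →₀ ℕ => mono s • grGen ((ℓ : ℤ) • fundWeight i)) '' {s | Edge.IsAdmissible ℓ s}) := by
  classical
  obtain ⟨N, hN⟩ := exists_wt_le m (i + 1) s.degree
  obtain ⟨n, hn⟩ : ∃ n, s.degree = n := ⟨_, rfl⟩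
  rw [hn] at hN
  obtain ⟨k, hk⟩ : ∃ k, N - Edge.wt m (i + 1) s = k := ⟨_, rfl⟩
  -- Straightening keeps the degree and strictly raises the weight, which is bounded by N in that
  -- degree.
  induction k using Nat.strong_induction_on generalizing s with
  | _ k ih =>
    by_cases hs : Edge.IsAdmissible ℓ s
    · exact Submodule.subset_span ⟨s, hs, rfl⟩
    rw [Edge.IsAdmissible] at hs
    push Not at hs
    obtain ⟨D, hD, hDs⟩ := hs
    -- The part u of s on an overlong chain is straightened and the rest v is multiplied back. Their
    -- supports are disjoint, so the structure constant in `mono v * mono u` is 1 and the monomial s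
    -- can be solved for over ℤ.
    set u := s.filter (· ∈ D) with hu
    set v := s.filter (· ∉ D) with hv
    have huv : v + u = s := (add_comm _ _).trans (Finsupp.filter_add_filter_not s (· ∈ D))
    have hdu : ℓ < u.degree := by
      refine hDs.trans_le ?_
      rw [Finsupp.degree_eq_sum]
      refine le_trans (Finset.sum_le_sum fun e he => ?_)
        (Finset.sum_le_sum_of_subset (Finset.subset_univ D))
      rw [hu, Finsupp.filter_apply_pos _ _ he]
    have hchain : IsChain (· ≤ ·) (u.support : Set (Edge m (i + 1))) := by
      refine hD.mono fun e he => ?_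
      rw [hu, Finsupp.support_filter] at he
      exact (Finset.mem_filter.mp he).2
    -- Every other term of this relation has the end points of u without being u, so it is heavier
    -- than the chain.
    have hrel := congrArg (mono v • ·) (sum_mono_smul_grGen i ℓ hdu (Edge.ends m (i + 1) u))
    simp only [smul_zero, Finset.smul_sum, smul_smul, mono_mul, smul_assoc] at hrel
    have hmem : u ∈ (edgeFamilies m (i + 1) u.degree).filter fun s =>
        Edge.ends m (i + 1) s = Edge.ends m (i + 1) u :=
      Finset.mem_filter.mpr ⟨mem_edgeFamilies.mpr rfl, rfl⟩
    rw [← Finset.add_sum_erase _ _ hmem, huv, monoConst_of_disjoint, one_smul, add_eq_zero_iff_eq_neg] at hrel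
    · rw [hrel]
      refine neg_mem (sum_mem fun u' hu' => nsmul_mem ?_ _)
      rw [Finset.mem_erase, Finset.mem_filter, mem_edgeFamilies] at hu'
      have hwt : Edge.wt m (i + 1) u < Edge.wt m (i + 1) u' := (Edge.eq_or_wt_lt_of_isChain i.2 hchain hu'.2.2.symm).resolve_left
        hu'.1
      have hdeg : (v + u').degree = n := by
        rw [map_add, hu'.2.1, ← map_add, huv, hn]
      have h1 := hN _ hdeg
      have h2 : Edge.wt m (i + 1) s < Edge.wt m (i + 1) (v + u') := by
        rw [← huv, map_add, map_add]
        omega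
      exact ih (N - Edge.wt m (i + 1) (v + u')) (by omega) _ hdeg rfl
    · intro e
      by_cases he : e ∈ D
      · left
        rw [hv, Finsupp.filter_apply_neg (· ∉ D) s (not_not.mpr he)]
      · right
        rw [hu, Finsupp.filter_apply_neg _ _ he]

end Straightening

end

section

open MvPolynomial

variable {m r : ℕ}

/-! ### The integral form contains the Demazure module -/

section Integral

variable {n : ℕ} {lam : Weight n}

theorem smul_mem_VZ {x : U n} (hx : x ∈ UZ n) {v : V lam} (hv : v ∈ VZ lam) : x • v ∈ VZ lam :=
  (VZ lam).smul_mem (⟨x, hx⟩ : UZ n) hv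

/-- A `finsum` of infinite support has the default value 0, which also lies in the lattice; no local
nilpotency is needed. -/
theorem expAct_mem_VZ {x : U n} (hx : ∀ k, divPow x k ∈ UZ n) {v : V lam} (hv : v ∈ VZ lam) :
    expAct x v ∈ VZ lam :=
  finsum_induction (· ∈ VZ lam) (zero_mem _) (fun _ _ => add_mem) fun k => smul_mem_VZ (hx k) hv

theorem divPow_neg {A : Type*} [Ring A] [Algebra ℂ A] (x : A) (k : ℕ) :
    divPow (-x) k = (-1 : ℤ) ^ k • divPow x k := by
  rw [divPow, divPow, neg_pow, smul_comm, zsmul_eq_mul]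
  push_cast
  rfl

theorem extremalVec_mem_VZ (w : List (Fin n)) : extremalVec lam w ∈ VZ lam := by
  have he : ∀ (α : PosRoot n) k, divPow (eVec α) k ∈ UZ n := fun α k =>
    Algebra.subset_adjoin (Or.inl (Or.inl ⟨α, k, rfl⟩))
  have hf : ∀ (α : PosRoot n) k, divPow (-fVec α) k ∈ UZ n := fun α k => by
    rw [divPow_neg]
    exact (UZ n).smul_mem (Algebra.subset_adjoin (Or.inl (Or.inr ⟨α, k, rfl⟩))) _
  induction w with
  | nil => exact Submodule.subset_span rfl
  | cons k w ih =>
    exact expAct_mem_VZ (he _) (expAct_mem_VZ (hf _) (expAct_mem_VZ (he _) ih))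

theorem UZb_le_UZ : UZb n ≤ UZ n :=
  Algebra.adjoin_mono (Set.union_subset_union_left _ Set.subset_union_left)

theorem demazure_subset_VZ (w : List (Fin n)) :
    (demazure lam w : Set (V lam)) ⊆ VZ lam := by
  intro v hv
  obtain ⟨y, rfl⟩ := Submodule.mem_span_singleton.mp hv
  exact smul_mem_VZ (UZb_le_UZ y.2) (extremalVec_mem_VZ w)

end Integral

/-! ### The Demazure module -/

theorem coe_borelHom_gen (α : PosRoot m) (k : ℕ) :
    (borelHom m (gen α k) : U (2 * m)) = divPow (eVec (phi α)) k := by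
  rw [gen, borelHom, RingQuot.liftAlgHom_mkAlgHom_apply, FreeAlgebra.lift_ι_apply]
  rfl

theorem coe_borelHom_mono (s : Edge m r →₀ ℕ) : (borelHom m (mono s) : U (2 * m)) = highOp s := by
  change ((UZb (2 * m)).val.comp (borelHom m)) (mono s) = _
  rw [mono, map_list_prod, List.map_map, highOp]
  congr 1
  exact List.map_congr_left fun e _ => coe_borelHom_gen _ _

section Demazure

variable (i : Fin m) (ℓ : ℕ)

/-- The weight `Ψ(ℓ ω_i)`. -/
abbrev tauWeight : Weight (2 * m) := Psi ((ℓ : ℤ) • fundWeight i)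

/-- The generator of the Demazure module. -/
def tauGen : demazure (tauWeight i ℓ) (tauWord m) :=
  ⟨extremalVec (tauWeight i ℓ) (tauWord m), Submodule.subset_span rfl⟩

theorem coe_smul_tauGen (x : SZ m) : ((x • tauGen i ℓ : demazure (tauWeight i ℓ) (tauWord m)) :
    V (tauWeight i ℓ)) = (borelHom m x : U (2 * m)) • extremalVec (tauWeight i ℓ) (tauWord m) := rfl

theorem gen_smul_tauGen {α : PosRoot m} (hα : ¬ ((α.1.1 : ℕ) < i + 1 ∧ i + 1 ≤ (α.1.2 : ℕ))) {k : ℕ}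
    (hk : k ≠ 0) : gen α k • tauGen i ℓ = 0 := by
  obtain ⟨Θ, hΘ, hΘ1, hΘ2⟩ := exists_realization_tau m i ℓ
  apply Subtype.ext
  apply hΘ
  rw [coe_smul_tauGen, coe_borelHom_gen, hΘ1, hΘ2, map_divPow]
  refine (divPow_apply_eq_zero (tensHom_eVec_tauVec i.2 ℓ (γ := phi α) ?_ ?_) hk).trans
    (map_zero Θ).symm
  · change 2 * m ≤ (α.1.1 : ℕ) + 2 * m
    omega
  · change ¬ ((α.1.1 : ℕ) + 2 * m < 2 * m + (i + 1) ∧ i + 1 ≤ (α.1.2 : ℕ))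
    omega

theorem apply_mono_smul_tauGen {Θ : V (tauWeight i ℓ) →+
      ((Fin ℓ × (Fin (i + 1) ⊕ Fin (i + 1)) → Fin (2 * (2 * m))) → ℂ)}
    (hΘ1 : ∀ (x : U (2 * m)) (w : V (tauWeight i ℓ)),
      Θ (x • w) = tensHom (Fin ℓ × (Fin (i + 1) ⊕ Fin (i + 1))) (2 * m) x (Θ w))
    (hΘ2 : Θ (extremalVec (tauWeight i ℓ) (tauWord m)) =
      wedgeVec (Fin ℓ) (colMat ℂ (tauCol m (i + 1) i.2)))
    (s : Edge m (i + 1) →₀ ℕ) (t : Fin ℓ × (Fin (i + 1) ⊕ Fin (i + 1)) → Fin (2 * (2 * m))) :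
    Θ ((mono s • tauGen i ℓ : demazure (tauWeight i ℓ) (tauWord m)) : V (tauWeight i ℓ)) t =
      coeff s (wedgeVec (Fin ℓ) (tauChart (r := i + 1) i.2 X) t) := by
  rw [coe_smul_tauGen, coe_borelHom_mono, hΘ1, hΘ2]
  exact tensHom_highOp_apply i.2 ℓ s t

/-- Injectivity of the realization turns the relation into one for every coordinate, and the
comparison of minors in both directions replaces the large matrix by the affine chart. -/
theorem sum_mono_smul_tauGen_eq_zero_iff {T : Finset (Edge m (i + 1) →₀ ℕ)}
    {c : (Edge m (i + 1) →₀ ℕ) → ℤ} : ∑ s ∈ T, c s • mono s • tauGen i ℓ = 0 ↔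
      ∀ t : Fin ℓ × Fin (i + 1) → Fin (2 * m),
        ∑ s ∈ T, (c s : ℂ) * coeff s (wedgeVec (Fin ℓ) (chartMat (r := i + 1) i.2 X) t) = 0 := by
  obtain ⟨Θ, hΘ, hΘ1, hΘ2⟩ := exists_realization_tau m i ℓ
  have h1 : ∑ s ∈ T, c s • mono s • tauGen i ℓ = 0 ↔
      ∀ t', ∑ s ∈ T, (c s : ℂ) * coeff s (wedgeVec (Fin ℓ) (tauChart (r := i + 1) i.2 X) t') = 0 := by
    have h2 : ∀ t', Θ ((∑ s ∈ T, c s • mono s • tauGen i ℓ :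
        demazure (tauWeight i ℓ) (tauWord m)) : V (tauWeight i ℓ)) t' = ∑ s ∈ T, (c s : ℂ) *
          coeff s (wedgeVec (Fin ℓ) (tauChart (r := i + 1) i.2 X) t') := by
      intro t'
      rw [Submodule.coe_sum, map_sum, Finset.sum_apply]
      refine Finset.sum_congr rfl fun s _ => ?_
      rw [Submodule.coe_smul_of_tower, map_zsmul, Pi.smul_apply,
        apply_mono_smul_tauGen i ℓ hΘ1 hΘ2, zsmul_eq_mul]
    rw [← Submodule.coe_eq_zero, ← map_eq_zero_iff Θ hΘ, funext_iff]
    exact forall_congr' fun t' => by rw [h2, Pi.zero_apply]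
  rw [h1]
  constructor
  · intro h t
    obtain ⟨t', ht'⟩ := exists_wedgeVec_tauChart_eq (r := i + 1) i.2
      (X : Edge m (i + 1) → MvPolynomial (Edge m (i + 1)) ℂ) t
    rw [← ht']
    exact h t'
  · intro h t'
    obtain ⟨ε, t, ht⟩ := exists_wedgeVec_chartMat_eq (r := i + 1) i.2
      (X : Edge m (i + 1) → MvPolynomial (Edge m (i + 1)) ℂ) t'
    have h3 : ∀ s, coeff s (wedgeVec (Fin ℓ) (tauChart (r := i + 1) i.2
        (X : Edge m (i + 1) → MvPolynomial (Edge m (i + 1)) ℂ)) t') =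
          ε * coeff s (wedgeVec (Fin ℓ) (chartMat (r := i + 1) i.2 X) t) := by
      intro s
      rw [ht, ← coeff_C_mul]
      simp
    simp only [h3, mul_left_comm _ (ε : ℂ)]
    rw [← Finset.mul_sum, h t, mul_zero]

/-- For a coordinate t only monomials of degree equal to the height of t contribute, by homogeneity,
and the part of the relation in that degree vanishes there. -/
theorem sum_mono_smul_tauGen_eq_zero {T : Finset (Edge m (i + 1) →₀ ℕ)}
    {c : (Edge m (i + 1) →₀ ℕ) → ℤ}
    (h : ∑ s ∈ T, c s • mono s • grGen ((ℓ : ℤ) • fundWeight i) = 0) :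
    ∑ s ∈ T, c s • mono s • tauGen i ℓ = 0 := by
  refine (sum_mono_smul_tauGen_eq_zero_iff i ℓ).mpr fun t => ?_
  rw [← sum_mul_coeff_eq_zero i (fun s hs => (Finset.mem_filter.mp hs).2) c
    (sum_mono_smul_grGen_mem h _) rfl (t := t)]
  refine (Finset.sum_filter_of_ne fun s _ hs => ?_).symm
  by_contra hd
  exact hs (by rw [(isHomogeneous_wedgeVec_chartMat i.2 t).coeff_eq_zero hd, mul_zero])

/-- The admissible monomials are linearly independent on the generator of the Demazure module. -/
theorem eq_zero_of_sum_mono_smul_tauGen {T : Finset (Edge m (i + 1) →₀ ℕ)}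
    (hT : ∀ s ∈ T, Edge.IsAdmissible ℓ s) {c : (Edge m (i + 1) →₀ ℕ) → ℤ}
    (h : ∑ s ∈ T, c s • mono s • tauGen i ℓ = 0) : ∀ s ∈ T, c s = 0 := by
  classical
  by_contra! hne
  have hT' : (T.filter fun s => c s ≠ 0).Nonempty := by
    obtain ⟨s, hs, hc⟩ := hne
    exact ⟨s, Finset.mem_filter.mpr ⟨hs, hc⟩⟩
  -- Take s of least weight in the relation. The product of minors led by s has otherwise only
  -- lighter monomials, none of which occurs in the relation.
  obtain ⟨s, hs, hmin⟩ := Finset.exists_min_image _ (Edge.wt m (i + 1)) hT'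
  rw [Finset.mem_filter] at hs
  obtain ⟨t, ht1, ht2⟩ := exists_isLead_wedgeVec (r := i + 1) i.2 (hT s hs.1)
  have h1 := (sum_mono_smul_tauGen_eq_zero_iff i ℓ).mp h t
  rw [Finset.sum_eq_single s, ht1, mul_one] at h1
  · exact hs.2 (Int.cast_eq_zero.mp h1)
  · intro s' hs' hne'
    by_contra h0
    have hc : c s' ≠ 0 := fun hc => h0 (by rw [hc, Int.cast_zero, zero_mul])
    have h2 := (ht2 s' (right_ne_zero_of_mul h0)).resolve_left hne'
    exact absurd h2 (not_lt.mpr (hmin s' (Finset.mem_filter.mpr ⟨hs', hc⟩)))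
  · exact fun h' => absurd hs.1 h'

/-- Applying the spanning lemma to the pair of generators in the product module represents x on both
by one and the same integral combination of monomials. -/
theorem smul_tauGen_eq_zero_of_smul_grGen {x : SZ m}
    (hx : x • grGen ((ℓ : ℤ) • fundWeight i) = 0) : x • tauGen i ℓ = 0 := by
  have h := smul_mem_span_mono (r := i + 1) (w := (tauGen i ℓ, grGen ((ℓ : ℤ) • fundWeight i)))
    (fun α k hk hα => Prod.ext (gen_smul_tauGen i ℓ hα hk) (gen_smul_grGen i ℓ hα hk)) x
  obtain ⟨c, hc⟩ := Finsupp.mem_span_range_iff_exists_finsupp.mp h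
  have h1 := congrArg Prod.fst hc
  have h2 := congrArg Prod.snd hc
  rw [Finsupp.sum, Prod.fst_sum] at h1
  rw [Finsupp.sum, Prod.snd_sum] at h2
  rw [Prod.smul_snd, hx] at h2
  exact h1.symm.trans (sum_mono_smul_tauGen_eq_zero i ℓ h2)

theorem smul_grGen_mem_span (x : SZ m) : x • grGen ((ℓ : ℤ) • fundWeight i) ∈ Submodule.span ℤ
    ((fun s : Edge m (i + 1) →₀ ℕ => mono s • grGen ((ℓ : ℤ) • fundWeight i)) ''
      {s | Edge.IsAdmissible ℓ s}) := by
  have h := smul_mem_span_mono (r := i + 1) (w := grGen ((ℓ : ℤ) • fundWeight i))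
    (fun α k hk hα => gen_smul_grGen i ℓ hα hk) x
  refine Submodule.span_le.mpr ?_ h
  rintro _ ⟨s, rfl⟩
  exact mono_smul_grGen_mem_span i ℓ s

/-- Write the action of x on the graded generator in admissible monomials. By the other inclusion of
annihilators the same combination represents x on `tauGen`, where it is zero, and independence there
kills all coefficients. -/
theorem smul_grGen_eq_zero_of_smul_tauGen {x : SZ m} (hx : x • tauGen i ℓ = 0) :
    x • grGen ((ℓ : ℤ) • fundWeight i) = 0 := by
  obtain ⟨c, hc, hcx⟩ := Finsupp.mem_span_image_iff_linearCombination ℤ |>.mp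
    (smul_grGen_mem_span i ℓ x)
  rw [Finsupp.linearCombination_apply, Finsupp.sum] at hcx
  have hz : ∀ {W : Type} [AddCommGroup W] [Module (SZ m) W] (w : W),
      (∑ s ∈ c.support, c s • mono s) • w = ∑ s ∈ c.support, c s • mono s • w := by
    intro W _ _ w
    rw [Finset.sum_smul]
    exact Finset.sum_congr rfl fun s _ => smul_assoc _ _ _
  have h1 : (∑ s ∈ c.support, c s • mono s - x) • grGen ((ℓ : ℤ) • fundWeight i) = 0 := by
    rw [sub_smul, hz, hcx, sub_self]
  have h2 := smul_tauGen_eq_zero_of_smul_grGen i ℓ h1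
  rw [sub_smul, hx, sub_zero, hz] at h2
  have h3 := eq_zero_of_sum_mono_smul_tauGen i ℓ (fun s hs => hc hs) h2
  rw [← hcx]
  exact Finset.sum_eq_zero fun s hs => by rw [h3 s hs, zero_smul]

/-! #### The Borel subalgebra -/

theorem exists_edge_phi_root {γ : PosRoot (2 * m)} (h1 : r ≤ (γ.1.1 : ℕ)) (h2 : 2 * m ≤ (γ.1.2 : ℕ))
    (h3 : (γ.1.2 : ℕ) < 2 * m + r) : ∃ e : Edge m r, phi e.root = γ := by
  have h4 := γ.2.2
  obtain ⟨e, he⟩ := exists_edge_root (r := r) (α := (⟨(⟨γ.1.2 - 2 * m, by omega⟩,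
    ⟨γ.1.1, by omega⟩), by rw [Fin.lt_def]; simp only; omega, by simp only; omega⟩ : PosRoot m))
    (by simp only; omega) h1
  refine ⟨e, ?_⟩
  rw [he]
  apply Subtype.ext
  refine Prod.ext rfl (Fin.ext ?_)
  change (γ.1.2 : ℕ) - 2 * m + 2 * m = γ.1.2
  omega

theorem eVec_commute_phi {γ : PosRoot (2 * m)} (h2 : 2 * m ≤ (γ.1.2 : ℕ)) (β : PosRoot m) :
    Commute (eVec γ : U (2 * m)) (eVec (phi β)) := by
  have h1 := γ.2.2
  have h3 := β.1.1.2
  have h4 := β.1.2.2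
  refine rootU_commute ?_ ?_ ?_ ?_ <;>
  · simp only [phi, ne_eq, Fin.ext_iff, Fin.val_rev]
    omega

theorem map_binom {A B : Type*} [Ring A] [Algebra ℂ A] [Ring B] [Algebra ℂ B] (g : A →ₐ[ℂ] B)
    (x : A) (k : ℕ) : g (binom x k) = binom (g x) k := by
  rw [binom, binom, map_smul, Polynomial.aeval_algHom_apply]

/-- The span of the images of the extremal vector under the monomials. -/
def tauSpan : Submodule ℤ (V (tauWeight i ℓ)) := Submodule.span ℤ
  (Set.range fun s : Edge m (i + 1) →₀ ℕ =>
    highOp s • extremalVec (tauWeight i ℓ) (tauWord m))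

/-- Three kinds of positive roots occur. Those of the Levi part act by integral shears, those of
intervals multiply monomials, and the other roots of the upper right block commute with the
monomials and annihilate the extremal vector. -/
theorem eVec_smul_mem_tauSpan (γ : PosRoot (2 * m)) (k : ℕ) (s : Edge m (i + 1) →₀ ℕ) :
    divPow (eVec γ) k • highOp s • extremalVec (tauWeight i ℓ) (tauWord m) ∈ tauSpan i ℓ := by
  obtain ⟨Θ, hΘ, hΘ1, hΘ2⟩ := exists_realization_tau m i ℓ
  rcases lt_or_ge (γ.1.2 : ℕ) (2 * m) with h | h
  · obtain ⟨S, c, hS⟩ := exists_int_tensHom_eVec (r := i + 1) i.2 ℓ h k s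
    have h1 : divPow (eVec γ) k • highOp s • extremalVec (tauWeight i ℓ) (tauWord m) =
        ∑ u ∈ S, c u • highOp u • extremalVec (tauWeight i ℓ) (tauWord m) := by
      apply hΘ
      rw [smul_smul, hΘ1, hΘ2, map_sum]
      refine hS.trans (Finset.sum_congr rfl fun u _ => ?_)
      rw [map_zsmul, hΘ1, hΘ2]
      rfl
    rw [h1]
    exact sum_mem fun u _ => Submodule.smul_mem _ _ (Submodule.subset_span ⟨u, rfl⟩)
  · by_cases hγ : (γ.1.2 : ℕ) < 2 * m + (i + 1) ∧ i + 1 ≤ (γ.1.1 : ℕ)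
    · obtain ⟨e, rfl⟩ := exists_edge_phi_root hγ.2 h hγ.1
      rw [← coe_borelHom_gen, ← coe_borelHom_mono, smul_smul, ← mono_single, ← MulMemClass.coe_mul,
        ← map_mul, mono_mul, map_nsmul]
      change (monoConst _ _ • (borelHom m (mono _) : U (2 * m))) • _ ∈ _
      rw [smul_assoc, coe_borelHom_mono]
      exact nsmul_mem (Submodule.subset_span (Set.mem_range_self _)) _
    · by_cases hk : k = 0
      · rw [hk, divPow_zero, one_smul]
        exact Submodule.subset_span ⟨s, rfl⟩
      · have hc : Commute (divPow (eVec γ) k) (highOp s) := by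
          refine Commute.list_prod_right _ _ fun x hx => ?_
          obtain ⟨e, -, rfl⟩ := List.mem_map.mp hx
          exact divPow_commute (eVec_commute_phi h _) _ _
        have h0 : divPow (eVec γ) k • extremalVec (tauWeight i ℓ) (tauWord m) = 0 := by
          apply hΘ
          rw [hΘ1, hΘ2, map_zero, map_divPow]
          exact divPow_apply_eq_zero (tensHom_eVec_tauVec i.2 ℓ h hγ) hk
        rw [smul_smul, hc.eq, mul_smul, h0, smul_zero]
        exact zero_mem _

theorem binom_smul_mem_tauSpan (j : Fin (2 * m)) (k : ℕ) (s : Edge m (i + 1) →₀ ℕ) :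
    binom (hVec j) k • highOp s • extremalVec (tauWeight i ℓ) (tauWord m) ∈ tauSpan i ℓ := by
  obtain ⟨Θ, hΘ, hΘ1, hΘ2⟩ := exists_realization_tau m i ℓ
  obtain ⟨c, hc⟩ := exists_int_tensHom_hVec (r := i + 1) i.2 ℓ j s
  have h1 : binom (hVec j) k • highOp s • extremalVec (tauWeight i ℓ) (tauWord m) =
      Ring.choose c k • highOp s • extremalVec (tauWeight i ℓ) (tauWord m) := by
    apply hΘ
    rw [hΘ1, map_zsmul, hΘ1, hΘ2, map_binom]
    exact binom_apply_of_eigenvector hc k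
  rw [h1]
  exact Submodule.smul_mem _ _ (Submodule.subset_span ⟨s, rfl⟩)

theorem smul_mem_tauSpan {x : U (2 * m)} (hx : x ∈ UZb (2 * m)) :
    ∀ v ∈ tauSpan i ℓ, x • v ∈ tauSpan i ℓ := by
  induction hx using Algebra.adjoin_induction with
  | mem x hx =>
    intro v hv
    induction hv using Submodule.span_induction with
    | zero => rw [smul_zero]; exact zero_mem _
    | add a b _ _ ha hb => rw [smul_add]; exact add_mem ha hb
    | smul c a _ ha => rw [smul_comm]; exact Submodule.smul_mem _ c ha
    | mem a ha =>
      obtain ⟨s, rfl⟩ := ha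
      rcases hx with ⟨γ, k, rfl⟩ | ⟨j, k, rfl⟩
      · exact eVec_smul_mem_tauSpan i ℓ γ k s
      · exact binom_smul_mem_tauSpan i ℓ j k s
  | algebraMap c =>
    intro v hv
    rw [eq_intCast, Int.cast_smul_eq_zsmul]
    exact Submodule.smul_mem _ c hv
  | add x y _ _ hx hy =>
    intro v hv
    rw [add_smul]
    exact add_mem (hx v hv) (hy v hv)
  | mul x y _ _ hx hy =>
    intro v hv
    rw [mul_smul]
    exact hx _ (hy v hv)

/-- The Demazure module is generated by the extremal vector over the divided power algebra. -/
theorem exists_smul_tauGen (y : demazure (tauWeight i ℓ) (tauWord m)) :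
    ∃ x : SZ m, x • tauGen i ℓ = y := by
  obtain ⟨b, hb⟩ := Submodule.mem_span_singleton.mp y.2
  have hy : (y : V (tauWeight i ℓ)) ∈ tauSpan i ℓ := by
    rw [← hb]
    refine smul_mem_tauSpan i ℓ b.2 _ (Submodule.subset_span ⟨0, ?_⟩)
    change highOp 0 • _ = _
    rw [← coe_borelHom_mono, mono_zero, map_one, OneMemClass.coe_one, one_smul]
  obtain ⟨c, hc⟩ := Finsupp.mem_span_range_iff_exists_finsupp.mp hy
  refine ⟨∑ s ∈ c.support, c s • mono s, Subtype.ext ?_⟩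
  rw [← hc, Finset.sum_smul, Submodule.coe_sum]
  refine Finset.sum_congr rfl fun s _ => ?_
  rw [smul_assoc, Submodule.coe_smul_of_tower, coe_smul_tauGen, coe_borelHom_mono]

/-- Two cyclic modules whose generators have equal annihilators are both the quotient of the algebra
by that annihilator. -/
theorem nonempty_linearEquiv : Nonempty (demazure (tauWeight i ℓ) (tauWord m) ≃ₗ[SZ m]
    Va ((ℓ : ℤ) • fundWeight i)) := by
  have hker : LinearMap.ker (LinearMap.toSpanSingleton (SZ m) _ (tauGen i ℓ)) =
      LinearMap.ker (LinearMap.toSpanSingleton (SZ m) _ (grGen ((ℓ : ℤ) • fundWeight i))) := by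
    ext x
    exact ⟨smul_grGen_eq_zero_of_smul_tauGen i ℓ, smul_tauGen_eq_zero_of_smul_grGen i ℓ⟩
  exact ⟨((LinearMap.toSpanSingleton (SZ m) _ (tauGen i ℓ)).quotKerEquivOfSurjective
    (exists_smul_tauGen i ℓ)).symm ≪≫ₗ Submodule.quotEquivOfEq _ _ hker ≪≫ₗ
      (LinearMap.toSpanSingleton (SZ m) _ (grGen ((ℓ : ℤ) • fundWeight i))).quotKerEquivOfSurjective
        exists_smul_grGen⟩

end Demazure

end

end SympPBW

end

theorem mainTheorem10 (m : ℕ) (i : Fin m) (ℓ : ℕ) :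
    (SympPBW.demazure (SympPBW.Psi ((ℓ : ℤ) • SympPBW.fundWeight i)) (SympPBW.tauWord m) :
        Set (SympPBW.V (SympPBW.Psi ((ℓ : ℤ) • SympPBW.fundWeight i)))) ⊆
      SympPBW.VZ (SympPBW.Psi ((ℓ : ℤ) • SympPBW.fundWeight i)) ∧
    Nonempty
      (SympPBW.demazure (SympPBW.Psi ((ℓ : ℤ) • SympPBW.fundWeight i)) (SympPBW.tauWord m)
        ≃ₗ[SympPBW.SZ m] SympPBW.Va ((ℓ : ℤ) • SympPBW.fundWeight i)) :=
  ⟨SympPBW.demazure_subset_VZ _, SympPBW.nonempty_linearEquiv i ℓ⟩
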